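/- Let $n>1$, let $B^n$ be the open unit ball of $\mathbb C^n$ and $d\sigma$ the (unnormalized) surface measure on $\partial B^n$. A $C^2$ function $f:B^n\to\mathbb C$ is called $M$-harmonic if it is annihilated by the invariant Laplacian $$\widetilde\Delta=4(1-|z|^2)\sum_{j,k=1}^n(\delta_{jk}-z_j\overline z_k)\frac{\partial^2}{\partial z_j\partial\overline z_k}.$$ The $M$-harmonic Hardy space $H^2_{Mh}(B^n)$ consists of the $M$-harmonic $f$ with $\sup_{0<r<1}\int_{\partial B^n}|f(r\zeta)|^2\,d\sigma(\zeta)<\infty$. Let $K$ be its reproducing kernel (the $M$-harmonic Szegő kernel), i.e. the function on $B^n\times B^n$, $M$-harmonic in both variables, with $K(x,\cdot)\in H^2_{Mh}(B^n)$ for each $x\in B^n$ and $$f(x)=\int_{\partial B^n}f(\zeta)K(x,\zeta)\,d\sigma(\zeta)\qquad\text{for all } f\in H^2_{Mh}(B^n),\ x\in B^n,$$ where $f(\zeta)$ and $K(x,\zeta)$ on $\partial B^n$ denote radial boundary values of $f$ and $K(x,\cdot)$. Let $X=\overline{B^n\times B^n}\setminus\{(\zeta,\zeta):\zeta\in\partial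 B^n\}$, and say that $K\in C^m(X)$ if $K$ has an extension to $X$ which is of class $C^m$ (in the real sense, up to the boundary) on $X$. Then $$K\in C^{n-1}(X)\setminus C^n(X).$$ Moreover, a $(1-t)^n\log(1-t)$ singularity occurs: there are $\zeta\in\partial B^n$, $w\in B^n$ and functions $a,b$ that are $C^\infty$ in a neighbourhood of $t=1$, with $b(1)\ne0$, such that for all $t<1$ sufficiently close to $1$ $$K(t\zeta,w)=a(t)+b(t)\,(1-t)^n\log(1-t).$$ -/

import Mathlib

open MeasureTheory Filter Topology
open scoped ContDiff

noncomputable section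

/-- The complex space `ℂⁿ` with its Euclidean norm (smoothness is always over `ℝ`). -/
abbrev Cn (n : ℕ) : Type := EuclideanSpace ℂ (Fin n)

/-- The open unit ball `Bⁿ` of `ℂⁿ`. -/
def unitBall (n : ℕ) : Set (Cn n) := Metric.ball 0 1

/-- The (unnormalized) surface measure `dσ` on the unit sphere of `ℂⁿ`, of total mass
`2 πⁿ / (n-1)!`. -/
def surfaceMeasure (n : ℕ) : Measure (Metric.sphere (0 : Cn n) 1) :=
  (volume : Measure (Cn n)).toSphere

/-- The Wirtinger derivative `∂f/∂z_j = (∂f/∂x_j - i ∂f/∂y_j) / 2`. -/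
def wirtinger {n : ℕ} (j : Fin n) (f : Cn n → ℂ) (z : Cn n) : ℂ :=
  (1 / 2) * (fderiv ℝ f z (EuclideanSpace.single j 1)
    - Complex.I * fderiv ℝ f z (EuclideanSpace.single j Complex.I))

/-- The Wirtinger derivative `∂f/∂z̄_j = (∂f/∂x_j + i ∂f/∂y_j) / 2`. -/
def wirtingerBar {n : ℕ} (j : Fin n) (f : Cn n → ℂ) (z : Cn n) : ℂ :=
  (1 / 2) * (fderiv ℝ f z (EuclideanSpace.single j 1)
    + Complex.I * fderiv ℝ f z (EuclideanSpace.single j Complex.I))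

/-- The invariant Laplacian
`4 (1 - |z|²) ∑_{j,k} (δ_{jk} - z_j z̄_k) ∂²f / ∂z_j ∂z̄_k`. -/
def invLaplacian {n : ℕ} (f : Cn n → ℂ) (z : Cn n) : ℂ :=
  4 * (1 - (‖z‖ : ℂ) ^ 2) * ∑ j : Fin n, ∑ k : Fin n,
    ((if j = k then 1 else 0) - z j * (starRingEnd ℂ) (z k))
      * wirtinger j (wirtingerBar k f) z

/-- `f` is M-harmonic on the unit ball: it is `C²` there and annihilated by the invariant
Laplacian.  Only the values of `f` on the open ball matter. -/
def MHarmonic {n : ℕ} (f : Cn n → ℂ) : Prop :=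
  ContDiffOn ℝ 2 f (unitBall n) ∧ ∀ z ∈ unitBall n, invLaplacian f z = 0

/-- Membership in the M-harmonic Hardy space `H²` of the ball: M-harmonic functions whose
square means over the spheres of radius `r < 1` are bounded. -/
def MemHardy {n : ℕ} (f : Cn n → ℂ) : Prop :=
  MHarmonic f ∧ ∃ C : ℝ, ∀ r : ℝ, 0 < r → r < 1 →
    ∫ ζ, ‖f (r • (ζ : Cn n))‖ ^ 2 ∂(surfaceMeasure n) ≤ C

/-- `g` gives the radial boundary values of `f` on the unit sphere:
`f (r ζ) → g ζ` as `r → 1⁻`, for almost every `ζ`. -/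
def IsRadialBoundaryValue {n : ℕ} (f : Cn n → ℂ)
    (g : Metric.sphere (0 : Cn n) 1 → ℂ) : Prop :=
  ∀ᵐ ζ : Metric.sphere (0 : Cn n) 1 ∂(surfaceMeasure n),
    Tendsto (fun r : ℝ => f (r • (ζ : Cn n))) (𝓝[<] 1) (𝓝 (g ζ))

/-- `K` is (on `Bⁿ × Bⁿ`) the M-harmonic Szegő kernel, i.e. the reproducing kernel of the
M-harmonic Hardy space: it is M-harmonic in both variables, `K x ·` belongs to the Hardy space
and has radial boundary values, and `f x = ∫ f ζ K(x, ζ) dσ(ζ)` for every `f` in the Hardy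
space, where `f ζ` and `K(x, ζ)` stand for the radial boundary values. -/
structure IsSzegoKernel (n : ℕ) (K : Cn n → Cn n → ℂ) : Prop where
  mharmonic_left : ∀ y ∈ unitBall n, MHarmonic (fun x => K x y)
  memHardy_right : ∀ x ∈ unitBall n, MemHardy (fun y => K x y)
  reproducing : ∀ x ∈ unitBall n, ∃ k : Metric.sphere (0 : Cn n) 1 → ℂ,
    IsRadialBoundaryValue (fun y => K x y) k ∧
    ∀ (f : Cn n → ℂ) (g : Metric.sphere (0 : Cn n) 1 → ℂ),
      MemHardy f → IsRadialBoundaryValue f g →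
        f x = ∫ ζ, g ζ * k ζ ∂(surfaceMeasure n)

/-- The closure of `Bⁿ × Bⁿ` with the boundary diagonal `{(ζ, ζ) : |ζ| = 1}` removed. -/
def closedBallsMinusBoundaryDiagonal (n : ℕ) : Set (Cn n × Cn n) :=
  closure (unitBall n ×ˢ unitBall n) \ {p | p.1 = p.2 ∧ ‖p.1‖ = 1}

/-- The function `K` on `Bⁿ × Bⁿ` is of class `C^m` on the closure of `Bⁿ × Bⁿ` minus the
boundary diagonal: it has an extension to that set which is `C^m` up to the boundary. -/
def IsCmUpToBoundary (n m : ℕ) (K : Cn n → Cn n → ℂ) : Prop :=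
  ∃ F : Cn n × Cn n → ℂ,
    ContDiffOn ℝ m F (closedBallsMinusBoundaryDiagonal n) ∧
    ∀ x ∈ unitBall n, ∀ y ∈ unitBall n, F (x, y) = K x y

/-- `K` has a singularity of type `(1-t)^n log (1-t)` at the boundary: along the radius through
some boundary point `ζ`, for some fixed `w` in the ball, `K (tζ, w)` equals
`a(t) + b(t) (1-t)^n log (1-t)` for `t < 1` near `1`, where `a`, `b` are smooth near `1` and
`b 1 ≠ 0`. -/
def HasLogSingularity (n : ℕ) (K : Cn n → Cn n → ℂ) : Prop :=
  ∃ ζ : Cn n, ‖ζ‖ = 1 ∧ ∃ w ∈ unitBall n, ∃ a b : ℝ → ℂ,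
    ContDiffAt ℝ ∞ a 1 ∧ ContDiffAt ℝ ∞ b 1 ∧ b 1 ≠ 0 ∧
    ∀ᶠ t : ℝ in 𝓝[<] 1,
      K (t • ζ) w = a t + b t * (((1 - t) ^ n * Real.log (1 - t) : ℝ) : ℂ)

end

/-!
Write `⟨z, w⟩` for the Hermitian product that is linear in `z`, and let
`P(x, ζ) = (1 - |x|²)ⁿ / |1 - ⟨x, ζ⟩|²ⁿ` be the Poisson-Szegő kernel. It is M-harmonic in `x`, and
the Poisson-Szegő integral of a continuous function `g` belongs to the Hardy space and has the
boundary values `g` (`poissonIntegral_memHardy`, `poissonIntegral_boundary`). The reproducing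
property, tested on these functions, forces the boundary values of `K(x, ·)` to be `P(x, ·) / σ`,
where `σ` is the mass of the sphere (`boundary_values_eq_poisson`). Applied once more, to
`K(x, ·)`, it gives `K(x, y) = σ⁻² ∫ P(x, ζ) P(y, ζ) dσ(ζ)` (`szego_eq_integral`), so everything
is decided by `sphereQuad x y`, the integral of `|1 - ⟨x, ζ⟩|^(-2n) |1 - ⟨y, ζ⟩|^(-2n)`.

Two Feynman parametrizations merge the holomorphic and the antiholomorphic factors of the
integrand into powers at points of the segment between `x` and `y`. The resulting integral over
the sphere is a finite combination of powers of `1 - ⟨u, v⟩`, because the coefficients of its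
power series, in which binomial coefficients are weighted by the moments of the sphere, are
polynomials in the index (`exists_choose_expansion`). One segment parameter can be integrated out,
the other leaves one-dimensional integrals `segInt` of products of powers of two affine functions
(`sphereQuad_eq`). A recursion reduces these to `∫₀¹ ds / ((s a + (1-s) b)(s c + (1-s) d))`, which
is `(log b + log c - log a - log d) / (bc - ad)`; here `a = 1 - |x|²`, `d = 1 - |y|²`,
`bc = |1 - ⟨x, y⟩|²`. This gives `segInt_expansion`, and then `K(x, y) = A + B sⁿ log s` with
`s = (1 - |x|²)(1 - |y|²)` and `A`, `B` smooth up to the boundary away from the boundary diagonal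
(`exists_szego_expansion`).

Since `sⁿ log s` is of class `Cⁿ⁻¹`, so is `K`. For the converse and for the logarithmic
singularity it is enough that `B` is not zero at some point with `|x| = 1`, `|y| < 1`. If
`⟨x, y⟩ = 0`, then `B` is a polynomial in `1 - |y|²`, whose coefficient of degree `n` comes from a
single term of the sum and can be seen not to vanish (`exists_log_coeff_ne_zero`). On the radius
through such an `x`, the function `B sⁿ log s` is not of class `Cⁿ` up to the end point
(`not_contDiffOn_mul_pow_mul_log`).
-/

noncomputable section

/-! ### Moments of the surface measure -/

theorem finrank_real_Cn (n : ℕ) : Module.finrank ℝ (Cn n) = 2 * n := by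
  rw [← Module.finrank_mul_finrank ℝ ℂ (Cn n), finrank_euclideanSpace_fin,
    Complex.finrank_real_complex]

theorem nontrivial_Cn {n : ℕ} (hn : 0 < n) : Nontrivial (Cn n) :=
  Module.nontrivial_of_finrank_pos (R := ℝ) (by rw [finrank_real_Cn]; omega)

/-- Polar coordinates for a product of an angular and a radial function. -/
theorem integral_polar {n : ℕ} (hn : 0 < n) (f : Metric.sphere (0 : Cn n) 1 → ℂ) (g : ℝ → ℂ)
    (F : Cn n → ℂ)
    (hF : ∀ ζ : Metric.sphere (0 : Cn n) 1, ∀ r : ℝ, 0 < r → F (r • (ζ : Cn n)) = f ζ * g r) :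
    ∫ z, F z = (∫ ζ, f ζ ∂(surfaceMeasure n)) *
      ∫ r : Set.Ioi (0 : ℝ), g r ∂(Measure.volumeIoiPow (Module.finrank ℝ (Cn n) - 1)) := by
  have := nontrivial_Cn hn
  calc
    ∫ z, F z = ∫ z : ({(0)}ᶜ : Set (Cn n)), F (z : Cn n)
        ∂((volume : Measure (Cn n)).comap Subtype.val) := by
      rw [integral_subtype_comap (measurableSet_singleton _).compl F,
        restrict_compl_singleton]
    _ = ∫ p, f p.1 * g p.2 ∂((volume : Measure (Cn n)).toSphere.prod
          (.volumeIoiPow (Module.finrank ℝ (Cn n) - 1))) := by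
      rw [← (volume : Measure (Cn n)).measurePreserving_homeomorphUnitSphereProd.integral_comp
        (Homeomorph.measurableEmbedding _)]
      refine integral_congr_ae (.of_forall fun z => ?_)
      have hz : (z : Cn n) ≠ 0 := z.2
      have hz' : 0 < ‖(z : Cn n)‖ := norm_pos_iff.2 hz
      have := hF (homeomorphUnitSphereProd (Cn n) z).1 (homeomorphUnitSphereProd (Cn n) z).2
        (homeomorphUnitSphereProd (Cn n) z).2.2
      simp only [homeomorphUnitSphereProd_apply_fst_coe, homeomorphUnitSphereProd_apply_snd_coe,
        smul_smul, mul_inv_cancel₀ hz'.ne', one_smul] at this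
      simpa using this
    _ = _ := by
      rw [surfaceMeasure]
      exact integral_prod_mul f (fun r : Set.Ioi (0 : ℝ) => g r)

theorem integral_volumeIoiPow (m : ℕ) (g : ℝ → ℂ) :
    ∫ r : Set.Ioi (0 : ℝ), g r ∂(Measure.volumeIoiPow m) =
      ∫ r in Set.Ioi (0 : ℝ), (r : ℂ) ^ m * g r := by
  simp only [Measure.volumeIoiPow, ENNReal.ofReal]
  rw [integral_withDensity_eq_integral_smul,
    integral_subtype_comap measurableSet_Ioi fun a ↦ Real.toNNReal (a ^ m) • g a,
    setIntegral_congr_fun measurableSet_Ioi fun x hx ↦ ?_]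
  · have : (0:ℝ) ≤ x ^ m := pow_nonneg (le_of_lt hx) _
    simp only [NNReal.smul_def, Real.coe_toNNReal _ this, Complex.real_smul, Complex.ofReal_pow]
  · exact (measurable_subtype_coe.pow_const _).real_toNNReal

theorem integral_radial {n : ℕ} (hn : 0 < n) (m : ℕ) :
    ∫ r in Set.Ioi (0 : ℝ), (r : ℂ) ^ (2 * n - 1) * ((r : ℂ) ^ m * (Real.exp (-r ^ 2) : ℂ)) =
      (Real.Gamma ((2 * n + m) / 2) / 2 : ℝ) := by
  have h := integral_rpow_mul_exp_neg_rpow (p := 2) (q := (2 * n - 1 + m : ℕ)) (by norm_num)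
    (by have : (0:ℝ) ≤ ((2 * n - 1 + m : ℕ) : ℝ) := by positivity
        linarith)
  have h2 : (((2 * n - 1 + m : ℕ) : ℝ) + 1) = 2 * n + m := by
    norm_cast
    omega
  rw [h2] at h
  have h3 : ∫ r in Set.Ioi (0 : ℝ), (r : ℂ) ^ (2 * n - 1) * ((r : ℂ) ^ m * (Real.exp (-r ^ 2) : ℂ))
     = ∫ r in Set.Ioi (0 : ℝ), ((r ^ ((2 * n - 1 + m : ℕ) : ℝ) * Real.exp (-r ^ (2:ℝ)) : ℝ) : ℂ) := by
    refine setIntegral_congr_fun measurableSet_Ioi fun x hx => ?_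
    have hr : x ^ (2:ℝ) = x ^ 2 := by
      rw [← Real.rpow_natCast]; norm_num
    simp only [Real.rpow_natCast, hr]
    push_cast
    rw [pow_add]; ring
  rw [h3, integral_complex_ofReal, h]
  push_cast; ring

theorem integrable_pow_mul_gauss {n : ℕ} (hn : 0 < n) (m : ℕ) :
    Integrable (fun z : Cn n => ‖z‖ ^ m * Real.exp (-‖z‖ ^ 2)) := by
  have := nontrivial_Cn hn
  rw [integrable_fun_norm_addHaar (volume : Measure (Cn n)) (f := fun r => r ^ m * Real.exp (-r ^ 2))]
  have := integrableOn_rpow_mul_exp_neg_rpow (p := 2)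
    (s := ((Module.finrank ℝ (Cn n) - 1 + m : ℕ) : ℝ))
    (by have : (0:ℝ) ≤ ((Module.finrank ℝ (Cn n) - 1 + m : ℕ) : ℝ) := by positivity
        linarith) (by norm_num)
  refine this.congr_fun (fun x hx => ?_) measurableSet_Ioi
  have hr : x ^ (2:ℝ) = x ^ 2 := by
    rw [← Real.rpow_natCast]; norm_num
  simp only [Real.rpow_natCast, hr, smul_eq_mul, pow_add]
  ring

/-- A continuous function of polynomial growth is integrable against the Gaussian weight. -/
theorem integrable_gauss_of_bound {n : ℕ} (hn : 0 < n) (m : ℕ) (C : ℝ) (f : Cn n → ℂ)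
    (hf : Continuous f) (hb : ∀ z, ‖f z‖ ≤ C * ‖z‖ ^ m) :
    Integrable (fun z : Cn n => f z * (Real.exp (-‖z‖ ^ 2) : ℂ)) := by
  refine ((integrable_pow_mul_gauss hn m).const_mul C).mono' (by fun_prop) (.of_forall fun z => ?_)
  rw [norm_mul, Complex.norm_real, Real.norm_of_nonneg (Real.exp_pos _).le, ← mul_assoc]
  exact mul_le_mul_of_nonneg_right (hb z) (Real.exp_pos _).le

theorem norm_inner_pow_mul_le {n : ℕ} (u v z : Cn n) (k l : ℕ) :
    ‖inner ℂ v z ^ k * inner ℂ z u ^ l‖ ≤ (‖v‖ ^ k * ‖u‖ ^ l) * ‖z‖ ^ (k + l) := by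
  rw [norm_mul, norm_pow, norm_pow, pow_add]
  calc _ ≤ (‖v‖ * ‖z‖) ^ k * (‖z‖ * ‖u‖) ^ l := by
        gcongr <;> exact norm_inner_le_norm _ _
    _ = _ := by rw [mul_pow, mul_pow]; ring

theorem real_inner_Cn {n : ℕ} (z w : Cn n) : inner ℝ z w = (inner ℂ z w).re := by
  simp [PiLp.inner_apply, Complex.inner]

theorem fderiv_gauss {n : ℕ} (z w : Cn n) :
    fderiv ℝ (fun z : Cn n => (Real.exp (-‖z‖ ^ 2) : ℂ)) z w =
      -(inner ℂ z w + inner ℂ w z) * (Real.exp (-‖z‖ ^ 2) : ℂ) := by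
  have h1 : HasFDerivAt (fun z : Cn n => -‖z‖ ^ 2) (-(2 • (innerSL ℝ z))) z :=
    (hasStrictFDerivAt_norm_sq z).hasFDerivAt.neg
  have h3 := Complex.ofRealCLM.hasFDerivAt.comp z h1.exp
  have h4 : fderiv ℝ (fun z : Cn n => (Real.exp (-‖z‖ ^ 2) : ℂ)) z = _ := h3.fderiv
  rw [h4]
  have h5 : inner ℂ z w + inner ℂ w z = ((2 * inner ℝ z w : ℝ) : ℂ) := by
    rw [real_inner_Cn, ← inner_conj_symm w z, Complex.add_conj]
  rw [h5]
  simp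
  ring

theorem hasFDerivAt_inner_pow {n : ℕ} (u v z : Cn n) (k l : ℕ) :
    ∃ L : Cn n →L[ℝ] ℂ, HasFDerivAt (fun z : Cn n => inner ℂ v z ^ k * inner ℂ z u ^ l) L z ∧
      ∀ w, L w = k * inner ℂ v z ^ (k - 1) * inner ℂ v w * inner ℂ z u ^ l +
        inner ℂ v z ^ k * (l * inner ℂ z u ^ (l - 1) * inner ℂ w u) := by
  have h1 : HasFDerivAt (fun z : Cn n => inner ℂ v z) ((innerSL ℂ v).restrictScalars ℝ) z :=
    ((innerSL ℂ v).restrictScalars ℝ).hasFDerivAt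
  have h2 : HasFDerivAt (fun z : Cn n => inner ℂ z u)
      (Complex.conjCLE.toContinuousLinearMap ∘L (innerSL ℂ u).restrictScalars ℝ) z := by
    have := (Complex.conjCLE.toContinuousLinearMap ∘L (innerSL ℂ u).restrictScalars ℝ).hasFDerivAt
      (x := z)
    exact this.congr_of_eventuallyEq (.of_forall fun z => by simp)
  refine ⟨_, (h1.pow k).mul (h2.pow l), fun w => ?_⟩
  simp
  ring

/-- The Gaussian moment `∫ ⟨z, v⟩ᵏ ⟨u, z⟩ˡ exp (-|z|²) dz`, with `⟨z, w⟩` linear in `z`, that is,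
`inner ℂ w z`. -/
def gaussMoment {n : ℕ} (u v : Cn n) (k l : ℕ) : ℂ :=
  ∫ z : Cn n, inner ℂ v z ^ k * inner ℂ z u ^ l * (Real.exp (-‖z‖ ^ 2) : ℂ)

theorem integrable_gaussMoment {n : ℕ} (hn : 0 < n) (u v : Cn n) (k l : ℕ) :
    Integrable (fun z : Cn n => inner ℂ v z ^ k * inner ℂ z u ^ l * (Real.exp (-‖z‖ ^ 2) : ℂ)) :=
  integrable_gauss_of_bound hn (k + l) _ _ (by fun_prop) (norm_inner_pow_mul_le u v · k l)

/-- Integration by parts in the real direction `w` against the Gaussian weight. -/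
theorem gaussMoment_by_parts {n : ℕ} (hn : 0 < n) (u v w : Cn n) (k l : ℕ) :
    ∫ z : Cn n, inner ℂ v z ^ k * inner ℂ z u ^ l * ((inner ℂ z w + inner ℂ w z) *
        (Real.exp (-‖z‖ ^ 2) : ℂ)) =
      k * inner ℂ v w * gaussMoment u v (k - 1) l +
        l * inner ℂ w u * gaussMoment u v k (l - 1) := by
  have hd : ∀ z w, fderiv ℝ (fun z : Cn n => inner ℂ v z ^ k * inner ℂ z u ^ l) z w =
      k * inner ℂ v z ^ (k - 1) * inner ℂ v w * inner ℂ z u ^ l +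
        inner ℂ v z ^ k * (l * inner ℂ z u ^ (l - 1) * inner ℂ w u) := by
    intro z w
    obtain ⟨L, hL, hw⟩ := hasFDerivAt_inner_pow u v z k l
    rw [hL.fderiv, hw]
  have hi : ∀ a b, Integrable (fun z : Cn n => inner ℂ v z ^ a * inner ℂ z u ^ b *
      (Real.exp (-‖z‖ ^ 2) : ℂ)) := integrable_gaussMoment hn u v
  have e1 : ∀ z : Cn n, (k * inner ℂ v z ^ (k - 1) * inner ℂ v w * inner ℂ z u ^ l +
        inner ℂ v z ^ k * (l * inner ℂ z u ^ (l - 1) * inner ℂ w u)) * (Real.exp (-‖z‖ ^ 2) : ℂ) =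
      k * inner ℂ v w * (inner ℂ v z ^ (k - 1) * inner ℂ z u ^ l * (Real.exp (-‖z‖ ^ 2) : ℂ)) +
      l * inner ℂ w u * (inner ℂ v z ^ k * inner ℂ z u ^ (l - 1) * (Real.exp (-‖z‖ ^ 2) : ℂ)) := by
    intro z; ring
  have hI1 : Integrable (fun z : Cn n => (k * inner ℂ v z ^ (k - 1) * inner ℂ v w * inner ℂ z u ^ l +
        inner ℂ v z ^ k * (l * inner ℂ z u ^ (l - 1) * inner ℂ w u)) *
          (Real.exp (-‖z‖ ^ 2) : ℂ)) := by
    simp_rw [e1]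
    exact ((hi _ _).const_mul _).add ((hi _ _).const_mul _)
  have hI2 : Integrable (fun z : Cn n => inner ℂ v z ^ k * inner ℂ z u ^ l *
      (-(inner ℂ z w + inner ℂ w z) * (Real.exp (-‖z‖ ^ 2) : ℂ))) := by
    have := integrable_gauss_of_bound hn (k + l + 1) ((‖v‖ ^ k * ‖u‖ ^ l) * (2 * ‖w‖))
      (fun z : Cn n => inner ℂ v z ^ k * inner ℂ z u ^ l * (-(inner ℂ z w + inner ℂ w z)))
      (by fun_prop) (fun z => by
        rw [norm_mul, norm_neg, pow_succ]
        have h1 := norm_inner_pow_mul_le u v z k l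
        have h2 : ‖inner ℂ z w + inner ℂ w z‖ ≤ 2 * ‖w‖ * ‖z‖ := by
          refine (norm_add_le _ _).trans ?_
          have := norm_inner_le_norm (𝕜 := ℂ) z w
          have := norm_inner_le_norm (𝕜 := ℂ) w z
          linarith
        calc _ ≤ ((‖v‖ ^ k * ‖u‖ ^ l) * ‖z‖ ^ (k + l)) * (2 * ‖w‖ * ‖z‖) := by gcongr
          _ = _ := by ring)
    simpa only [mul_assoc] using this
  have key := integral_mul_fderiv_eq_neg_fderiv_mul_of_integrable (μ := (volume : Measure (Cn n)))
    (f := fun z : Cn n => inner ℂ v z ^ k * inner ℂ z u ^ l)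
    (g := fun z : Cn n => (Real.exp (-‖z‖ ^ 2) : ℂ)) (v := w)
    (by simpa only [hd] using hI1) (by simpa only [fderiv_gauss] using hI2) (hi k l)
    (fun z _ => (hasFDerivAt_inner_pow u v z k l).choose_spec.1.differentiableAt)
    (fun z _ => by
      have h1 : HasFDerivAt (fun z : Cn n => -‖z‖ ^ 2) (-(2 • (innerSL ℝ z))) z :=
        (hasStrictFDerivAt_norm_sq z).hasFDerivAt.neg
      exact (Complex.ofRealCLM.hasFDerivAt.comp z h1.exp).differentiableAt)
  simp only [hd, fderiv_gauss, e1, neg_mul, mul_neg, integral_neg, neg_inj] at key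
  rw [key, integral_add ((hi _ _).const_mul _) ((hi _ _).const_mul _), integral_const_mul,
    integral_const_mul]
  rfl

/-- Integration by parts with the operator `∂/∂z` in the direction of `u`, which annihilates
`⟨u, z⟩`. -/
theorem gaussMoment_succ_right {n : ℕ} (hn : 0 < n) (u v : Cn n) (k l : ℕ) :
    gaussMoment u v k (l + 1) = k * inner ℂ v u * gaussMoment u v (k - 1) l := by
  have h1 := gaussMoment_by_parts hn u v u k l
  have h2 := gaussMoment_by_parts hn u v (Complex.I • u) k l
  have hint : Integrable fun z : Cn n => inner ℂ v z ^ k * inner ℂ z u ^ l *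
      ((inner ℂ z u + inner ℂ u z) * (Real.exp (-‖z‖ ^ 2) : ℂ)) := by
    have := integrable_gauss_of_bound hn (k + l + 1) ((‖v‖ ^ k * ‖u‖ ^ l) * (2 * ‖u‖))
      (fun z : Cn n => inner ℂ v z ^ k * inner ℂ z u ^ l * (inner ℂ z u + inner ℂ u z))
      (by fun_prop) (fun z => by
        rw [norm_mul, pow_succ]
        have h1 := norm_inner_pow_mul_le u v z k l
        have h2 : ‖inner ℂ z u + inner ℂ u z‖ ≤ 2 * ‖u‖ * ‖z‖ := by
          refine (norm_add_le _ _).trans ?_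
          have := norm_inner_le_norm (𝕜 := ℂ) z u
          have := norm_inner_le_norm (𝕜 := ℂ) u z
          linarith
        calc _ ≤ ((‖v‖ ^ k * ‖u‖ ^ l) * ‖z‖ ^ (k + l)) * (2 * ‖u‖ * ‖z‖) := by gcongr
          _ = _ := by ring)
    simpa only [mul_assoc] using this
  have h4 : ∫ z : Cn n, inner ℂ v z ^ k * inner ℂ z u ^ l *
      ((inner ℂ z (Complex.I • u) + inner ℂ (Complex.I • u) z) *
        (Real.exp (-‖z‖ ^ 2) : ℂ)) = Complex.I * (2 * gaussMoment u v k (l + 1) -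
      ∫ z : Cn n, inner ℂ v z ^ k * inner ℂ z u ^ l * ((inner ℂ z u + inner ℂ u z) *
        (Real.exp (-‖z‖ ^ 2) : ℂ))) := by
    rw [gaussMoment, ← integral_const_mul,
      ← integral_sub ((integrable_gaussMoment hn u v k (l + 1)).const_mul _) hint,
      ← integral_const_mul]
    congr 1
    ext z
    simp only [inner_smul_left, inner_smul_right, Complex.conj_I]
    ring
  rw [h4, h1] at h2
  simp only [inner_smul_left, inner_smul_right, Complex.conj_I] at h2
  linear_combination (-Complex.I / 2) * h2 + (gaussMoment u v k (l + 1)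
     - k * inner ℂ v u * gaussMoment u v (k-1) l) * Complex.I_sq

theorem gaussMoment_conj {n : ℕ} (u v : Cn n) (k l : ℕ) :
    (starRingEnd ℂ) (gaussMoment u v k l) = gaussMoment v u l k := by
  rw [gaussMoment, gaussMoment, ← integral_conj]
  congr 1
  ext z
  simp only [map_mul, map_pow, inner_conj_symm, Complex.conj_ofReal]
  ring

/-- Moments of unequal bidegree vanish: lowering both degrees leads to a derivative of `1`. -/
theorem gaussMoment_of_ne {n : ℕ} (hn : 0 < n) (u v : Cn n) {k l : ℕ} (h : k ≠ l) :
    gaussMoment u v k l = 0 := by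
  induction k generalizing l with
  | zero =>
    obtain ⟨l, rfl⟩ := Nat.exists_eq_succ_of_ne_zero h.symm
    rw [gaussMoment_succ_right hn]; simp
  | succ k ih =>
    cases l with
    | zero =>
      rw [← gaussMoment_conj, gaussMoment_succ_right hn]; simp
    | succ l =>
      rw [gaussMoment_succ_right hn, Nat.add_sub_cancel, ih (by omega), mul_zero]

theorem gaussMoment_self {n : ℕ} (hn : 0 < n) (u v : Cn n) (k : ℕ) :
    gaussMoment u v k k = k.factorial * inner ℂ v u ^ k * gaussMoment u v 0 0 := by
  induction k with
  | zero => simp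
  | succ k ih =>
    rw [gaussMoment_succ_right hn, Nat.add_sub_cancel, ih, Nat.factorial_succ]
    push_cast; ring

/-- The moment `∫ ⟨ζ, v⟩ᵏ ⟨u, ζ⟩ˡ dσ(ζ)` of the surface measure, with `⟨z, w⟩` linear in `z`, that
is, `inner ℂ w z`. -/
def sphereMoment {n : ℕ} (u v : Cn n) (k l : ℕ) : ℂ :=
  ∫ ζ, inner ℂ v (ζ : Cn n) ^ k * inner ℂ (ζ : Cn n) u ^ l ∂(surfaceMeasure n)

/-- Polar coordinates reduce the moments of the sphere to Gaussian moments, for which integration by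
parts is available. -/
theorem gaussMoment_eq_sphereMoment {n : ℕ} (hn : 0 < n) (u v : Cn n) (k l : ℕ) :
    gaussMoment u v k l = sphereMoment u v k l *
      (Real.Gamma ((2 * n + (k + l : ℕ)) / 2) / 2 : ℝ) := by
  rw [gaussMoment, integral_polar hn
    (fun ζ => inner ℂ v (ζ : Cn n) ^ k * inner ℂ (ζ : Cn n) u ^ l)
    (fun r => (r : ℂ) ^ (k + l) * (Real.exp (-r ^ 2) : ℂ)), sphereMoment, finrank_real_Cn,
    integral_volumeIoiPow _ (fun r => (r : ℂ) ^ (k + l) * (Real.exp (-r ^ 2) : ℂ)),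
    integral_radial hn]
  intro ζ r hr
  have h1 : ‖r • (ζ : Cn n)‖ = r := by
    rw [norm_smul, Real.norm_of_nonneg hr.le, norm_eq_of_mem_sphere, mul_one]
  rw [h1, ← Complex.coe_smul, inner_smul_left, inner_smul_right, Complex.conj_ofReal]
  ring

/-- Total mass of the surface measure. -/
def sphereMass (n : ℕ) : ℝ := (surfaceMeasure n).real Set.univ

theorem sphereMass_pos {n : ℕ} (hn : 0 < n) : 0 < sphereMass n := by
  have := nontrivial_Cn hn
  have h : surfaceMeasure n ≠ 0 := Measure.toSphere_ne_zero _
  have : IsFiniteMeasure (surfaceMeasure n) := by unfold surfaceMeasure; infer_instance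
  have : NeZero (surfaceMeasure n) := ⟨h⟩
  exact measureReal_univ_pos

theorem sphereMoment_of_ne {n : ℕ} (hn : 0 < n) (u v : Cn n) {k l : ℕ} (h : k ≠ l) :
    sphereMoment u v k l = 0 := by
  have h1 := gaussMoment_eq_sphereMoment hn u v k l
  rw [gaussMoment_of_ne hn u v h] at h1
  refine (mul_eq_zero.1 h1.symm).resolve_right ?_
  have : 0 < Real.Gamma ((2 * n + (k + l : ℕ)) / 2) := Real.Gamma_pos_of_pos (by positivity)
  exact_mod_cast (div_pos this two_pos).ne'

theorem sphereMoment_self {n : ℕ} (hn : 0 < n) (u v : Cn n) (k : ℕ) :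
    sphereMoment u v k k = sphereMass n / ((n - 1 + k).choose k : ℂ) * inner ℂ v u ^ k := by
  have hG : ∀ k : ℕ, Real.Gamma ((2 * n + (k + k : ℕ)) / 2) = (n - 1 + k).factorial := by
    intro k
    rw [← Real.Gamma_nat_eq_factorial]
    congr 1
    have : ((n - 1 + k : ℕ) : ℝ) + 1 = n + k := by norm_cast; omega
    rw [this]; push_cast; ring
  have h0 := gaussMoment_eq_sphereMoment hn u v 0 0
  have h1 := gaussMoment_eq_sphereMoment hn u v k k
  rw [gaussMoment_self hn, h0, hG k, hG 0] at h1
  have h2 : sphereMoment u v 0 0 = sphereMass n := by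
    simp [sphereMoment, sphereMass]
  rw [h2] at h1
  have h3 : ((n - 1 + k).choose k : ℂ) * k.factorial * (n - 1).factorial =
      (n - 1 + k).factorial := by
    have := Nat.choose_mul_factorial_mul_factorial (n := n - 1 + k) (k := k) (by omega)
    rw [Nat.add_sub_cancel] at this
    exact_mod_cast this
  have h4 : ((n - 1 + k).choose k : ℂ) ≠ 0 := by
    exact_mod_cast (Nat.choose_pos (by omega)).ne'
  have h5 : ((n - 1).factorial : ℂ) ≠ 0 := by exact_mod_cast Nat.factorial_ne_zero _
  have h6 : (k.factorial : ℂ) ≠ 0 := by exact_mod_cast Nat.factorial_ne_zero _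
  push_cast at h1
  rw [← h3] at h1
  simp only [add_zero] at h1
  field_simp at h1 ⊢
  linear_combination -h1

instance isFiniteMeasure_surfaceMeasure (n : ℕ) : IsFiniteMeasure (surfaceMeasure n) := by
  unfold surfaceMeasure; infer_instance

theorem Continuous.integrable_of_compactSpace {X F : Type*} [TopologicalSpace X] [CompactSpace X]
    [MeasurableSpace X] [BorelSpace X] [NormedAddCommGroup F] [SecondCountableTopologyEither X F]
    {μ : Measure X} [IsFiniteMeasure μ] {f : X → F} (hf : Continuous f) : Integrable f μ :=
  hf.integrable_of_hasCompactSupport (HasCompactSupport.of_compactSpace f)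

/-! ### Power series of integrals over the sphere -/

theorem norm_inner_lt_one {n : ℕ} {u : Cn n} (hu : ‖u‖ < 1) (ζ : Metric.sphere (0 : Cn n) 1) :
    ‖inner ℂ (ζ : Cn n) u‖ < 1 ∧ ‖inner ℂ u (ζ : Cn n)‖ < 1 := by
  have hζ := norm_eq_of_mem_sphere ζ
  constructor
  · exact (norm_inner_le_norm _ _).trans_lt (by rwa [hζ, one_mul])
  · exact (norm_inner_le_norm _ _).trans_lt (by rwa [hζ, mul_one])

/-- Expansion of the sphere integral of `(1 - ⟨u, ζ⟩)^(-p-1) (1 - ⟨ζ, v⟩)^(-q-1)` in powers of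
`⟨u, v⟩`: only the diagonal terms of the product of the two binomial series survive. -/
theorem hasSum_sphere_integral {n : ℕ} (hn : 0 < n) {u v : Cn n} (hu : ‖u‖ < 1) (hv : ‖v‖ < 1)
    (p q : ℕ) :
    HasSum (fun k : ℕ => (sphereMass n : ℂ) * (((k + p).choose p : ℂ) * ((k + q).choose q : ℂ) /
      ((n - 1 + k).choose k : ℂ) * inner ℂ v u ^ k))
      (∫ ζ, 1 / (1 - inner ℂ (ζ : Cn n) u) ^ (p + 1) * (1 / (1 - inner ℂ v (ζ : Cn n)) ^ (q + 1))
        ∂(surfaceMeasure n)) := by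
  let F : ℕ × ℕ → Metric.sphere (0 : Cn n) 1 → ℂ := fun kl ζ =>
    ((kl.1 + p).choose p * inner ℂ (ζ : Cn n) u ^ kl.1) *
      ((kl.2 + q).choose q * inner ℂ v (ζ : Cn n) ^ kl.2)
  have hFc : ∀ kl, Continuous (F kl) := fun kl => by fun_prop
  have hsum : ∀ (m : ℕ) (r : ℝ), 0 ≤ r → r < 1 →
      Summable fun k : ℕ => ((k + m).choose m : ℝ) * r ^ k := fun m r h0 h1 =>
    (hasSum_choose_mul_geometric_of_norm_lt_one m (by rwa [Real.norm_of_nonneg h0])).summable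
  have hb : ∀ kl ζ, ‖F kl ζ‖ ≤ ((kl.1 + p).choose p * ‖u‖ ^ kl.1) *
      ((kl.2 + q).choose q * ‖v‖ ^ kl.2) := by
    intro kl ζ
    have hζ := norm_eq_of_mem_sphere ζ
    have h1 := norm_inner_le_norm (𝕜 := ℂ) (ζ : Cn n) u
    have h2 := norm_inner_le_norm (𝕜 := ℂ) v (ζ : Cn n)
    rw [hζ] at h1 h2
    simp only [F, norm_mul, norm_pow, Complex.norm_natCast]
    rw [one_mul] at h1
    rw [mul_one] at h2
    gcongr
  have hsum2 : Summable fun kl : ℕ × ℕ => ((kl.1 + p).choose p * ‖u‖ ^ kl.1) *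
      ((kl.2 + q).choose q * ‖v‖ ^ kl.2) :=
    (hsum p _ (norm_nonneg _) hu).mul_of_nonneg (hsum q _ (norm_nonneg _) hv)
      (fun k => by positivity) (fun k => by positivity)
  have hI : ∀ kl, Integrable (F kl) (surfaceMeasure n) := fun kl =>
    (hFc kl).integrable_of_compactSpace
  have key := hasSum_integral_of_summable_integral_norm (F := F) hI (by
    refine Summable.of_nonneg_of_le (fun kl => integral_nonneg fun _ => norm_nonneg _)
      (fun kl => ?_) (hsum2.mul_left (sphereMass n))
    calc _ ≤ ∫ _ζ : Metric.sphere (0 : Cn n) 1, ((kl.1 + p).choose p * ‖u‖ ^ kl.1) *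
          ((kl.2 + q).choose q * ‖v‖ ^ kl.2) ∂(surfaceMeasure n) :=
          integral_mono (hI kl).norm (integrable_const _) (hb kl)
      _ = _ := by simp [sphereMass])
  have hpt : ∀ ζ : Metric.sphere (0 : Cn n) 1, ∑' kl, F kl ζ =
      1 / (1 - inner ℂ (ζ : Cn n) u) ^ (p + 1) * (1 / (1 - inner ℂ v (ζ : Cn n)) ^ (q + 1)) := by
    intro ζ
    have h1 := hasSum_choose_mul_geometric_of_norm_lt_one p (norm_inner_lt_one hu ζ).1
    have h2 := hasSum_choose_mul_geometric_of_norm_lt_one q (norm_inner_lt_one hv ζ).2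
    exact (h1.mul h2 (Summable.of_norm_bounded hsum2 (hb · ζ))).tsum_eq
  simp_rw [hpt] at key
  have hF : ∀ kl : ℕ × ℕ, ∫ ζ, F kl ζ ∂(surfaceMeasure n) =
      (kl.1 + p).choose p * (kl.2 + q).choose q * sphereMoment u v kl.2 kl.1 := by
    intro kl
    rw [sphereMoment, ← integral_const_mul]
    congr 1; ext ζ
    simp only [F]; ring
  simp_rw [hF] at key
  have hinj : Function.Injective (fun k : ℕ => (k, k)) := fun a b h => (Prod.mk.inj h).1
  rw [← hinj.hasSum_iff] at key
  · refine Eq.mp (congrArg (fun f => HasSum f _) (funext fun k => ?_)) key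
    rw [Function.comp_apply, sphereMoment_self hn]
    ring
  · rintro ⟨k, l⟩ hkl
    rw [sphereMoment_of_ne hn u v (fun h => hkl ⟨k, by rw [show l = k from h]⟩), mul_zero]

/-- The products of the coefficients of two powers `(1 - w)^(-2n)`, weighted by the moments of the
sphere, are a combination of the coefficients of the powers `(1 - w)^(-2n-l)`, `l ≤ n`: up to
constants they are `(n+k)(n+k+1)⋯(2n+k-1) · (2n-1+k)! / k!`, where the first product is a
polynomial in `k` of degree `n`. -/
theorem exists_choose_expansion {n : ℕ} (hn : 0 < n) : ∃ e : ℕ → ℝ, e n ≠ 0 ∧ ∀ k : ℕ,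
    ((k + (2 * n - 1)).choose (2 * n - 1) : ℝ) * ((k + (2 * n - 1)).choose (2 * n - 1) : ℝ) /
      ((n - 1 + k).choose k : ℝ) =
    ∑ l ∈ Finset.range (n + 1), e l * ((k + (2 * n - 1 + l)).choose (2 * n - 1 + l) : ℝ) := by
  -- The polynomial is expanded in the rising factorials of `2n + k`, one linear factor at a time.
  have main : ∀ N : ℕ, ∃ g : ℕ → ℝ, g N = 1 ∧ ∀ k : ℕ,
      ((n + k).ascFactorial N : ℝ) * (2 * n - 1 + k).factorial =
        ∑ l ∈ Finset.range (N + 1), g l * (2 * n - 1 + k + l).factorial := by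
    intro N
    induction N with
    | zero => exact ⟨fun _ => 1, rfl, fun k => by simp⟩
    | succ N ih =>
      obtain ⟨g, hg1, hg⟩ := ih
      refine ⟨fun l => (if l = 0 then 0 else g (l - 1)) +
        (if l = N + 1 then 0 else ((N : ℝ) - n - l) * g l), by simp [hg1], fun k => ?_⟩
      have h1 : ∀ l : ℕ, ((n : ℝ) + k + N) * (2 * n - 1 + k + l).factorial =
          (2 * n - 1 + k + (l + 1)).factorial + ((N : ℝ) - n - l) * (2 * n - 1 + k + l).factorial := by
        intro l
        rw [← add_assoc, Nat.factorial_succ]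
        have : ((2 * n - 1 + k + l + 1 : ℕ) : ℝ) = 2 * n + k + l := by
          have : 2 * n - 1 + k + l + 1 = 2 * n + k + l := by omega
          rw [this]; push_cast; ring
        rw [Nat.cast_mul, this]; ring
      have h2 : ((n + k).ascFactorial (N + 1) : ℝ) = ((n : ℝ) + k + N) * (n + k).ascFactorial N := by
        rw [Nat.ascFactorial_succ]; push_cast; ring
      have S1 : ∑ l ∈ Finset.range (N + 1 + 1), (if l = 0 then 0 else g (l - 1)) *
          ((2 * n - 1 + k + l).factorial : ℝ) =
          ∑ l ∈ Finset.range (N + 1), g l * ((2 * n - 1 + k + (l + 1)).factorial : ℝ) := by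
        rw [Finset.sum_range_succ']; simp
      have S2 : ∑ l ∈ Finset.range (N + 1 + 1), (if l = N + 1 then 0 else ((N : ℝ) - n - l) * g l) *
          ((2 * n - 1 + k + l).factorial : ℝ) = ∑ l ∈ Finset.range (N + 1),
            ((N : ℝ) - n - l) * g l * ((2 * n - 1 + k + l).factorial : ℝ) := by
        rw [Finset.sum_range_succ, if_pos rfl, zero_mul, add_zero]
        refine Finset.sum_congr rfl fun l hl => ?_
        rw [if_neg (by have := Finset.mem_range.1 hl; omega)]
      simp only [add_mul, Finset.sum_add_distrib]
      rw [S1, S2, h2, mul_assoc, hg, Finset.mul_sum, ← Finset.sum_add_distrib]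
      refine Finset.sum_congr rfl fun l _ => ?_
      linear_combination g l * h1 l
  obtain ⟨g, hg1, hg⟩ := main n
  refine ⟨fun l => g l * ((n - 1).factorial * (2 * n - 1 + l).factorial / (2 * n - 1).factorial ^ 2),
    ?_, fun k => ?_⟩
  · simp only [hg1]; positivity
  have hA : ∀ l : ℕ, ((k + (2 * n - 1 + l)).choose (2 * n - 1 + l) : ℝ) =
      (2 * n - 1 + k + l).factorial / (k.factorial * (2 * n - 1 + l).factorial) := by
    intro l
    rw [Nat.cast_choose ℝ (by omega), Nat.add_sub_cancel]
    rw [show k + (2 * n - 1 + l) = 2 * n - 1 + k + l by ring]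
    ring
  have hB : ((n - 1 + k).choose k : ℝ) = (n - 1 + k).factorial / (k.factorial * (n - 1).factorial) := by
    rw [Nat.cast_choose ℝ (by omega), Nat.add_sub_cancel]
  have hC : ((n - 1 + k).factorial : ℝ) * (n + k).ascFactorial n = (2 * n - 1 + k).factorial := by
    have := Nat.factorial_mul_ascFactorial (n - 1 + k) n
    rw [show n - 1 + k + 1 = n + k by omega, show n - 1 + k + n = 2 * n - 1 + k by omega] at this
    exact_mod_cast this
  have hA0 := hA 0
  simp only [add_zero] at hA0
  have hpos : ((n - 1 + k).factorial : ℝ) ≠ 0 := by positivity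
  have h3 : ∀ l ∈ Finset.range (n + 1), g l * ((n - 1).factorial * (2 * n - 1 + l).factorial /
      (2 * n - 1).factorial ^ 2) * ((k + (2 * n - 1 + l)).choose (2 * n - 1 + l) : ℝ) =
      ((n - 1).factorial / ((2 * n - 1).factorial ^ 2 * k.factorial)) *
        (g l * (2 * n - 1 + k + l).factorial) := by
    intro l _
    rw [hA]
    have : ((2 * n - 1 + l).factorial : ℝ) ≠ 0 := by positivity
    field_simp
  rw [Finset.sum_congr rfl h3, ← Finset.mul_sum, ← hg, hA0, hB, ← hC]
  field_simp

/-! ### Integrals over a segment and the Feynman parametrization -/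

theorem re_segment_pos {a b : ℂ} (ha : 0 < a.re) (hb : 0 < b.re) {s : ℝ} (h0 : 0 ≤ s) (h1 : s ≤ 1) :
    0 < ((s : ℂ) * a + (1 - s) * b).re := by
  have : ((s : ℂ) * a + (1 - s) * b).re = s * a.re + (1 - s) * b.re := by simp
  rw [this]
  rcases h0.eq_or_lt with rfl | h
  · simpa using hb
  · have := mul_pos h ha
    have := mul_nonneg (sub_nonneg.2 h1) hb.le
    linarith

theorem segment_ne_zero {a b : ℂ} (ha : 0 < a.re) (hb : 0 < b.re) {s : ℝ} (h0 : 0 ≤ s)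
    (h1 : s ≤ 1) : (s : ℂ) * a + (1 - s) * b ≠ 0 := fun h => by
  have := re_segment_pos ha hb h0 h1
  rw [h] at this
  simp at this

theorem inv_pow_eq_mul {X : ℂ} (hX : X ≠ 0) (i : ℕ) : (X ^ i)⁻¹ = X * (X ^ (i + 1))⁻¹ := by
  rw [pow_succ', mul_inv, ← mul_assoc, mul_inv_cancel₀ hX, one_mul]

/-- The integrals `∫₀¹ sᵏ (1-s)^(i+j-2-k) (s a + (1-s) b)⁻ⁱ (s c + (1-s) d)⁻ʲ ds`. -/
def segInt (k i j : ℕ) (a b c d : ℂ) : ℂ :=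
  ∫ s in (0 : ℝ)..1, (s : ℂ) ^ k * (1 - s) ^ (i + j - 2 - k) *
    (((s * a + (1 - s) * b) ^ i)⁻¹ * ((s * c + (1 - s) * d) ^ j)⁻¹)

theorem continuousOn_segInt_integrand {a b c d : ℂ} (ha : 0 < a.re) (hb : 0 < b.re)
    (hc : 0 < c.re) (hd : 0 < d.re) (k m i j : ℕ) :
    ContinuousOn (fun s : ℝ => (s : ℂ) ^ k * (1 - s) ^ m *
      (((s * a + (1 - s) * b) ^ i)⁻¹ * ((s * c + (1 - s) * d) ^ j)⁻¹)) (Set.Icc 0 1) := by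
  refine ContinuousOn.mul (by fun_prop) (ContinuousOn.mul ?_ ?_)
  · exact ContinuousOn.inv₀ (by fun_prop)
      fun s hs => pow_ne_zero _ (segment_ne_zero ha hb hs.1 hs.2)
  · exact ContinuousOn.inv₀ (by fun_prop)
      fun s hs => pow_ne_zero _ (segment_ne_zero hc hd hs.1 hs.2)

theorem intervalIntegrable_segInt {a b c d : ℂ} (ha : 0 < a.re) (hb : 0 < b.re)
    (hc : 0 < c.re) (hd : 0 < d.re) (k m i j : ℕ) :
    IntervalIntegrable (fun s : ℝ => (s : ℂ) ^ k * (1 - s) ^ m *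
      (((s * a + (1 - s) * b) ^ i)⁻¹ * ((s * c + (1 - s) * d) ^ j)⁻¹)) volume 0 1 :=
  ContinuousOn.intervalIntegrable (by
    rw [Set.uIcc_of_le zero_le_one]; exact continuousOn_segInt_integrand ha hb hc hd k m i j)

/-- The integral over `[0, 1]` of the derivative of `sᵖ (1-s)^q (s a + (1-s) b)^(-p-q)`. By
homogeneity the three terms of the product rule combine into two. -/
theorem feynman_step {a b : ℂ} (ha : 0 < a.re) (hb : 0 < b.re) (p q : ℕ) (hpq : 0 < p + q) :
    (p : ℂ) * b * (∫ s in (0 : ℝ)..1, (s : ℂ) ^ (p - 1) * (1 - s) ^ q *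
        ((s * a + (1 - s) * b) ^ (p + q + 1))⁻¹)
      - q * a * (∫ s in (0 : ℝ)..1, (s : ℂ) ^ p * (1 - s) ^ (q - 1) *
        ((s * a + (1 - s) * b) ^ (p + q + 1))⁻¹)
      = (if q = 0 then (a ^ p)⁻¹ else 0) - (if p = 0 then (b ^ q)⁻¹ else 0) := by
  have hcont : ∀ k m i : ℕ, IntervalIntegrable (fun s : ℝ => (s : ℂ) ^ k * (1 - s) ^ m *
      ((s * a + (1 - s) * b) ^ i)⁻¹) volume 0 1 := by
    intro k m i
    simpa using intervalIntegrable_segInt ha hb ha hb k m i 0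
  have hderiv : ∀ s ∈ Set.uIcc (0 : ℝ) 1, HasDerivAt (fun s : ℝ => (s : ℂ) ^ p * (1 - s) ^ q *
      ((s * a + (1 - s) * b) ^ (p + q))⁻¹)
      ((p : ℂ) * b * ((s : ℂ) ^ (p - 1) * (1 - s) ^ q * ((s * a + (1 - s) * b) ^ (p + q + 1))⁻¹) -
        q * a * ((s : ℂ) ^ p * (1 - s) ^ (q - 1) * ((s * a + (1 - s) * b) ^ (p + q + 1))⁻¹)) s := by
    intro s hs
    rw [Set.uIcc_of_le zero_le_one] at hs
    have hne := segment_ne_zero ha hb hs.1 hs.2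
    have h0 : HasDerivAt (fun s : ℝ => (s : ℂ)) 1 s := Complex.ofRealCLM.hasDerivAt
    have h1 : HasDerivAt (fun s : ℝ => 1 - (s : ℂ)) (-1) s := by simpa using h0.const_sub 1
    have h2 : HasDerivAt (fun s : ℝ => (s : ℂ) * a + (1 - s) * b) (1 * a + (-1) * b) s :=
      (h0.mul_const a).add (h1.mul_const b)
    have h3 := ((h0.pow p).mul (h1.pow q)).mul ((h2.pow (p + q)).inv (pow_ne_zero _ hne))
    refine h3.congr_deriv ?_
    simp only [Pi.mul_apply, Pi.pow_apply, Pi.inv_apply]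
    set X := (s : ℂ) * a + (1 - s) * b with hX
    have hp : ((p : ℂ) * (s : ℂ) ^ (p - 1)) * s = p * (s : ℂ) ^ p := by
      rcases p with _ | p
      · simp
      · rw [Nat.add_sub_cancel]; ring
    have hq : ((q : ℂ) * (1 - (s : ℂ)) ^ (q - 1)) * (1 - s) = q * (1 - (s : ℂ)) ^ q := by
      rcases q with _ | q
      · simp
      · rw [Nat.add_sub_cancel]; ring
    obtain ⟨m, hm⟩ := Nat.exists_eq_succ_of_ne_zero hpq.ne'
    have hm' : ((p + q : ℕ) : ℂ) = p + q := by push_cast; ring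
    rw [hm', hm, Nat.succ_sub_one, Nat.succ_eq_add_one]
    have e1 : (X ^ (m + 1))⁻¹ = X * (X ^ (m + 1 + 1))⁻¹ := inv_pow_eq_mul hne _
    have e2 : -((p + q : ℂ) * X ^ m * (1 * a + -1 * b)) / (X ^ (m + 1)) ^ 2 =
        -((p + q : ℂ) * (a - b)) * (X ^ (m + 1 + 1))⁻¹ := by field_simp; ring
    rw [e1, e2]
    generalize (X ^ (m + 1 + 1))⁻¹ = Y
    rw [hX]
    linear_combination Y * (a - b) * (1 - (s : ℂ)) ^ q * hp + Y * (a - b) * (s : ℂ) ^ p * hq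
  have h := intervalIntegral.integral_eq_sub_of_hasDerivAt hderiv
    (((hcont _ _ _).const_mul _).sub ((hcont _ _ _).const_mul _))
  rw [intervalIntegral.integral_sub ((hcont _ _ _).const_mul _) ((hcont _ _ _).const_mul _),
    intervalIntegral.integral_const_mul, intervalIntegral.integral_const_mul] at h
  rw [h]
  congr 1
  · rcases eq_or_ne q 0 with rfl | hq <;> simp [*]
  · rcases eq_or_ne p 0 with rfl | hp <;> simp [*]

/-- The Feynman parametrization of `a^(-p-1) b^(-q-1)`. -/
theorem feynman {a b : ℂ} (ha : 0 < a.re) (hb : 0 < b.re) (p q : ℕ) :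
    ∫ s in (0 : ℝ)..1, (s : ℂ) ^ p * (1 - s) ^ q * ((s * a + (1 - s) * b) ^ (p + q + 2))⁻¹ =
      (p.factorial * q.factorial / (p + q + 1).factorial : ℂ) *
        ((a ^ (p + 1))⁻¹ * (b ^ (q + 1))⁻¹) := by
  have ha0 := Complex.ne_zero_of_re_pos ha
  have hb0 := Complex.ne_zero_of_re_pos hb
  induction q generalizing p with
  | zero =>
    have h := feynman_step ha hb (p + 1) 0 (by omega)
    simp only [Nat.add_sub_cancel, add_zero, Nat.cast_zero, zero_mul, sub_zero, if_true, pow_zero,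
      if_neg (Nat.succ_ne_zero p)] at h ⊢
    have hp : ((p + 1 : ℕ) : ℂ) ≠ 0 := by exact_mod_cast Nat.succ_ne_zero p
    have hf : ((p + 1).factorial : ℂ) = (p + 1 : ℕ) * p.factorial := by
      rw [Nat.factorial_succ]; push_cast; ring
    have hp' : (p.factorial : ℂ) ≠ 0 := by exact_mod_cast Nat.factorial_ne_zero p
    rw [hf]
    refine mul_left_cancel₀ (mul_ne_zero hp hb0) (h.trans ?_)
    simp
    field_simp
  | succ q ih =>
    have h := feynman_step ha hb (p + 1) (q + 1) (by omega)
    simp only [Nat.add_sub_cancel, if_neg (Nat.succ_ne_zero p), if_neg (Nat.succ_ne_zero q),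
      sub_zero] at h
    have e1 : p + (q + 1) + 2 = p + 1 + (q + 1) + 1 := by ring
    have e2 : p + 1 + q + 2 = p + 1 + (q + 1) + 1 := by ring
    have h2 := ih (p + 1)
    rw [e2] at h2
    rw [e1]
    rw [h2] at h
    have hp : ((p + 1 : ℕ) : ℂ) ≠ 0 := by exact_mod_cast Nat.succ_ne_zero p
    refine mul_left_cancel₀ (mul_ne_zero hp hb0) ((sub_eq_zero.1 h).trans ?_)
    rw [show p + 1 + q + 1 = p + (q + 1) + 1 by ring, Nat.factorial_succ p, Nat.factorial_succ q]
    push_cast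
    field_simp
    ring

theorem integral_unitInterval (f : ℝ → ℂ) :
    ∫ s : unitInterval, f s = ∫ s in (0 : ℝ)..1, f s := by
  rw [intervalIntegral.integral_of_le zero_le_one, ← integral_Icc_eq_integral_Ioc]
  exact integral_subtype_comap measurableSet_Icc f

/-- Without the second factor, `segInt` is an instance of the Feynman parametrization. -/
theorem segInt_zero_right {a b c d : ℂ} (ha : 0 < a.re) (hb : 0 < b.re) {k i : ℕ} (h : k + 2 ≤ i) :
    segInt k i 0 a b c d = (k.factorial * (i - 2 - k).factorial / (i - 1).factorial : ℂ) *
        ((a ^ (k + 1))⁻¹ * (b ^ (i - 1 - k))⁻¹) := by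
  have := feynman ha hb k (i - 2 - k)
  rw [show k + (i - 2 - k) + 2 = i by omega, show k + (i - 2 - k) + 1 = i - 1 by omega,
    show i - 2 - k + 1 = i - 1 - k by omega] at this
  rw [← this, segInt]
  simp

theorem segInt_zero_left {a b c d : ℂ} (hc : 0 < c.re) (hd : 0 < d.re) {k j : ℕ} (h : k + 2 ≤ j) :
    segInt k 0 j a b c d = (k.factorial * (j - 2 - k).factorial / (j - 1).factorial : ℂ) *
        ((c ^ (k + 1))⁻¹ * (d ^ (j - 1 - k))⁻¹) := by
  rw [← segInt_zero_right hc hd h (c := a) (d := b), segInt, segInt]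
  simp

/-- Lowering of `i` and `j`, from `c (s a + (1-s) b) - a (s c + (1-s) d) = (1-s) (bc - ad)`. -/
theorem segInt_rec_const {a b c d : ℂ} (ha : 0 < a.re) (hb : 0 < b.re)
    (hc : 0 < c.re) (hd : 0 < d.re) {k i j : ℕ} (h : k + 1 ≤ i + j) :
    (b * c - a * d) * segInt k (i + 1) (j + 1) a b c d =
      c * segInt k i (j + 1) a b c d - a * segInt k (i + 1) j a b c d := by
  have hi := fun k m i j => intervalIntegrable_segInt ha hb hc hd k m i j
  simp only [segInt]
  rw [← intervalIntegral.integral_const_mul, ← intervalIntegral.integral_const_mul,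
    ← intervalIntegral.integral_const_mul,
    ← intervalIntegral.integral_sub ((hi _ _ _ _).const_mul _) ((hi _ _ _ _).const_mul _)]
  refine intervalIntegral.integral_congr fun s hs => ?_
  rw [Set.uIcc_of_le zero_le_one] at hs
  have h1 := segment_ne_zero ha hb hs.1 hs.2
  have h2 := segment_ne_zero hc hd hs.1 hs.2
  have e1 : i + 1 + (j + 1) - 2 - k = i + j - 1 - k + 1 := by omega
  have e2 : i + (j + 1) - 2 - k = i + j - 1 - k := by omega
  have e3 : i + 1 + j - 2 - k = i + j - 1 - k := by omega
  simp only [e1, e2, e3]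
  rw [pow_succ (1 - (s : ℂ))]
  rw [inv_pow_eq_mul h1 i, inv_pow_eq_mul h2 j]
  generalize (1 - (s : ℂ)) ^ (i + j - 1 - k) = R
  generalize ((s * a + (1 - s) * b) ^ (i + 1))⁻¹ = U
  generalize ((s * c + (1 - s) * d) ^ (j + 1))⁻¹ = W
  ring

/-- Lowering of `i`, `j` and `k`, from `b (s c + (1-s) d) - d (s a + (1-s) b) = s (bc - ad)`. -/
theorem segInt_rec_var {a b c d : ℂ} (ha : 0 < a.re) (hb : 0 < b.re)
    (hc : 0 < c.re) (hd : 0 < d.re) {k i j : ℕ} (h : k + 1 ≤ i + j) :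
    (b * c - a * d) * segInt (k + 1) (i + 1) (j + 1) a b c d =
      b * segInt k (i + 1) j a b c d - d * segInt k i (j + 1) a b c d := by
  have hi := fun k m i j => intervalIntegrable_segInt ha hb hc hd k m i j
  simp only [segInt]
  rw [← intervalIntegral.integral_const_mul, ← intervalIntegral.integral_const_mul,
    ← intervalIntegral.integral_const_mul,
    ← intervalIntegral.integral_sub ((hi _ _ _ _).const_mul _) ((hi _ _ _ _).const_mul _)]
  refine intervalIntegral.integral_congr fun s hs => ?_
  rw [Set.uIcc_of_le zero_le_one] at hs
  have h1 := segment_ne_zero ha hb hs.1 hs.2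
  have h2 := segment_ne_zero hc hd hs.1 hs.2
  have e1 : i + 1 + (j + 1) - 2 - (k + 1) = i + j - 1 - k := by omega
  have e2 : i + (j + 1) - 2 - k = i + j - 1 - k := by omega
  have e3 : i + 1 + j - 2 - k = i + j - 1 - k := by omega
  simp only [e1, e2, e3]
  rw [inv_pow_eq_mul h1 i, inv_pow_eq_mul h2 j]
  generalize (1 - (s : ℂ)) ^ (i + j - 1 - k) = R
  generalize ((s * a + (1 - s) * b) ^ (i + 1))⁻¹ = U
  generalize ((s * c + (1 - s) * d) ^ (j + 1))⁻¹ = W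
  ring

/-- The base of the recursion, and the only source of logarithms. -/
theorem segInt_one_one {a b c d : ℂ} (ha : 0 < a.re) (hb : 0 < b.re)
    (hc : 0 < c.re) (hd : 0 < d.re) :
    (b * c - a * d) * segInt 0 1 1 a b c d =
      Complex.log b + Complex.log c - Complex.log a - Complex.log d := by
  have hderiv : ∀ s ∈ Set.uIcc (0 : ℝ) 1, HasDerivAt (fun s : ℝ =>
      Complex.log (s * c + (1 - s) * d) - Complex.log (s * a + (1 - s) * b))
      ((b * c - a * d) * ((s : ℂ) ^ 0 * (1 - s) ^ 0 *
        (((s * a + (1 - s) * b) ^ 1)⁻¹ * ((s * c + (1 - s) * d) ^ 1)⁻¹))) s := by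
    intro s hs
    rw [Set.uIcc_of_le zero_le_one] at hs
    have h0 : HasDerivAt (fun s : ℝ => (s : ℂ)) 1 s := Complex.ofRealCLM.hasDerivAt
    have h1 : HasDerivAt (fun s : ℝ => 1 - (s : ℂ)) (-1) s := by simpa using h0.const_sub 1
    have h2 : HasDerivAt (fun s : ℝ => (s : ℂ) * a + (1 - s) * b) (1 * a + (-1) * b) s :=
      (h0.mul_const a).add (h1.mul_const b)
    have h3 : HasDerivAt (fun s : ℝ => (s : ℂ) * c + (1 - s) * d) (1 * c + (-1) * d) s :=
      (h0.mul_const c).add (h1.mul_const d)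
    have n1 := segment_ne_zero ha hb hs.1 hs.2
    have n2 := segment_ne_zero hc hd hs.1 hs.2
    refine ((h3.clog_real (Or.inl (re_segment_pos hc hd hs.1 hs.2))).sub
      (h2.clog_real (Or.inl (re_segment_pos ha hb hs.1 hs.2)))).congr_deriv ?_
    rw [div_sub_div _ _ n2 n1, pow_zero, pow_zero, pow_one, pow_one, one_mul, one_mul, ← mul_inv,
      mul_comm ((s : ℂ) * a + _), ← div_eq_mul_inv]
    ring
  have h := intervalIntegral.integral_eq_sub_of_hasDerivAt hderiv
    ((intervalIntegrable_segInt ha hb hc hd 0 0 1 1).const_mul _)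
  rw [intervalIntegral.integral_const_mul] at h
  rw [segInt]
  refine Eq.trans ?_ (h.trans ?_)
  · simp
  · simp; ring

/-! ### Logarithmic singularities of the segment integrals -/

/-- The parameters `(a, b, c, d)` at which the coefficients in the expansion of `segInt` are
smooth; `a` and `d` may vanish. -/
def segDomain : Set (ℂ × ℂ × ℂ × ℂ) :=
  {p | p.2.1 ≠ 0 ∧ p.2.2.1 ≠ 0 ∧ p.2.1 * p.2.2.1 - p.1 * p.2.2.2 ≠ 0}

theorem contDiffOn_det_inv :
    ContDiffOn ℝ ∞ (fun p : ℂ × ℂ × ℂ × ℂ => (p.2.1 * p.2.2.1 - p.1 * p.2.2.2)⁻¹) segDomain :=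
  ContDiffOn.inv (by fun_prop) fun _ hp => hp.2.2

/-- The singularities of `segInt` as `a` or `d` tends to `0`: a pole of order at most `k + 1 - j`
in `a` or `j - 1 - k` in `d` (truncated differences, so only one of the two occurs) and a
logarithm, both with smooth coefficients. The coefficient of the logarithm is computed at the
points `(0, 1, 1, d)`, where the recursion for it is that of the binomial coefficients. -/
theorem segInt_expansion (N : ℕ) : ∀ k i j : ℕ, i + j = N → k + 2 ≤ i + j →
    ∃ u v : ℂ × ℂ × ℂ × ℂ → ℂ, ContDiffOn ℝ ∞ u segDomain ∧ ContDiffOn ℝ ∞ v segDomain ∧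
      (∀ a b c d : ℂ, 0 < a.re → 0 < b.re → 0 < c.re → 0 < d.re → b * c - a * d ≠ 0 →
        segInt k i j a b c d = u (a, b, c, d) * ((a ^ (k + 1 - j))⁻¹ * (d ^ (j - 1 - k))⁻¹) +
          v (a, b, c, d) * (Complex.log b + Complex.log c - Complex.log a - Complex.log d)) ∧
      ∀ d : ℂ, v (0, 1, 1, d) =
        if j = 0 then 0 else (k.choose (j - 1) : ℂ) * (-d) ^ (k + 1 - j) := by
  induction N with
  | zero => intro k i j h1 h2; omega
  | succ N ih =>
    intro k i j hN hk
    rcases j with _ | j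
    · refine ⟨fun p => (k.factorial * (i - 2 - k).factorial / (i - 1).factorial : ℂ) *
        (p.2.1 ^ (i - 1 - k))⁻¹, fun _ => 0, ?_, contDiffOn_const, ?_, by simp⟩
      · exact contDiffOn_const.mul (ContDiffOn.inv (by fun_prop) fun p hp => pow_ne_zero _ hp.1)
      · intro a b c d ha hb hc hd _
        rw [segInt_zero_right ha hb (by omega)]
        simp
        ring
    rcases i with _ | i
    · refine ⟨fun p => (k.factorial * (j + 1 - 2 - k).factorial / (j + 1 - 1).factorial : ℂ) *
        (p.2.2.1 ^ (k + 1))⁻¹, fun _ => 0, ?_, contDiffOn_const, ?_, ?_⟩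
      · exact contDiffOn_const.mul (ContDiffOn.inv (by fun_prop) fun p hp => pow_ne_zero _ hp.2.1)
      · intro a b c d ha hb hc hd _
        rw [segInt_zero_left hc hd (by omega), show k + 1 - (j + 1) = 0 by omega]
        simp
        ring
      · intro d
        rw [Nat.choose_eq_zero_of_lt (by omega)]; simp
    rcases k with _ | k
    · rcases Nat.eq_zero_or_pos (i + j) with h0 | h0
      · obtain ⟨rfl, rfl⟩ : i = 0 ∧ j = 0 := by omega
        refine ⟨fun _ => 0, fun p => (p.2.1 * p.2.2.1 - p.1 * p.2.2.2)⁻¹, contDiffOn_const,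
          contDiffOn_det_inv, ?_, by simp⟩
        intro a b c d ha hb hc hd hΔ
        rw [← segInt_one_one ha hb hc hd]
        field_simp
        simp
      · obtain ⟨u₁, v₁, hu₁, hv₁, h₁, w₁⟩ := ih 0 i (j + 1) (by omega) (by omega)
        obtain ⟨u₂, v₂, hu₂, hv₂, h₂, w₂⟩ := ih 0 (i + 1) j (by omega) (by omega)
        refine ⟨fun p => (p.2.1 * p.2.2.1 - p.1 * p.2.2.2)⁻¹ *
            (p.2.2.1 * u₁ p - u₂ p * p.1 ^ (1 - (0 + 1 - j)) * p.2.2.2 ^ (j - (j - 1 - 0))),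
          fun p => (p.2.1 * p.2.2.1 - p.1 * p.2.2.2)⁻¹ * (p.2.2.1 * v₁ p - p.1 * v₂ p),
          ?_, ?_, ?_, ?_⟩
        · exact contDiffOn_det_inv.mul ((ContDiffOn.mul (by fun_prop) hu₁).sub
            ((hu₂.mul (by fun_prop)).mul (by fun_prop)))
        · exact contDiffOn_det_inv.mul ((ContDiffOn.mul (by fun_prop) hv₁).sub
            (ContDiffOn.mul (by fun_prop) hv₂))
        · intro a b c d ha hb hc hd hΔ
          have hr := segInt_rec_const ha hb hc hd (k := 0) (i := i) (j := j) (by omega)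
          have ha0 := Complex.ne_zero_of_re_pos ha
          have hd0 := Complex.ne_zero_of_re_pos hd
          rw [h₁ a b c d ha hb hc hd hΔ, h₂ a b c d ha hb hc hd hΔ] at hr
          have e3 : a * (a ^ (0 + 1 - j))⁻¹ = a ^ (1 - (0 + 1 - j)) := by
            rw [← div_eq_mul_inv, div_eq_iff (pow_ne_zero _ ha0), ← pow_add, ← pow_one a, ← pow_mul]
            congr 1; omega
          have e4 : (d ^ (j - 1 - 0))⁻¹ = d ^ (j - (j - 1 - 0)) * (d ^ (j + 1 - 1 - 0))⁻¹ := by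
            rw [← div_eq_mul_inv, eq_div_iff (pow_ne_zero _ hd0),
              inv_mul_eq_iff_eq_mul₀ (pow_ne_zero _ hd0), ← pow_add]
            congr 1; omega
          have e5 : a ^ (0 + 1 - (j + 1)) = 1 := by rw [show 0 + 1 - (j + 1) = 0 by omega, pow_zero]
          rw [e5, e4] at hr
          rw [e5]
          refine mul_left_cancel₀ hΔ (hr.trans ?_)
          simp only [mul_add, ← mul_assoc, mul_inv_cancel₀ hΔ, one_mul]
          linear_combination (- u₂ (a, b, c, d) * d ^ (j - (j - 1 - 0)) *
            (d ^ (j + 1 - 1 - 0))⁻¹) * e3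
        · intro d
          simp [w₁]
    · obtain ⟨u₁, v₁, hu₁, hv₁, h₁, w₁⟩ := ih k (i + 1) j (by omega) (by omega)
      obtain ⟨u₂, v₂, hu₂, hv₂, h₂, w₂⟩ := ih k i (j + 1) (by omega) (by omega)
      refine ⟨fun p => (p.2.1 * p.2.2.1 - p.1 * p.2.2.2)⁻¹ *
            (p.2.1 * u₁ p - u₂ p * p.1 ^ ((k + 1 + 1 - (j + 1)) - (k + 1 - (j + 1))) *
              p.2.2.2 ^ ((j + 1 - 1 - (k + 1)) + 1 - (j + 1 - 1 - k))),
          fun p => (p.2.1 * p.2.2.1 - p.1 * p.2.2.2)⁻¹ * (p.2.1 * v₁ p - p.2.2.2 * v₂ p),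
          ?_, ?_, ?_, ?_⟩
      · exact contDiffOn_det_inv.mul ((ContDiffOn.mul (by fun_prop) hu₁).sub
          ((hu₂.mul (by fun_prop)).mul (by fun_prop)))
      · exact contDiffOn_det_inv.mul ((ContDiffOn.mul (by fun_prop) hv₁).sub
          (ContDiffOn.mul (by fun_prop) hv₂))
      · intro a b c d ha hb hc hd hΔ
        have hr := segInt_rec_var ha hb hc hd (k := k) (i := i) (j := j) (by omega)
        have ha0 := Complex.ne_zero_of_re_pos ha
        have hd0 := Complex.ne_zero_of_re_pos hd
        rw [h₁ a b c d ha hb hc hd hΔ, h₂ a b c d ha hb hc hd hΔ] at hr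
        have e1 : k + 1 - j = k + 1 + 1 - (j + 1) := by omega
        have e2 : j - 1 - k = j + 1 - 1 - (k + 1) := by omega
        have e3 : (a ^ (k + 1 - (j + 1)))⁻¹ = a ^ ((k + 1 + 1 - (j + 1)) - (k + 1 - (j + 1))) *
            (a ^ (k + 1 + 1 - (j + 1)))⁻¹ := by
          rw [← div_eq_mul_inv, eq_div_iff (pow_ne_zero _ ha0),
            inv_mul_eq_iff_eq_mul₀ (pow_ne_zero _ ha0), ← pow_add]
          congr 1; omega
        have e4 : d * (d ^ (j + 1 - 1 - k))⁻¹ =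
            d ^ ((j + 1 - 1 - (k + 1)) + 1 - (j + 1 - 1 - k)) * (d ^ (j + 1 - 1 - (k + 1)))⁻¹ := by
          rw [← div_eq_mul_inv, ← div_eq_mul_inv,
            div_eq_div_iff (pow_ne_zero _ hd0) (pow_ne_zero _ hd0), ← pow_add, ← pow_succ']
          congr 1; omega
        rw [e1, e2, e3] at hr
        refine mul_left_cancel₀ hΔ (hr.trans ?_)
        simp only [mul_add, ← mul_assoc, mul_inv_cancel₀ hΔ, one_mul]
        linear_combination (- u₂ (a, b, c, d) * a ^ ((k + 1 + 1 - (j + 1)) - (k + 1 - (j + 1))) *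
            (a ^ (k + 1 + 1 - (j + 1)))⁻¹) * e4
      · intro d
        simp only [w₁, w₂, Nat.add_sub_cancel, if_neg (Nat.succ_ne_zero j)]
        rcases j with _ | j
        · simp; ring
        · rw [if_neg (Nat.succ_ne_zero j), Nat.add_sub_cancel, Nat.choose_succ_succ,
            show k + 1 + 1 - (j + 1 + 1) = k + 1 - (j + 1) by omega]
          rcases lt_or_ge k (j + 1) with h | h
          · rw [Nat.choose_eq_zero_of_lt h]; simp
          · obtain ⟨m, rfl⟩ := Nat.exists_eq_add_of_le h
            rw [show j + 1 + m + 1 - (j + 1) = m + 1 by omega,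
              show j + 1 + m + 1 - (j + 1 + 1) = m by omega]
            push_cast
            ring

/-! ### The integral of a product of two Poisson-Szegő denominators -/

theorem one_sub_re_pos {w : ℂ} (hw : ‖w‖ < 1) : 0 < (1 - w).re := by
  have := (Complex.re_le_norm w).trans_lt hw
  simpa using this

theorem sphere_re_pos {n : ℕ} {u : Cn n} (hu : ‖u‖ < 1) (ζ : Metric.sphere (0 : Cn n) 1) :
    0 < (1 - inner ℂ (ζ : Cn n) u).re ∧ 0 < (1 - inner ℂ u (ζ : Cn n)).re :=
  ⟨one_sub_re_pos (norm_inner_lt_one hu ζ).1, one_sub_re_pos (norm_inner_lt_one hu ζ).2⟩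

theorem ball_re_pos {n : ℕ} {u v : Cn n} (hu : ‖u‖ < 1) (hv : ‖v‖ < 1) :
    0 < (1 - inner ℂ u v).re :=
  one_sub_re_pos ((norm_inner_le_norm _ _).trans_lt
    (mul_lt_one_of_nonneg_of_lt_one_left (norm_nonneg _) hu hv.le))

/-- The normalizing constant of the Feynman parametrization of two `n`-th powers. -/
def feynmanConst (n : ℕ) : ℂ := (2 * n - 1).factorial / ((n - 1).factorial * (n - 1).factorial)

theorem feynmanConst_ne_zero (n : ℕ) : feynmanConst n ≠ 0 := by
  have h1 : ((2 * n - 1).factorial : ℂ) ≠ 0 := by exact_mod_cast Nat.factorial_ne_zero _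
  have h2 : ((n - 1).factorial : ℂ) ≠ 0 := by exact_mod_cast Nat.factorial_ne_zero _
  exact div_ne_zero h1 (mul_ne_zero h2 h2)

/-- The Feynman parametrization of `a⁻ⁿ b⁻ⁿ`. -/
theorem feynman_pair {n : ℕ} (hn : 0 < n) {a b : ℂ} (ha : 0 < a.re) (hb : 0 < b.re) :
    (a ^ n)⁻¹ * (b ^ n)⁻¹ = feynmanConst n * ∫ s in (0 : ℝ)..1,
      (s : ℂ) ^ (n - 1) * (1 - s) ^ (n - 1) * ((s * a + (1 - s) * b) ^ (2 * n))⁻¹ := by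
  have h := feynman ha hb (n - 1) (n - 1)
  rw [show n - 1 + (n - 1) + 2 = 2 * n by omega, show n - 1 + (n - 1) + 1 = 2 * n - 1 by omega,
    Nat.sub_add_cancel hn] at h
  have h1 : ((2 * n - 1).factorial : ℂ) ≠ 0 := by exact_mod_cast Nat.factorial_ne_zero _
  have h2 : ((n - 1).factorial : ℂ) ≠ 0 := by exact_mod_cast Nat.factorial_ne_zero _
  rw [h, feynmanConst]
  field_simp

/-- Inserting `1 = (s + (1 - s))ˡ` into an integral over the unit interval. -/
theorem integral_insert_binomial (l m m' : ℕ) (f : ℝ → ℂ) (hf : ContinuousOn f (Set.Icc 0 1)) :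
    ∫ s in (0 : ℝ)..1, (s : ℂ) ^ m * (1 - s) ^ m' * f s =
      ∑ i ∈ Finset.range (l + 1), (l.choose i : ℂ) *
        ∫ s in (0 : ℝ)..1, (s : ℂ) ^ (m + i) * (1 - s) ^ (m' + (l - i)) * f s := by
  simp_rw [← intervalIntegral.integral_const_mul]
  rw [← intervalIntegral.integral_finsetSum]
  · congr 1
    ext s
    calc _ = (s : ℂ) ^ m * (1 - s) ^ m' * f s * ((s : ℂ) + (1 - s)) ^ l := by
          rw [add_sub_cancel, one_pow, mul_one]
      _ = _ := by
        rw [add_pow, Finset.mul_sum]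
        refine Finset.sum_congr rfl fun i _ => ?_
        rw [pow_add, pow_add]; ring
  · intro i _
    refine ContinuousOn.intervalIntegrable ?_
    rw [Set.uIcc_of_le zero_le_one]
    exact ContinuousOn.mul (by fun_prop) (ContinuousOn.mul (by fun_prop) hf)

/-- The coefficients of `exists_choose_expansion`. -/
def expansionCoeff {n : ℕ} (hn : 0 < n) : ℕ → ℝ := (exists_choose_expansion hn).choose

theorem expansionCoeff_self_ne_zero {n : ℕ} (hn : 0 < n) : expansionCoeff hn n ≠ 0 :=
  (exists_choose_expansion hn).choose_spec.1

/-- The sphere integral of two conjugate powers of order `2n` is a finite combination of powers of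
`1 - ⟨u, v⟩`, the one of highest order `3n` included. -/
theorem sphere_integral_pow_pow {n : ℕ} (hn : 0 < n) {u v : Cn n} (hu : ‖u‖ < 1) (hv : ‖v‖ < 1) :
    ∫ ζ, ((1 - inner ℂ (ζ : Cn n) u) ^ (2 * n))⁻¹ * ((1 - inner ℂ v (ζ : Cn n)) ^ (2 * n))⁻¹
        ∂(surfaceMeasure n) =
      sphereMass n * ∑ l ∈ Finset.range (n + 1), expansionCoeff hn l *
        ((1 - inner ℂ v u) ^ (2 * n + l))⁻¹ := by
  have h := hasSum_sphere_integral hn hu hv (2 * n - 1) (2 * n - 1)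
  simp only [show 2 * n - 1 + 1 = 2 * n by omega, one_div] at h
  refine h.unique (HasSum.mul_left _ ?_)
  have hw : ‖inner ℂ v u‖ < 1 := (norm_inner_le_norm _ _).trans_lt
    (mul_lt_one_of_nonneg_of_lt_one_left (norm_nonneg _) hv hu.le)
  have h2 : HasSum (fun k : ℕ => ∑ l ∈ Finset.range (n + 1), (expansionCoeff hn l : ℂ) *
      (((k + (2 * n - 1 + l)).choose (2 * n - 1 + l) : ℂ) * inner ℂ v u ^ k))
      (∑ l ∈ Finset.range (n + 1), (expansionCoeff hn l : ℂ) *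
        ((1 - inner ℂ v u) ^ (2 * n + l))⁻¹) := by
    refine hasSum_sum fun l _ => HasSum.mul_left _ ?_
    have := hasSum_choose_mul_geometric_of_norm_lt_one (2 * n - 1 + l) hw
    rwa [one_div, show 2 * n - 1 + l + 1 = 2 * n + l by omega] at this
  refine Eq.mp (congrArg (fun f => HasSum f _) (funext fun k => ?_)) h2
  have h3 := (exists_choose_expansion hn).choose_spec.2 k
  have h4 := congrArg (fun r : ℝ => (r : ℂ)) h3
  push_cast at h4
  rw [h4, Finset.sum_mul]
  exact Finset.sum_congr rfl fun l _ => by rw [expansionCoeff]; ring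

/-- The coefficients in the expansion of `∫₀¹ (s (1-s))ⁿ⁻¹ (s a + (1-s) b)^(-2n-l) ds` as a
combination of the products `a^(-n-i) b^(-n-l+i)`, `i ≤ l`. -/
def splitCoeff (n l i : ℕ) : ℂ :=
  l.choose i * ((n - 1 + i).factorial * (n - 1 + (l - i)).factorial / (2 * n - 1 + l).factorial)

/-- The antiholomorphic powers at `x` and `y` are merged into one at a point of the segment
`[y, x]`, the integral over the sphere is evaluated, and the parameter of the segment is
integrated out. -/
theorem sphere_integral_pow_pair {n : ℕ} (hn : 0 < n) {u x y : Cn n} (hu : ‖u‖ < 1) (hx : ‖x‖ < 1)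
    (hy : ‖y‖ < 1) :
    ∫ ζ, ((1 - inner ℂ (ζ : Cn n) u) ^ (2 * n))⁻¹ *
        (((1 - inner ℂ x (ζ : Cn n)) ^ n)⁻¹ * ((1 - inner ℂ y (ζ : Cn n)) ^ n)⁻¹)
        ∂(surfaceMeasure n) =
      feynmanConst n * (sphereMass n * ∑ l ∈ Finset.range (n + 1), expansionCoeff hn l *
        ∑ i ∈ Finset.range (l + 1), splitCoeff n l i *
          (((1 - inner ℂ x u) ^ (n + i))⁻¹ * ((1 - inner ℂ y u) ^ (n + (l - i)))⁻¹)) := by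
  have hxu := ball_re_pos hx hu
  have hyu := ball_re_pos hy hu
  have hseg : ∀ s : unitInterval, ‖((s : ℝ) • x + (1 - (s : ℝ)) • y)‖ < 1 := fun s => by
    have := (convex_ball (0 : Cn n) 1) (mem_ball_zero_iff.2 hx) (mem_ball_zero_iff.2 hy)
      s.2.1 (sub_nonneg.2 s.2.2) (by ring)
    exact mem_ball_zero_iff.1 this
  have hlin : ∀ (s : ℝ) (z : Cn n), 1 - inner ℂ (s • x + (1 - s) • y) z =
      s * (1 - inner ℂ x z) + (1 - s) * (1 - inner ℂ y z) := fun s z => by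
    rw [inner_add_left, ← Complex.coe_smul, ← Complex.coe_smul, inner_smul_left, inner_smul_left]
    simp; ring
  have hcont : Continuous (Function.uncurry fun (ζ : Metric.sphere (0 : Cn n) 1)
      (s : unitInterval) => ((1 - inner ℂ (ζ : Cn n) u) ^ (2 * n))⁻¹ *
        (((s : ℝ) : ℂ) ^ (n - 1) * (1 - ((s : ℝ) : ℂ)) ^ (n - 1) *
          ((((s : ℝ) : ℂ) * (1 - inner ℂ x (ζ : Cn n)) +
            (1 - ((s : ℝ) : ℂ)) * (1 - inner ℂ y (ζ : Cn n))) ^ (2 * n))⁻¹)) := by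
    refine Continuous.mul (Continuous.inv₀ (by fun_prop) fun p => pow_ne_zero _
      (Complex.ne_zero_of_re_pos (sphere_re_pos hu p.1).1)) (Continuous.mul (by fun_prop)
        (Continuous.inv₀ (by fun_prop) fun p => pow_ne_zero _
          (segment_ne_zero (sphere_re_pos hx p.1).2 (sphere_re_pos hy p.1).2 p.2.2.1 p.2.2.2)))
  calc _ = ∫ ζ : Metric.sphere (0 : Cn n) 1, feynmanConst n * ∫ s : unitInterval,
        ((1 - inner ℂ (ζ : Cn n) u) ^ (2 * n))⁻¹ *
        (((s : ℝ) : ℂ) ^ (n - 1) * (1 - ((s : ℝ) : ℂ)) ^ (n - 1) *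
          ((((s : ℝ) : ℂ) * (1 - inner ℂ x (ζ : Cn n)) +
            (1 - ((s : ℝ) : ℂ)) * (1 - inner ℂ y (ζ : Cn n))) ^ (2 * n))⁻¹)
          ∂volume ∂(surfaceMeasure n) := by
        congr 1
        ext ζ
        rw [feynman_pair hn (sphere_re_pos hx ζ).2 (sphere_re_pos hy ζ).2, integral_const_mul,
          integral_unitInterval (fun s : ℝ => (s : ℂ) ^ (n - 1) * (1 - (s : ℂ)) ^ (n - 1) *
          (((s : ℂ) * (1 - inner ℂ x (ζ : Cn n)) +
            (1 - (s : ℂ)) * (1 - inner ℂ y (ζ : Cn n))) ^ (2 * n))⁻¹)]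
        ring
    _ = feynmanConst n * ∫ s : unitInterval, ((s : ℝ) : ℂ) ^ (n - 1) *
        (1 - ((s : ℝ) : ℂ)) ^ (n - 1) *
        (sphereMass n * ∑ l ∈ Finset.range (n + 1), expansionCoeff hn l *
          ((((s : ℝ) : ℂ) * (1 - inner ℂ x u) + (1 - ((s : ℝ) : ℂ)) * (1 - inner ℂ y u)) ^
            (2 * n + l))⁻¹) := by
        rw [integral_const_mul, integral_integral_swap hcont.integrable_of_compactSpace]
        congr 2
        ext s
        rw [← hlin, ← sphere_integral_pow_pow hn hu (hseg s), ← integral_const_mul]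
        congr 1
        ext ζ
        rw [← hlin]
        ring
    _ = _ := by
        rw [integral_unitInterval (fun s : ℝ => (s : ℂ) ^ (n - 1) * (1 - (s : ℂ)) ^ (n - 1) *
          (sphereMass n * ∑ l ∈ Finset.range (n + 1), expansionCoeff hn l *
          (((s : ℂ) * (1 - inner ℂ x u) + (1 - (s : ℂ)) * (1 - inner ℂ y u)) ^ (2 * n + l))⁻¹))]
        congr 1
        have hc : ∀ m : ℕ, ContinuousOn (fun s : ℝ => (((s : ℂ) * (1 - inner ℂ x u) +
            (1 - (s : ℂ)) * (1 - inner ℂ y u)) ^ m)⁻¹) (Set.Icc 0 1) := fun m =>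
          ContinuousOn.inv₀ (by fun_prop)
            fun s hs => pow_ne_zero _ (segment_ne_zero hxu hyu hs.1 hs.2)
        calc _ = ∫ s in (0 : ℝ)..1, sphereMass n * ∑ l ∈ Finset.range (n + 1), expansionCoeff hn l *
              ((s : ℂ) ^ (n - 1) * (1 - (s : ℂ)) ^ (n - 1) *
              (((s : ℂ) * (1 - inner ℂ x u) + (1 - (s : ℂ)) * (1 - inner ℂ y u)) ^
                (2 * n + l))⁻¹) := by
              congr 1
              ext s
              rw [Finset.mul_sum, Finset.mul_sum, Finset.mul_sum]
              exact Finset.sum_congr rfl fun l _ => by ring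
          _ = _ := by
              rw [intervalIntegral.integral_const_mul, intervalIntegral.integral_finsetSum]
              · congr 1
                refine Finset.sum_congr rfl fun l _ => ?_
                rw [intervalIntegral.integral_const_mul, integral_insert_binomial l _ _ _ (hc _)]
                congr 1
                refine Finset.sum_congr rfl fun i hi => ?_
                have hil : i ≤ l := Nat.lt_succ_iff.1 (Finset.mem_range.1 hi)
                have hf := feynman hxu hyu (n - 1 + i) (n - 1 + (l - i))
                rw [show n - 1 + i + (n - 1 + (l - i)) + 2 = 2 * n + l by omega,
                  show n - 1 + i + (n - 1 + (l - i)) + 1 = 2 * n - 1 + l by omega,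
                  show n - 1 + i + 1 = n + i by omega,
                  show n - 1 + (l - i) + 1 = n + (l - i) by omega] at hf
                rw [hf, splitCoeff]
                ring
              · intro l _
                refine ContinuousOn.intervalIntegrable ?_
                rw [Set.uIcc_of_le zero_le_one]
                exact continuousOn_const.mul (ContinuousOn.mul (by fun_prop) (hc _))

/-- The integral over the sphere of `|1 - ⟨x, ζ⟩|^(-2n) |1 - ⟨y, ζ⟩|^(-2n)`, the product of the
Poisson-Szegő kernels at `x` and `y` without their numerators. -/
def sphereQuad {n : ℕ} (x y : Cn n) : ℂ :=
  ∫ ζ, (((1 - inner ℂ (ζ : Cn n) x) ^ n)⁻¹ * ((1 - inner ℂ (ζ : Cn n) y) ^ n)⁻¹) *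
        (((1 - inner ℂ x (ζ : Cn n)) ^ n)⁻¹ * ((1 - inner ℂ y (ζ : Cn n)) ^ n)⁻¹)
        ∂(surfaceMeasure n)

/-- The holomorphic powers at `x` and `y` are merged as well. Here the integral over the parameter
of the segment does not reduce to products of powers, and the integrals `segInt` appear. -/
theorem sphereQuad_eq {n : ℕ} (hn : 0 < n) {x y : Cn n} (hx : ‖x‖ < 1) (hy : ‖y‖ < 1) :
    sphereQuad x y = feynmanConst n * (feynmanConst n * (sphereMass n *
      ∑ l ∈ Finset.range (n + 1), expansionCoeff hn l *
        ∑ i ∈ Finset.range (l + 1), splitCoeff n l i * ∑ j ∈ Finset.range (l + 1),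
          (l.choose j : ℂ) * segInt (n - 1 + j) (n + i) (n + (l - i))
            (1 - inner ℂ x x) (1 - inner ℂ x y) (1 - inner ℂ y x) (1 - inner ℂ y y))) := by
  have hseg : ∀ s : unitInterval, ‖((s : ℝ) • x + (1 - (s : ℝ)) • y)‖ < 1 := fun s => by
    have := (convex_ball (0 : Cn n) 1) (mem_ball_zero_iff.2 hx) (mem_ball_zero_iff.2 hy)
      s.2.1 (sub_nonneg.2 s.2.2) (by ring)
    exact mem_ball_zero_iff.1 this
  have hlin : ∀ (s : ℝ) (z : Cn n), 1 - inner ℂ z (s • x + (1 - s) • y) =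
      s * (1 - inner ℂ z x) + (1 - s) * (1 - inner ℂ z y) := fun s z => by
    rw [inner_add_right, ← Complex.coe_smul, ← Complex.coe_smul, inner_smul_right, inner_smul_right]
    simp; ring
  have hcont : Continuous (Function.uncurry fun (ζ : Metric.sphere (0 : Cn n) 1)
      (s : unitInterval) => (((s : ℝ) : ℂ) ^ (n - 1) * (1 - ((s : ℝ) : ℂ)) ^ (n - 1) *
          ((((s : ℝ) : ℂ) * (1 - inner ℂ (ζ : Cn n) x) +
            (1 - ((s : ℝ) : ℂ)) * (1 - inner ℂ (ζ : Cn n) y)) ^ (2 * n))⁻¹) *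
        (((1 - inner ℂ x (ζ : Cn n)) ^ n)⁻¹ * ((1 - inner ℂ y (ζ : Cn n)) ^ n)⁻¹)) := by
    refine Continuous.mul (Continuous.mul (by fun_prop) (Continuous.inv₀ (by fun_prop) fun p =>
      pow_ne_zero _ (segment_ne_zero (sphere_re_pos hx p.1).1 (sphere_re_pos hy p.1).1
        p.2.2.1 p.2.2.2))) (Continuous.mul ?_ ?_)
    · exact Continuous.inv₀ (by fun_prop) fun p => pow_ne_zero _
        (Complex.ne_zero_of_re_pos (sphere_re_pos hx p.1).2)
    · exact Continuous.inv₀ (by fun_prop) fun p => pow_ne_zero _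
        (Complex.ne_zero_of_re_pos (sphere_re_pos hy p.1).2)
  have ha := ball_re_pos hx hx
  have hb := ball_re_pos hx hy
  have hc := ball_re_pos hy hx
  have hd := ball_re_pos hy hy
  calc _ = ∫ ζ : Metric.sphere (0 : Cn n) 1, feynmanConst n * ∫ s : unitInterval,
        (((s : ℝ) : ℂ) ^ (n - 1) * (1 - ((s : ℝ) : ℂ)) ^ (n - 1) *
          ((((s : ℝ) : ℂ) * (1 - inner ℂ (ζ : Cn n) x) +
            (1 - ((s : ℝ) : ℂ)) * (1 - inner ℂ (ζ : Cn n) y)) ^ (2 * n))⁻¹) *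
        (((1 - inner ℂ x (ζ : Cn n)) ^ n)⁻¹ * ((1 - inner ℂ y (ζ : Cn n)) ^ n)⁻¹)
          ∂volume ∂(surfaceMeasure n) := by
        rw [sphereQuad]
        congr 1
        ext ζ
        rw [feynman_pair hn (sphere_re_pos hx ζ).1 (sphere_re_pos hy ζ).1, integral_mul_const,
          integral_unitInterval (fun s : ℝ => (s : ℂ) ^ (n - 1) * (1 - (s : ℂ)) ^ (n - 1) *
          (((s : ℂ) * (1 - inner ℂ (ζ : Cn n) x) +
            (1 - (s : ℂ)) * (1 - inner ℂ (ζ : Cn n) y)) ^ (2 * n))⁻¹)]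
        ring
    _ = feynmanConst n * ∫ s : unitInterval, ((s : ℝ) : ℂ) ^ (n - 1) *
        (1 - ((s : ℝ) : ℂ)) ^ (n - 1) * (feynmanConst n * (sphereMass n *
          ∑ l ∈ Finset.range (n + 1), expansionCoeff hn l *
          ∑ i ∈ Finset.range (l + 1), splitCoeff n l i *
          (((((s : ℝ) : ℂ) * (1 - inner ℂ x x) + (1 - ((s : ℝ) : ℂ)) * (1 - inner ℂ x y)) ^ (n + i))⁻¹ *
            ((((s : ℝ) : ℂ) * (1 - inner ℂ y x) + (1 - ((s : ℝ) : ℂ)) * (1 - inner ℂ y y)) ^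
              (n + (l - i)))⁻¹))) := by
        rw [integral_const_mul, integral_integral_swap hcont.integrable_of_compactSpace]
        congr 2
        ext s
        rw [← hlin, ← hlin, ← sphere_integral_pow_pair hn (hseg s) hx hy, ← integral_const_mul]
        congr 1
        ext ζ
        rw [← hlin]
        ring
    _ = _ := by
        rw [integral_unitInterval (fun s : ℝ => (s : ℂ) ^ (n - 1) *
          (1 - (s : ℂ)) ^ (n - 1) * (feynmanConst n * (sphereMass n *
          ∑ l ∈ Finset.range (n + 1), expansionCoeff hn l *
          ∑ i ∈ Finset.range (l + 1), splitCoeff n l i *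
          ((((s : ℂ) * (1 - inner ℂ x x) + (1 - (s : ℂ)) * (1 - inner ℂ x y)) ^ (n + i))⁻¹ *
            (((s : ℂ) * (1 - inner ℂ y x) + (1 - (s : ℂ)) * (1 - inner ℂ y y)) ^
              (n + (l - i)))⁻¹))))]
        congr 1
        calc _ = ∫ s in (0 : ℝ)..1, feynmanConst n * (sphereMass n *
              ∑ l ∈ Finset.range (n + 1), expansionCoeff hn l *
              ∑ i ∈ Finset.range (l + 1), splitCoeff n l i * ((s : ℂ) ^ (n - 1) *
                (1 - (s : ℂ)) ^ (n - 1) *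
              ((((s : ℂ) * (1 - inner ℂ x x) + (1 - (s : ℂ)) * (1 - inner ℂ x y)) ^ (n + i))⁻¹ *
                (((s : ℂ) * (1 - inner ℂ y x) + (1 - (s : ℂ)) * (1 - inner ℂ y y)) ^
                  (n + (l - i)))⁻¹))) := by
              congr 1
              ext s
              simp only [Finset.mul_sum]
              exact Finset.sum_congr rfl fun l _ => Finset.sum_congr rfl fun i _ => by ring
          _ = _ := by
              have hi := fun l i => intervalIntegrable_segInt ha hb hc hd (n - 1) (n - 1) (n + i)
                (n + (l - i))
              rw [intervalIntegral.integral_const_mul, intervalIntegral.integral_const_mul,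
                intervalIntegral.integral_finsetSum]
              · congr 2
                refine Finset.sum_congr rfl fun l _ => ?_
                rw [intervalIntegral.integral_const_mul, intervalIntegral.integral_finsetSum]
                · congr 1
                  refine Finset.sum_congr rfl fun i hil => ?_
                  have hil : i ≤ l := Nat.lt_succ_iff.1 (Finset.mem_range.1 hil)
                  have hco : ContinuousOn (fun s : ℝ => ((((s : ℂ) * (1 - inner ℂ x x) +
                      (1 - (s : ℂ)) * (1 - inner ℂ x y)) ^ (n + i))⁻¹ *
                      (((s : ℂ) * (1 - inner ℂ y x) + (1 - (s : ℂ)) * (1 - inner ℂ y y)) ^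
                      (n + (l - i)))⁻¹)) (Set.Icc 0 1) := by
                    simpa using continuousOn_segInt_integrand ha hb hc hd 0 0 (n + i) (n + (l - i))
                  rw [intervalIntegral.integral_const_mul, integral_insert_binomial l _ _ _ hco]
                  congr 1
                  refine Finset.sum_congr rfl fun j hj => ?_
                  have hj : j ≤ l := Nat.lt_succ_iff.1 (Finset.mem_range.1 hj)
                  rw [segInt, show n + i + (n + (l - i)) - 2 - (n - 1 + j) = n - 1 + (l - j) by omega]
                · exact fun i _ => (hi l i).const_mul _
              · intro l _
                refine IntervalIntegrable.const_mul ?_ _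
                have := IntervalIntegrable.sum (Finset.range (l + 1))
                  fun i _ => (hi l i).const_mul (splitCoeff n l i)
                rwa [Finset.sum_fn] at this

/-! ### Smoothness of parametric integrals -/

section Parametric

variable {E H S : Type} [NormedAddCommGroup E] [NormedSpace ℝ E] [NormedAddCommGroup H]
  [NormedSpace ℝ H] [TopologicalSpace S] [CompactSpace S] [SecondCountableTopology S]
  [MeasurableSpace S] [BorelSpace S] {μ : Measure S} [IsFiniteMeasure μ] {ι : S → H}
  {O : Set (E × H)} {U : Set E}

/-- Differentiation under the integral sign over a compact parameter space. Compactness gives a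
uniform bound for the derivative near `x₀`. -/
theorem hasFDerivAt_integral_of_contDiffOn {F : Type} [NormedAddCommGroup F] [NormedSpace ℝ F]
    (hι : Continuous ι) (hO : IsOpen O) {G : E × H → F} {m : WithTop ℕ∞} (hm : m ≠ 0)
    (hG : ContDiffOn ℝ m G O) {x₀ : E} (hx₀ : ∀ s, (x₀, ι s) ∈ O) :
    HasFDerivAt (fun x => ∫ s, G (x, ι s) ∂μ)
      (∫ s, (fderiv ℝ G (x₀, ι s)).comp (ContinuousLinearMap.inl ℝ E H) ∂μ) x₀ := by
  have hG1 : ContDiffOn ℝ 1 G O := hG.of_le (ENat.one_le_iff_ne_zero_withTop.2 hm)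
  have hD : ContinuousOn (fun p => (fderiv ℝ G p).comp (ContinuousLinearMap.inl ℝ E H)) O :=
    (hG1.continuousOn_fderiv_of_isOpen hO le_rfl).clm_comp continuousOn_const
  have hcomp : ∀ x : E, Continuous fun s => (x, ι s) := fun x => continuous_const.prodMk hι
  have hK : IsCompact (Set.range fun s => (x₀, ι s)) := isCompact_range (hcomp x₀)
  have hKO : (Set.range fun s => (x₀, ι s)) ⊆ O := by rintro _ ⟨s, rfl⟩; exact hx₀ s
  obtain ⟨C, hC⟩ := hK.exists_bound_of_continuousOn (hD.mono hKO)
  have hW : IsOpen (O ∩ (fun p => ‖(fderiv ℝ G p).comp (ContinuousLinearMap.inl ℝ E H)‖) ⁻¹'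
      Set.Iio (C + 1)) := hD.norm.isOpen_inter_preimage hO isOpen_Iio
  obtain ⟨u, v, hu, -, hxu, hv, huv⟩ := generalized_tube_lemma (isCompact_singleton (x := x₀))
    (isCompact_range hι) hW (by
      rintro ⟨x, _⟩ ⟨hx, s, rfl⟩
      obtain rfl : x = x₀ := hx
      exact ⟨hx₀ s, (hC _ ⟨s, rfl⟩).trans_lt (lt_add_one C)⟩)
  have hmem : ∀ x ∈ u, ∀ s, (x, ι s) ∈ O ∧
      ‖(fderiv ℝ G (x, ι s)).comp (ContinuousLinearMap.inl ℝ E H)‖ < C + 1 := fun x hx s =>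
    huv ⟨hx, hv ⟨s, rfl⟩⟩
  have hu' : u ∈ 𝓝 x₀ := hu.mem_nhds (hxu rfl)
  have hcG : ∀ x ∈ u, Continuous fun s => G (x, ι s) := fun x hx =>
    hG1.continuousOn.comp_continuous (hcomp x) fun s => (hmem x hx s).1
  refine hasFDerivAt_integral_of_dominated_of_fderiv_le (bound := fun _ => C + 1)
    (F' := fun x s => (fderiv ℝ G (x, ι s)).comp (ContinuousLinearMap.inl ℝ E H)) hu' ?_ ?_ ?_ ?_
    (integrable_const _) ?_
  · filter_upwards [hu'] with x hx
    exact (hcG x hx).aestronglyMeasurable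
  · exact (hcG x₀ (hxu rfl)).integrable_of_compactSpace
  · exact (hD.comp_continuous (hcomp x₀) hx₀).aestronglyMeasurable
  · exact .of_forall fun s x hx => (hmem x hx s).2.le
  · refine .of_forall fun s x hx => ?_
    have h1 : HasFDerivAt G (fderiv ℝ G (x, ι s)) (x, ι s) :=
      ((hG1.contDiffAt (hO.mem_nhds (hmem x hx s).1)).differentiableAt one_ne_zero).hasFDerivAt
    exact h1.comp x (hasFDerivAt_prodMk_left x (ι s))

/-- Integrals of smooth functions over a compact parameter space are smooth. -/
theorem contDiffOn_integral (hι : Continuous ι) (hO : IsOpen O) (hU : IsOpen U)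
    (hUO : ∀ x ∈ U, ∀ s, (x, ι s) ∈ O) (m : ℕ) :
    ∀ {F : Type} [NormedAddCommGroup F] [NormedSpace ℝ F] {G : E × H → F},
      ContDiffOn ℝ ∞ G O → ContDiffOn ℝ m (fun x => ∫ s, G (x, ι s) ∂μ) U := by
  induction m with
  | zero =>
    intro F _ _ G hG
    refine contDiffOn_zero.2 fun x hx => ?_
    exact (hasFDerivAt_integral_of_contDiffOn hι hO (by simp) hG
      (hUO x hx)).continuousAt.continuousWithinAt
  | succ m ih =>
    intro F _ _ G hG
    have hd := fun x hx => hasFDerivAt_integral_of_contDiffOn (μ := μ) hι hO (by simp) hG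
      (hUO x hx)
    have := (contDiffOn_succ_iff_fderiv_of_isOpen (𝕜 := ℝ) (n := m)
      (f := fun x => ∫ s, G (x, ι s) ∂μ) hU).2
    refine this ⟨fun x hx => (hd x hx).differentiableAt.differentiableWithinAt, by simp, ?_⟩
    refine (ih (G := fun p => (fderiv ℝ G p).comp (ContinuousLinearMap.inl ℝ E H)) ?_).congr
      fun x hx => (hd x hx).fderiv
    exact (hG.fderiv_of_isOpen hO (by simp)).clm_comp contDiffOn_const

end Parametric

/-! ### Wirtinger calculus -/

/-- `f` is real differentiable at `z` with Wirtinger derivatives `∂f/∂z_j = p j` and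
`∂f/∂z̄_j = q j`. -/
structure HasWirtingerAt {n : ℕ} (f : Cn n → ℂ) (z : Cn n) (p q : Fin n → ℂ) : Prop where
  differentiableAt : DifferentiableAt ℝ f z
  wirtinger_eq : ∀ j, wirtinger j f z = p j
  wirtingerBar_eq : ∀ j, wirtingerBar j f z = q j

namespace HasWirtingerAt

variable {n : ℕ} {f g : Cn n → ℂ} {z : Cn n} {p q p' q' : Fin n → ℂ}

theorem const (c : ℂ) (z : Cn n) : HasWirtingerAt (fun _ => c) z (fun _ => 0) (fun _ => 0) :=
  ⟨by fun_prop, fun j => by simp [wirtinger], fun j => by simp [wirtingerBar]⟩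

theorem sub (hf : HasWirtingerAt f z p q) (hg : HasWirtingerAt g z p' q') :
    HasWirtingerAt (fun z => f z - g z) z (fun j => p j - p' j) (fun j => q j - q' j) := by
  have h := fderiv_fun_sub hf.1 hg.1
  refine ⟨hf.1.sub hg.1, fun j => ?_, fun j => ?_⟩
  · rw [← hf.2, ← hg.2, wirtinger, wirtinger, wirtinger, h]
    simp only [sub_apply]; ring
  · rw [← hf.3, ← hg.3, wirtingerBar, wirtingerBar, wirtingerBar, h]
    simp only [sub_apply]; ring

theorem mul (hf : HasWirtingerAt f z p q) (hg : HasWirtingerAt g z p' q') :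
    HasWirtingerAt (fun z => f z * g z) z (fun j => p j * g z + f z * p' j)
      (fun j => q j * g z + f z * q' j) := by
  have h := fderiv_fun_mul hf.1 hg.1
  refine ⟨hf.1.mul hg.1, fun j => ?_, fun j => ?_⟩
  · rw [← hf.2, ← hg.2, wirtinger, wirtinger, wirtinger, h]
    simp only [add_apply, smul_apply, smul_eq_mul]; ring
  · rw [← hf.3, ← hg.3, wirtingerBar, wirtingerBar, wirtingerBar, h]
    simp only [add_apply, smul_apply, smul_eq_mul]; ring

theorem pow (hf : HasWirtingerAt f z p q) (m : ℕ) :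
    HasWirtingerAt (fun z => f z ^ (m + 1)) z (fun j => (m + 1) * f z ^ m * p j)
      (fun j => (m + 1) * f z ^ m * q j) := by
  have h := (hf.1.hasFDerivAt.pow (m + 1)).fderiv
  refine ⟨hf.1.pow _, fun j => ?_, fun j => ?_⟩
  · rw [← hf.2, wirtinger, wirtinger, h]
    simp; ring
  · rw [← hf.3, wirtingerBar, wirtingerBar, h]
    simp; ring

theorem inv (hf : HasWirtingerAt f z p q) (h0 : f z ≠ 0) :
    HasWirtingerAt (fun z => (f z)⁻¹) z (fun j => -((f z)⁻¹ ^ 2 * p j))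
      (fun j => -((f z)⁻¹ ^ 2 * q j)) := by
  have h : fderiv ℝ (fun z => (f z)⁻¹) z = _ :=
    ((hasFDerivAt_inv' (𝕜 := ℝ) h0).comp z hf.1.hasFDerivAt).fderiv
  refine ⟨hf.1.inv h0, fun j => ?_, fun j => ?_⟩
  · rw [← hf.2, wirtinger, wirtinger, h]
    simp; ring
  · rw [← hf.3, wirtingerBar, wirtingerBar, h]
    simp; ring

theorem congr (hf : HasWirtingerAt f z p q) (hp : p = p') (hq : q = q') :
    HasWirtingerAt f z p' q' := by rwa [← hp, ← hq]

theorem coord (k : Fin n) (z : Cn n) :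
    HasWirtingerAt (fun z => z k) z (fun j => if j = k then 1 else 0) (fun _ => 0) := by
  have h : HasFDerivAt (fun z : Cn n => z k)
      ((EuclideanSpace.proj k : Cn n →L[ℂ] ℂ).restrictScalars ℝ) z :=
    ((EuclideanSpace.proj k : Cn n →L[ℂ] ℂ).restrictScalars ℝ).hasFDerivAt
  refine ⟨h.differentiableAt, fun j => ?_, fun j => ?_⟩
  · rw [wirtinger, h.fderiv]
    rcases eq_or_ne k j with rfl | hj
    · simp; norm_num
    · simp [hj, hj.symm]
  · rw [wirtingerBar, h.fderiv]
    rcases eq_or_ne k j with rfl | hj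
    · simp
    · simp [hj]

theorem inner_left (ζ z : Cn n) :
    HasWirtingerAt (fun z => inner ℂ ζ z) z (fun j => (starRingEnd ℂ) (ζ j)) (fun _ => 0) := by
  have h : HasFDerivAt (fun z : Cn n => inner ℂ ζ z) ((innerSL ℂ ζ).restrictScalars ℝ) z :=
    ((innerSL ℂ ζ).restrictScalars ℝ).hasFDerivAt
  refine ⟨h.differentiableAt, fun j => ?_, fun j => ?_⟩
  · rw [wirtinger, h.fderiv]
    simp [EuclideanSpace.inner_single_right]
    linear_combination (-(1/2) * (starRingEnd ℂ) (ζ j)) * Complex.I_sq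
  · rw [wirtingerBar, h.fderiv]
    simp [EuclideanSpace.inner_single_right]
    linear_combination ((starRingEnd ℂ) (ζ j)) * Complex.I_sq

theorem inner_right (ζ z : Cn n) :
    HasWirtingerAt (fun z => inner ℂ z ζ) z (fun _ => 0) (fun j => ζ j) := by
  have h : HasFDerivAt (fun z : Cn n => inner ℂ z ζ)
      (Complex.conjCLE.toContinuousLinearMap ∘L (innerSL ℂ ζ).restrictScalars ℝ) z := by
    have := (Complex.conjCLE.toContinuousLinearMap ∘L (innerSL ℂ ζ).restrictScalars ℝ).hasFDerivAt
      (x := z)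
    exact this.congr_of_eventuallyEq (.of_forall fun z => by simp)
  refine ⟨h.differentiableAt, fun j => ?_, fun j => ?_⟩
  · rw [wirtinger, h.fderiv]
    simp [EuclideanSpace.inner_single_left]
    linear_combination (ζ j) * Complex.I_sq
  · rw [wirtingerBar, h.fderiv]
    simp [EuclideanSpace.inner_single_left]
    linear_combination (-(1/2) * ζ j) * Complex.I_sq

theorem norm_sq (z : Cn n) :
    HasWirtingerAt (fun z => (‖z‖ : ℂ) ^ 2) z (fun j => (starRingEnd ℂ) (z j)) (fun j => z j) := by
  have h1 : HasFDerivAt (fun z : Cn n => ‖z‖ ^ 2) (2 • (innerSL ℝ z)) z :=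
    (hasStrictFDerivAt_norm_sq z).hasFDerivAt
  have h : HasFDerivAt (fun z : Cn n => (‖z‖ : ℂ) ^ 2)
      (Complex.ofRealCLM.comp (2 • (innerSL ℝ z))) z :=
    (Complex.ofRealCLM.hasFDerivAt.comp z h1).congr_of_eventuallyEq
      (.of_forall fun z => by simp)
  refine ⟨h.differentiableAt, fun j => ?_, fun j => ?_⟩
  · rw [wirtinger, h.fderiv]
    simp only [ContinuousLinearMap.comp_apply, smul_apply, innerSL_apply_apply,
      real_inner_Cn, EuclideanSpace.inner_single_right]
    simp [Complex.ext_iff]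
  · rw [wirtingerBar, h.fderiv]
    simp only [ContinuousLinearMap.comp_apply, smul_apply, innerSL_apply_apply,
      real_inner_Cn, EuclideanSpace.inner_single_right]
    simp [Complex.ext_iff]

end HasWirtingerAt

/-! ### The Poisson-Szegő kernel and its integrals -/

/-- The (unnormalized) Poisson-Szegő kernel `(1 - |z|²)ⁿ / |1 - ⟨z, ζ⟩|²ⁿ`, as a complex number. -/
def poisson {n : ℕ} (z ζ : Cn n) : ℂ :=
  (1 - (‖z‖ : ℂ) ^ 2) ^ n * ((1 - inner ℂ ζ z)⁻¹ ^ n * (1 - inner ℂ z ζ)⁻¹ ^ n)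

/-- The derivative `∂P/∂z̄_k` of the Poisson-Szegő kernel. -/
def poissonBar {n : ℕ} (k : Fin n) (z ζ : Cn n) : ℂ :=
  n * (1 - (‖z‖ : ℂ) ^ 2) ^ (n - 1) * ((1 - inner ℂ ζ z)⁻¹ ^ n * (1 - inner ℂ z ζ)⁻¹ ^ n) *
    ((1 - (‖z‖ : ℂ) ^ 2) * (1 - inner ℂ z ζ)⁻¹ * ζ k - z k)

/-- The second derivative `∂²P/∂z_j∂z̄_k` of the Poisson-Szegő kernel. -/
def poissonMixed {n : ℕ} (j k : Fin n) (z ζ : Cn n) : ℂ :=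
  n * (1 - (‖z‖ : ℂ) ^ 2) ^ (n - 2) * ((1 - inner ℂ ζ z)⁻¹ ^ n * (1 - inner ℂ z ζ)⁻¹ ^ n) *
    ((-(n - 1) * (starRingEnd ℂ) (z j) + n * (1 - (‖z‖ : ℂ) ^ 2) * (1 - inner ℂ ζ z)⁻¹ *
        (starRingEnd ℂ) (ζ j)) * ((1 - (‖z‖ : ℂ) ^ 2) * (1 - inner ℂ z ζ)⁻¹ * ζ k - z k)
      - (1 - (‖z‖ : ℂ) ^ 2) * (1 - inner ℂ z ζ)⁻¹ * ((starRingEnd ℂ) (z j) * ζ k)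
      - (1 - (‖z‖ : ℂ) ^ 2) * (if j = k then 1 else 0))

/-- Only the antiholomorphic derivatives of the Poisson-Szegő kernel are needed in closed form. -/
theorem hasWirtingerAt_poisson {n : ℕ} (hn : 1 < n) {z ζ : Cn n} (h1 : 1 - inner ℂ ζ z ≠ 0)
    (h2 : 1 - inner ℂ z ζ ≠ 0) :
    ∃ p, HasWirtingerAt (fun z => poisson z ζ) z p (fun k => poissonBar k z ζ) := by
  obtain ⟨m, rfl⟩ : ∃ m, n = m + 2 := ⟨n - 2, by omega⟩
  have hρ := (HasWirtingerAt.const 1 z).sub (HasWirtingerAt.norm_sq z)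
  have hA := ((HasWirtingerAt.const 1 z).sub (HasWirtingerAt.inner_left ζ z)).inv h1
  have hB := ((HasWirtingerAt.const 1 z).sub (HasWirtingerAt.inner_right ζ z)).inv h2
  have h := (hρ.pow (m + 1)).mul ((hA.pow (m + 1)).mul (hB.pow (m + 1)))
  refine ⟨_, h.congr rfl ?_⟩
  funext k
  simp only [poissonBar, show m + 2 - 1 = m + 1 by omega]
  push_cast
  ring

theorem hasWirtingerAt_poissonBar {n : ℕ} (hn : 1 < n) (k : Fin n) {z ζ : Cn n}
    (h1 : 1 - inner ℂ ζ z ≠ 0) (h2 : 1 - inner ℂ z ζ ≠ 0) :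
    ∃ q, HasWirtingerAt (fun z => poissonBar k z ζ) z (fun j => poissonMixed j k z ζ) q := by
  obtain ⟨m, rfl⟩ : ∃ m, n = m + 2 := ⟨n - 2, by omega⟩
  have hρ := (HasWirtingerAt.const 1 z).sub (HasWirtingerAt.norm_sq z)
  have hA := ((HasWirtingerAt.const 1 z).sub (HasWirtingerAt.inner_left ζ z)).inv h1
  have hB := ((HasWirtingerAt.const 1 z).sub (HasWirtingerAt.inner_right ζ z)).inv h2
  have h := (((HasWirtingerAt.const ((m + 2 : ℕ) : ℂ) z).mul (hρ.pow m)).mul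
    ((hA.pow (m + 1)).mul (hB.pow (m + 1)))).mul
      (((hρ.mul hB).mul (HasWirtingerAt.const (ζ k) z)).sub (HasWirtingerAt.coord k z))
  refine ⟨_, h.congr ?_ rfl⟩
  funext j
  simp only [poissonMixed, show m + 2 - 2 = m by omega]
  push_cast
  ring

/-- The Poisson-Szegő kernel is annihilated by the invariant Laplacian. -/
theorem sum_poissonMixed {n : ℕ} {z : Cn n} {ζ : Cn n} (hζ : ‖ζ‖ = 1)
    (h1 : 1 - inner ℂ ζ z ≠ 0) (h2 : 1 - inner ℂ z ζ ≠ 0) :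
    ∑ j : Fin n, ∑ k : Fin n, ((if j = k then 1 else 0) - z j * (starRingEnd ℂ) (z k)) *
      poissonMixed j k z ζ = 0 := by
  have key : ∀ U V : Fin n → ℂ, ∑ j : Fin n, ∑ k : Fin n,
      ((if j = k then 1 else 0) - z j * (starRingEnd ℂ) (z k)) * (U j * V k) =
      ∑ j, U j * V j - (∑ j, z j * U j) * ∑ k, (starRingEnd ℂ) (z k) * V k := by
    intro U V
    simp only [sub_mul, Finset.sum_sub_distrib, ite_mul, one_mul, zero_mul, Finset.sum_ite_eq,
      Finset.mem_univ, if_true]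
    rw [Finset.sum_mul_sum]
    congr 1
    exact Finset.sum_congr rfl fun j _ => Finset.sum_congr rfl fun k _ => by ring
  have key2 : ∑ j : Fin n, ∑ k : Fin n, ((if j = k then 1 else 0) - z j * (starRingEnd ℂ) (z k)) *
      (if j = k then 1 else 0) = (n : ℂ) - ∑ j, z j * (starRingEnd ℂ) (z j) := by
    simp [Finset.sum_sub_distrib]
  have sZ : ∑ j, z j * (starRingEnd ℂ) (z j) = (‖z‖ : ℂ) ^ 2 := by
    rw [← Complex.coe_algebraMap, ← inner_self_eq_norm_sq_to_K (𝕜 := ℂ) z, PiLp.inner_apply]; rfl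
  have sζ : ∑ j, (starRingEnd ℂ) (ζ j) * ζ j = 1 := by
    have h : inner ℂ ζ ζ = ∑ j, (starRingEnd ℂ) (ζ j) * ζ j := by
      rw [PiLp.inner_apply]; exact Finset.sum_congr rfl fun j _ => mul_comm _ _
    rw [← h, inner_self_eq_norm_sq_to_K (𝕜 := ℂ), hζ]; simp
  have sZ1 : ∑ j, (starRingEnd ℂ) (z j) * z j = (‖z‖ : ℂ) ^ 2 := by
    rw [← sZ]; exact Finset.sum_congr rfl fun j _ => mul_comm _ _
  have sI : ∑ j, z j * (starRingEnd ℂ) (ζ j) = inner ℂ ζ z := by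
    rw [PiLp.inner_apply]; rfl
  have sI1 : ∑ j, (starRingEnd ℂ) (ζ j) * z j = inner ℂ ζ z := by
    rw [← sI]; exact Finset.sum_congr rfl fun j _ => mul_comm _ _
  have sJ : ∑ j, (starRingEnd ℂ) (z j) * ζ j = inner ℂ z ζ := by
    rw [PiLp.inner_apply]; exact Finset.sum_congr rfl fun j _ => mul_comm _ _
  have hA : (1 - inner ℂ ζ z)⁻¹ * inner ℂ ζ z = (1 - inner ℂ ζ z)⁻¹ - 1 := by
    field_simp; ring
  have hB : (1 - inner ℂ z ζ)⁻¹ * inner ℂ z ζ = (1 - inner ℂ z ζ)⁻¹ - 1 := by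
    field_simp; ring
  have k1 := key (fun j => (starRingEnd ℂ) (z j)) (fun k => ζ k)
  have k2 := key (fun j => (starRingEnd ℂ) (z j)) (fun k => z k)
  have k3 := key (fun j => (starRingEnd ℂ) (ζ j)) (fun k => ζ k)
  have k4 := key (fun j => (starRingEnd ℂ) (ζ j)) (fun k => z k)
  rw [sJ, sZ] at k1
  rw [sZ1, sZ] at k2
  rw [sζ, sI, sJ] at k3
  rw [sI1, sI, sZ1] at k4
  rw [sZ] at key2
  set A := (1 - inner ℂ ζ z)⁻¹ with hAdef
  set B := (1 - inner ℂ z ζ)⁻¹ with hBdef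
  set r := (‖z‖ : ℂ) ^ 2 with hr
  have hT : ∀ j k, ((if j = k then 1 else 0) - z j * (starRingEnd ℂ) (z k)) *
      poissonMixed j k z ζ = n * (1 - r) ^ (n - 2) * (A ^ n * B ^ n) * (
        (-n * (1 - r) * B) * (((if j = k then 1 else 0) - z j * (starRingEnd ℂ) (z k)) *
          ((starRingEnd ℂ) (z j) * ζ k)) +
        (n - 1) * (((if j = k then 1 else 0) - z j * (starRingEnd ℂ) (z k)) *
          ((starRingEnd ℂ) (z j) * z k)) +
        (n * (1 - r) ^ 2 * A * B) * (((if j = k then 1 else 0) - z j * (starRingEnd ℂ) (z k)) *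
          ((starRingEnd ℂ) (ζ j) * ζ k)) +
        (-n * (1 - r) * A) * (((if j = k then 1 else 0) - z j * (starRingEnd ℂ) (z k)) *
          ((starRingEnd ℂ) (ζ j) * z k)) +
        (-(1 - r)) * (((if j = k then 1 else 0) - z j * (starRingEnd ℂ) (z k)) *
          (if j = k then 1 else 0))) := by
    intro j k
    rw [poissonMixed, ← hAdef, ← hBdef, ← hr]
    ring
  simp only [hT, ← Finset.mul_sum, Finset.sum_add_distrib, k1, k2, k3, k4, key2]
  have hc : ∀ c e : ℂ, e = 0 → c * e = 0 := fun c e h => by rw [h, mul_zero]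
  refine hc _ _ ?_
  linear_combination (-n * (1 - r) ^ 2 * (B * inner ℂ z ζ + 1)) * hA - n * (1 - r) ^ 2 * A * hB

/-- The set on which the denominators of the Poisson-Szegő kernel do not vanish, with an additional
complex variable for the values of a function on the sphere. -/
def poissonDomain (n : ℕ) : Set (Cn n × (Cn n × ℂ)) :=
  {p | 1 - inner ℂ p.2.1 p.1 ≠ 0 ∧ 1 - inner ℂ p.1 p.2.1 ≠ 0}

theorem isOpen_poissonDomain (n : ℕ) : IsOpen (poissonDomain n) :=
  (isOpen_ne_fun (by fun_prop) (by fun_prop)).inter (isOpen_ne_fun (by fun_prop) (by fun_prop))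

theorem contDiff_norm_sq_ofReal (n : ℕ) : ContDiff ℝ ∞ (fun z : Cn n => (‖z‖ : ℂ) ^ 2) := by
  have : ContDiff ℝ ∞ (fun z : Cn n => ((‖z‖ ^ 2 : ℝ) : ℂ)) :=
    Complex.ofRealCLM.contDiff.comp (contDiff_norm_sq ℝ)
  simpa using this

theorem contDiff_inner_fst_snd (n : ℕ) :
    ContDiff ℝ ∞ (fun p : Cn n × Cn n => inner ℂ p.1 p.2) := contDiff_inner

theorem contDiffOn_poisson_mul (n : ℕ) :
    ContDiffOn ℝ ∞ (fun p : Cn n × (Cn n × ℂ) => poisson p.1 p.2.1 * p.2.2) (poissonDomain n) := by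
  have h1 : ContDiff ℝ ∞ (fun p : Cn n × (Cn n × ℂ) => inner ℂ p.2.1 p.1) :=
    (contDiff_inner_fst_snd n).comp ((contDiff_fst.comp contDiff_snd).prodMk contDiff_fst)
  have h2 : ContDiff ℝ ∞ (fun p : Cn n × (Cn n × ℂ) => inner ℂ p.1 p.2.1) :=
    (contDiff_inner_fst_snd n).comp (contDiff_fst.prodMk (contDiff_fst.comp contDiff_snd))
  have h3 : ContDiff ℝ ∞ (fun p : Cn n × (Cn n × ℂ) => (‖p.1‖ : ℂ) ^ 2) :=
    (contDiff_norm_sq_ofReal n).comp contDiff_fst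
  refine ContDiffOn.mul (ContDiffOn.mul ?_ (ContDiffOn.mul (ContDiffOn.pow (ContDiffOn.inv ?_ ?_) n)
    (ContDiffOn.pow (ContDiffOn.inv ?_ ?_) n))) (by fun_prop)
  · exact ((contDiff_const.sub h3).pow n).contDiffOn
  · exact (contDiff_const.sub h1).contDiffOn
  · exact fun p hp => hp.1
  · exact (contDiff_const.sub h2).contDiffOn
  · exact fun p hp => hp.2

theorem contDiffOn_poissonBar_mul {n : ℕ} (k : Fin n) :
    ContDiffOn ℝ ∞ (fun p : Cn n × (Cn n × ℂ) => poissonBar k p.1 p.2.1 * p.2.2)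
      (poissonDomain n) := by
  have h1 : ContDiff ℝ ∞ (fun p : Cn n × (Cn n × ℂ) => inner ℂ p.2.1 p.1) :=
    (contDiff_inner_fst_snd n).comp ((contDiff_fst.comp contDiff_snd).prodMk contDiff_fst)
  have h2 : ContDiff ℝ ∞ (fun p : Cn n × (Cn n × ℂ) => inner ℂ p.1 p.2.1) :=
    (contDiff_inner_fst_snd n).comp (contDiff_fst.prodMk (contDiff_fst.comp contDiff_snd))
  have h3 : ContDiff ℝ ∞ (fun p : Cn n × (Cn n × ℂ) => (‖p.1‖ : ℂ) ^ 2) :=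
    (contDiff_norm_sq_ofReal n).comp contDiff_fst
  have hA : ContDiffOn ℝ ∞ (fun p : Cn n × (Cn n × ℂ) => (1 - inner ℂ p.2.1 p.1)⁻¹)
      (poissonDomain n) := (contDiff_const.sub h1).contDiffOn.inv fun p hp => hp.1
  have hB : ContDiffOn ℝ ∞ (fun p : Cn n × (Cn n × ℂ) => (1 - inner ℂ p.1 p.2.1)⁻¹)
      (poissonDomain n) := (contDiff_const.sub h2).contDiffOn.inv fun p hp => hp.2
  have hρ : ContDiffOn ℝ ∞ (fun p : Cn n × (Cn n × ℂ) => 1 - (‖p.1‖ : ℂ) ^ 2)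
      (poissonDomain n) := (contDiff_const.sub h3).contDiffOn
  have hz : ContDiffOn ℝ ∞ (fun p : Cn n × (Cn n × ℂ) => p.1 k) (poissonDomain n) := by fun_prop
  have hζ : ContDiffOn ℝ ∞ (fun p : Cn n × (Cn n × ℂ) => p.2.1 k) (poissonDomain n) := by fun_prop
  exact (((contDiffOn_const.mul (hρ.pow _)).mul ((hA.pow n).mul (hB.pow n))).mul
    (((hρ.mul hB).mul hζ).sub hz)).mul (by fun_prop)

/-- Wirtinger derivatives of an integral over a compact parameter space. -/
theorem wirtinger_integral {n : ℕ} {H S : Type} [NormedAddCommGroup H]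
    [NormedSpace ℝ H] [TopologicalSpace S] [CompactSpace S] [SecondCountableTopology S]
    [MeasurableSpace S] [BorelSpace S] {μ : Measure S} [IsFiniteMeasure μ] {ι : S → H}
    {O : Set (Cn n × H)} (hι : Continuous ι) (hO : IsOpen O) {G : Cn n × H → ℂ}
    (hG : ContDiffOn ℝ ∞ G O) {z : Cn n} (hz : ∀ s, (z, ι s) ∈ O) (j : Fin n) :
    wirtinger j (fun x => ∫ s, G (x, ι s) ∂μ) z = ∫ s, wirtinger j (fun x => G (x, ι s)) z ∂μ ∧
    wirtingerBar j (fun x => ∫ s, G (x, ι s) ∂μ) z =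
      ∫ s, wirtingerBar j (fun x => G (x, ι s)) z ∂μ := by
  have hd := (hasFDerivAt_integral_of_contDiffOn (μ := μ) hι hO (by simp) hG hz).fderiv
  have hD : ContinuousOn (fun p => (fderiv ℝ G p).comp (ContinuousLinearMap.inl ℝ (Cn n) H)) O :=
    (hG.continuousOn_fderiv_of_isOpen hO (by simp)).clm_comp continuousOn_const
  have hc : Continuous fun s => (fderiv ℝ G (z, ι s)).comp (ContinuousLinearMap.inl ℝ (Cn n) H) :=
    hD.comp_continuous (continuous_const.prodMk hι) hz
  have hi : Integrable (fun s => (fderiv ℝ G (z, ι s)).comp (ContinuousLinearMap.inl ℝ (Cn n) H)) μ :=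
    hc.integrable_of_compactSpace
  have hs : ∀ s, fderiv ℝ (fun x => G (x, ι s)) z =
      (fderiv ℝ G (z, ι s)).comp (ContinuousLinearMap.inl ℝ (Cn n) H) := fun s =>
    HasFDerivAt.fderiv (((hG.contDiffAt (hO.mem_nhds (hz s))).differentiableAt
      (by simp)).hasFDerivAt.comp z (hasFDerivAt_prodMk_left z (ι s)))
  have hv : ∀ v, Integrable (fun s => ((fderiv ℝ G (z, ι s)).comp
      (ContinuousLinearMap.inl ℝ (Cn n) H)) v) μ := fun v => hi.apply_continuousLinearMap v
  constructor
  · simp only [wirtinger, hs]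
    rw [hd, ContinuousLinearMap.integral_apply hi, ContinuousLinearMap.integral_apply hi,
      integral_const_mul, integral_sub (hv _) ((hv _).const_mul _), integral_const_mul]
  · simp only [wirtingerBar, hs]
    rw [hd, ContinuousLinearMap.integral_apply hi, ContinuousLinearMap.integral_apply hi,
      integral_const_mul, integral_add (hv _) ((hv _).const_mul _), integral_const_mul]

theorem mem_unitBall {n : ℕ} {z : Cn n} : z ∈ unitBall n ↔ ‖z‖ < 1 := mem_ball_zero_iff

theorem mem_poissonDomain {n : ℕ} {z : Cn n} (hz : ‖z‖ < 1) (ζ : Metric.sphere (0 : Cn n) 1)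
    (w : ℂ) :
    (z, ((ζ : Cn n), w)) ∈ poissonDomain n :=
  ⟨Complex.ne_zero_of_re_pos (sphere_re_pos hz ζ).1,
   Complex.ne_zero_of_re_pos (sphere_re_pos hz ζ).2⟩

/-- The Poisson-Szegő integral (unnormalized). -/
def poissonIntegral {n : ℕ} (g : Metric.sphere (0 : Cn n) 1 → ℂ) (z : Cn n) : ℂ :=
  ∫ ζ, poisson z (ζ : Cn n) * g ζ ∂(surfaceMeasure n)

theorem continuous_poisson {n : ℕ} {z : Cn n} (hz : ‖z‖ < 1) :
    Continuous fun ζ : Metric.sphere (0 : Cn n) 1 => poisson z (ζ : Cn n) := by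
  refine continuous_const.mul (Continuous.mul (Continuous.pow (Continuous.inv₀ (by fun_prop) ?_) n)
    (Continuous.pow (Continuous.inv₀ (by fun_prop) ?_) n))
  · exact fun ζ => Complex.ne_zero_of_re_pos (sphere_re_pos hz ζ).1
  · exact fun ζ => Complex.ne_zero_of_re_pos (sphere_re_pos hz ζ).2

theorem continuous_poissonMixed {n : ℕ} (j k : Fin n) {z : Cn n} (hz : ‖z‖ < 1) :
    Continuous fun ζ : Metric.sphere (0 : Cn n) 1 => poissonMixed j k z (ζ : Cn n) := by
  have hA : Continuous fun ζ : Metric.sphere (0 : Cn n) 1 => (1 - inner ℂ (ζ : Cn n) z)⁻¹ :=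
    Continuous.inv₀ (by fun_prop) fun ζ => Complex.ne_zero_of_re_pos (sphere_re_pos hz ζ).1
  have hB : Continuous fun ζ : Metric.sphere (0 : Cn n) 1 => (1 - inner ℂ z (ζ : Cn n))⁻¹ :=
    Continuous.inv₀ (by fun_prop) fun ζ => Complex.ne_zero_of_re_pos (sphere_re_pos hz ζ).2
  have hζ : Continuous fun ζ : Metric.sphere (0 : Cn n) 1 => (ζ : Cn n) k := by fun_prop
  have hζ' : Continuous fun ζ : Metric.sphere (0 : Cn n) 1 => (starRingEnd ℂ) ((ζ : Cn n) j) :=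
    Complex.continuous_conj.comp (by fun_prop)
  unfold poissonMixed
  fun_prop

theorem poissonIntegral_mharmonic {n : ℕ} (hn : 1 < n) {g : Metric.sphere (0 : Cn n) 1 → ℂ}
    (hg : Continuous g) : MHarmonic (poissonIntegral g) := by
  have hι : Continuous fun ζ : Metric.sphere (0 : Cn n) 1 => ((ζ : Cn n), g ζ) := by fun_prop
  constructor
  · exact contDiffOn_integral (μ := surfaceMeasure n) hι (isOpen_poissonDomain n)
      (U := unitBall n) Metric.isOpen_ball
      (fun x hx ζ => mem_poissonDomain (mem_unitBall.1 hx) ζ _) 2 (contDiffOn_poisson_mul n)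
  intro z hz
  have hz' := mem_unitBall.1 hz
  have hne : ∀ {z : Cn n}, ‖z‖ < 1 → ∀ ζ : Metric.sphere (0 : Cn n) 1,
      1 - inner ℂ (ζ : Cn n) z ≠ 0 ∧ 1 - inner ℂ z (ζ : Cn n) ≠ 0 := fun hz ζ =>
    ⟨Complex.ne_zero_of_re_pos (sphere_re_pos hz ζ).1,
     Complex.ne_zero_of_re_pos (sphere_re_pos hz ζ).2⟩
  have hbar : ∀ k, ∀ x ∈ unitBall n, wirtingerBar k (poissonIntegral g) x =
      ∫ ζ, poissonBar k x (ζ : Cn n) * g ζ ∂(surfaceMeasure n) := by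
    intro k x hx
    have hx' := mem_unitBall.1 hx
    refine (wirtinger_integral (μ := surfaceMeasure n) hι (isOpen_poissonDomain n)
      (contDiffOn_poisson_mul n) (fun ζ => mem_poissonDomain hx' ζ _) k).2.trans ?_
    congr 1
    ext ζ
    obtain ⟨p, hp⟩ := hasWirtingerAt_poisson hn (hne hx' ζ).1 (hne hx' ζ).2
    refine ((hp.mul (HasWirtingerAt.const (g ζ) x)).3 k).trans ?_
    simp
  have hmix : ∀ j k, wirtinger j (wirtingerBar k (poissonIntegral g)) z =
      ∫ ζ, poissonMixed j k z (ζ : Cn n) * g ζ ∂(surfaceMeasure n) := by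
    intro j k
    have hev : wirtingerBar k (poissonIntegral g) =ᶠ[𝓝 z]
        fun x => ∫ ζ, poissonBar k x (ζ : Cn n) * g ζ ∂(surfaceMeasure n) := by
      filter_upwards [Metric.isOpen_ball.mem_nhds hz] with x hx using hbar k x hx
    rw [wirtinger, hev.fderiv_eq]
    refine (wirtinger_integral (μ := surfaceMeasure n) hι (isOpen_poissonDomain n)
      (contDiffOn_poissonBar_mul k) (fun ζ => mem_poissonDomain hz' ζ _) j).1.trans ?_
    congr 1
    ext ζ
    obtain ⟨q, hq⟩ := hasWirtingerAt_poissonBar hn k (hne hz' ζ).1 (hne hz' ζ).2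
    refine ((hq.mul (HasWirtingerAt.const (g ζ) z)).2 j).trans ?_
    simp
  rw [invLaplacian]
  simp only [hmix, ← integral_const_mul]
  have hi : ∀ j k : Fin n, Integrable (fun ζ : Metric.sphere (0 : Cn n) 1 =>
      ((if j = k then 1 else 0) - z j * (starRingEnd ℂ) (z k)) *
        (poissonMixed j k z (ζ : Cn n) * g ζ)) (surfaceMeasure n) := fun j k =>
    (continuous_const.mul ((continuous_poissonMixed j k hz').mul hg)).integrable_of_compactSpace
  have hsum : ∑ j : Fin n, ∑ k : Fin n, ∫ ζ : Metric.sphere (0 : Cn n) 1,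
      ((if j = k then 1 else 0) - z j * (starRingEnd ℂ) (z k)) *
        (poissonMixed j k z (ζ : Cn n) * g ζ) ∂(surfaceMeasure n) = 0 := by
    rw [Finset.sum_congr rfl fun j _ => (integral_finsetSum _ fun k _ => hi j k).symm,
      ← integral_finsetSum _ fun j _ => integrable_finsetSum _ fun k _ => hi j k]
    refine integral_eq_zero_of_ae (.of_forall fun ζ => ?_)
    have := sum_poissonMixed (norm_eq_of_mem_sphere ζ) (hne hz' ζ).1 (hne hz' ζ).2
    calc _ = (∑ j : Fin n, ∑ k : Fin n, ((if j = k then 1 else 0) - z j * (starRingEnd ℂ) (z k)) *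
          poissonMixed j k z (ζ : Cn n)) * g ζ := by
          simp only [Finset.sum_mul, mul_assoc]
      _ = _ := by rw [this, zero_mul]; rfl
  rw [hsum, mul_zero]

/-- The real form of the Poisson-Szegő kernel. -/
def poissonReal {n : ℕ} (z ζ : Cn n) : ℝ := (1 - ‖z‖ ^ 2) ^ n * (‖1 - inner ℂ ζ z‖ ^ (2 * n))⁻¹

theorem poisson_eq_ofReal {n : ℕ} (z ζ : Cn n) : poisson z ζ = poissonReal z ζ := by
  rw [poisson, poissonReal, ← mul_pow, ← mul_inv]
  have h : (1 - inner ℂ ζ z) * (1 - inner ℂ z ζ) = ((‖1 - inner ℂ ζ z‖ ^ 2 : ℝ) : ℂ) := by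
    rw [← Complex.normSq_eq_norm_sq, ← Complex.mul_conj]
    simp [inner_conj_symm]
  rw [h]
  push_cast
  rw [pow_mul, inv_pow]

theorem poissonReal_nonneg {n : ℕ} {z : Cn n} (hz : ‖z‖ ≤ 1) (ζ : Cn n) : 0 ≤ poissonReal z ζ := by
  have : 0 ≤ 1 - ‖z‖ ^ 2 := by nlinarith [norm_nonneg z]
  unfold poissonReal
  positivity

theorem continuous_poissonReal {n : ℕ} {z : Cn n} (hz : ‖z‖ < 1) :
    Continuous fun ζ : Metric.sphere (0 : Cn n) 1 => poissonReal z (ζ : Cn n) := by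
  refine continuous_const.mul (Continuous.inv₀ (by fun_prop) fun ζ => ?_)
  exact pow_ne_zero _ (norm_ne_zero_iff.2 (Complex.ne_zero_of_re_pos (sphere_re_pos hz ζ).1))

/-- The power series of the integral is that of `(1 - |z|²)⁻ⁿ`, because the moments of the sphere
cancel one of the two binomial coefficients. -/
theorem integral_poisson {n : ℕ} (hn : 0 < n) {z : Cn n} (hz : ‖z‖ < 1) :
    ∫ ζ, poisson z (ζ : Cn n) ∂(surfaceMeasure n) = sphereMass n := by
  have h := hasSum_sphere_integral hn hz hz (n - 1) (n - 1)
  have hw : ‖inner ℂ z z‖ < 1 := (norm_inner_le_norm _ _).trans_lt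
    (mul_lt_one_of_nonneg_of_lt_one_left (norm_nonneg _) hz hz.le)
  have h2 := (hasSum_choose_mul_geometric_of_norm_lt_one (n - 1) hw).mul_left (sphereMass n : ℂ)
  have h3 := h.unique (Eq.mp (congrArg (fun f => HasSum f _) (funext fun k => ?_)) h2)
  · rw [Nat.sub_add_cancel hn] at h3
    calc _ = (1 - (‖z‖ : ℂ) ^ 2) ^ n * ∫ ζ, 1 / (1 - inner ℂ (ζ : Cn n) z) ^ n *
          (1 / (1 - inner ℂ z (ζ : Cn n)) ^ n) ∂(surfaceMeasure n) := by
          rw [← integral_const_mul]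
          simp only [poisson, inv_pow, one_div]
      _ = _ := by
          have h4 : (1 : ℂ) - inner ℂ z z ≠ 0 := Complex.ne_zero_of_re_pos (one_sub_re_pos hw)
          rw [h3, inner_self_eq_norm_sq_to_K (𝕜 := ℂ)] at *
          simp only [Complex.coe_algebraMap] at *
          field_simp
  · have h5 : ((k + (n - 1)).choose (n - 1) : ℂ) ≠ 0 := by
      exact_mod_cast (Nat.choose_pos (by omega)).ne'
    rw [show (n - 1 + k).choose k = (k + (n - 1)).choose (n - 1) by
      rw [add_comm, Nat.choose_symm_add]]
    field_simp

theorem integral_poissonReal {n : ℕ} (hn : 0 < n) {z : Cn n} (hz : ‖z‖ < 1) :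
    ∫ ζ, poissonReal z (ζ : Cn n) ∂(surfaceMeasure n) = sphereMass n := by
  have h := integral_poisson hn hz
  simp only [poisson_eq_ofReal, integral_complex_ofReal] at h
  exact_mod_cast h

/-- Poisson-Szegő integrals of continuous functions are even bounded, by the positivity of the
kernel and its constant mass. -/
theorem poissonIntegral_memHardy {n : ℕ} (hn : 1 < n) {g : Metric.sphere (0 : Cn n) 1 → ℂ}
    (hg : Continuous g) : MemHardy (poissonIntegral g) := by
  refine ⟨poissonIntegral_mharmonic hn hg, ?_⟩
  obtain ⟨M, hM⟩ := isCompact_univ.exists_bound_of_continuousOn hg.continuousOn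
  have hbd : ∀ z : Cn n, ‖z‖ < 1 → ‖poissonIntegral g z‖ ≤ sphereMass n * M := by
    intro z hz
    calc _ ≤ ∫ ζ : Metric.sphere (0 : Cn n) 1, poissonReal z (ζ : Cn n) * M ∂(surfaceMeasure n) := by
          refine norm_integral_le_of_norm_le
            ((continuous_poissonReal hz).mul continuous_const).integrable_of_compactSpace
            (.of_forall fun ζ => ?_)
          rw [norm_mul, poisson_eq_ofReal, Complex.norm_real,
            Real.norm_of_nonneg (poissonReal_nonneg hz.le _)]
          exact mul_le_mul_of_nonneg_left (hM ζ trivial) (poissonReal_nonneg hz.le _)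
      _ = _ := by rw [integral_mul_const, integral_poissonReal (by omega) hz]
  refine ⟨(sphereMass n * M) ^ 2 * sphereMass n, fun r h0 h1 => ?_⟩
  have h : ∀ ζ : Metric.sphere (0 : Cn n) 1, ‖‖poissonIntegral g (r • (ζ : Cn n))‖ ^ 2‖ ≤
      (sphereMass n * M) ^ 2 := fun ζ => by
    rw [norm_pow, norm_norm]
    refine pow_le_pow_left₀ (norm_nonneg _) (hbd _ ?_) 2
    rw [norm_smul, norm_eq_of_mem_sphere, mul_one, Real.norm_of_nonneg h0.le]
    exact h1
  exact (le_abs_self _).trans (norm_integral_le_of_norm_le_const (.of_forall h))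

/-- Away from `ζ` the Poisson-Szegő kernel at `r ζ` tends to zero uniformly as `r → 1`. -/
theorem poissonReal_le_of_dist {n : ℕ} {ζ η : Metric.sphere (0 : Cn n) 1} {δ r : ℝ}
    (hδ : 0 < δ) (hr : 1 / 2 < r) (hr1 : r < 1) (h : δ ≤ ‖(η : Cn n) - ζ‖) :
    poissonReal (r • (ζ : Cn n)) (η : Cn n) ≤ (1 - r ^ 2) ^ n * ((δ ^ 2 / 4) ^ (2 * n))⁻¹ := by
  have hr0 : 0 < r := by linarith
  have hnorm : ‖r • (ζ : Cn n)‖ = r := by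
    rw [norm_smul, norm_eq_of_mem_sphere, mul_one, Real.norm_of_nonneg hr0.le]
  have h1 : ‖(η : Cn n) - ζ‖ ^ 2 = 2 - 2 * (inner ℂ (η : Cn n) (ζ : Cn n)).re := by
    have := norm_sub_sq (𝕜 := ℂ) (η : Cn n) (ζ : Cn n)
    rw [norm_eq_of_mem_sphere, norm_eq_of_mem_sphere] at this
    rw [this]
    simp only [RCLike.re_to_complex]
    ring
  have h2 : δ ^ 2 ≤ ‖(η : Cn n) - ζ‖ ^ 2 := pow_le_pow_left₀ hδ.le h 2
  have h3 : δ ^ 2 / 4 ≤ ‖1 - inner ℂ (η : Cn n) (r • (ζ : Cn n))‖ := by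
    refine le_trans ?_ (Complex.re_le_norm _)
    rw [← Complex.coe_smul, inner_smul_right]
    simp only [Complex.sub_re, Complex.one_re, Complex.re_ofReal_mul]
    nlinarith [sq_nonneg δ]
  rw [poissonReal, hnorm]
  have h4 : 0 ≤ 1 - r ^ 2 := by nlinarith
  gcongr

/-- Continuous functions on the sphere are the radial boundary values of their Poisson-Szegő
integrals. -/
theorem poissonIntegral_boundary {n : ℕ} (hn : 0 < n) {g : Metric.sphere (0 : Cn n) 1 → ℂ}
    (hg : Continuous g) :
    IsRadialBoundaryValue (poissonIntegral fun ζ => (sphereMass n : ℂ)⁻¹ * g ζ) g := by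
  refine .of_forall fun ζ => ?_
  have hσ := sphereMass_pos hn
  have hnorm : ∀ r : ℝ, 0 < r → r < 1 → ‖r • (ζ : Cn n)‖ < 1 := fun r h0 h1 => by
    rw [norm_smul, norm_eq_of_mem_sphere, mul_one, Real.norm_of_nonneg h0.le]; exact h1
  have hev : ∀ᶠ r : ℝ in 𝓝[<] 1, 1 / 2 < r ∧ r < 1 := by
    filter_upwards [Ioo_mem_nhdsLT (show (1 / 2 : ℝ) < 1 by norm_num)] with r hr using hr
  have key := tendsto_integral_peak_smul_of_integrable_of_tendsto (μ := surfaceMeasure n)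
    (g := g) (l := 𝓝[<] (1 : ℝ)) (x₀ := ζ) (a := g ζ) (t := Set.univ)
    (φ := fun r η => (sphereMass n)⁻¹ * poissonReal (r • (ζ : Cn n)) (η : Cn n))
    MeasurableSet.univ univ_mem (measure_ne_top _ _) ?_ ?_ ?_ ?_
    hg.integrable_of_compactSpace hg.continuousAt
  · refine key.congr fun r => ?_
    rw [poissonIntegral]
    congr 1
    ext η
    rw [poisson_eq_ofReal, Complex.real_smul]
    push_cast
    ring
  · filter_upwards [hev] with r hr η
    exact mul_nonneg (inv_nonneg.2 hσ.le)
      (poissonReal_nonneg (hnorm r (by linarith) hr.2).le _)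
  · intro u hu hζu
    obtain ⟨δ, hδ, hball⟩ := Metric.isOpen_iff.1 hu ζ hζu
    have hlim : Tendsto (fun r : ℝ => (sphereMass n)⁻¹ * ((1 - r ^ 2) ^ n *
        ((δ ^ 2 / 4) ^ (2 * n))⁻¹)) (𝓝[<] 1) (𝓝 0) := by
      have : Continuous fun r : ℝ => (sphereMass n)⁻¹ * ((1 - r ^ 2) ^ n *
        ((δ ^ 2 / 4) ^ (2 * n))⁻¹) := by fun_prop
      have h := (this.tendsto 1).mono_left (nhdsWithin_le_nhds (s := Set.Iio 1))
      simpa [hn.ne'] using h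
    rw [Metric.tendstoUniformlyOn_iff]
    intro ε hε
    filter_upwards [hev, hlim.eventually (gt_mem_nhds hε)] with r hr hlt η hη
    have hd : δ ≤ ‖(η : Cn n) - ζ‖ := by
      by_contra hlt'
      refine hη (hball ?_)
      rw [Metric.mem_ball, Subtype.dist_eq, dist_eq_norm]
      exact not_le.1 hlt'
    have hnn := poissonReal_nonneg (hnorm r (by linarith) hr.2).le (η : Cn n)
    rw [Pi.zero_apply, dist_zero_left, Real.norm_of_nonneg (mul_nonneg (inv_nonneg.2 hσ.le) hnn)]
    exact (mul_le_mul_of_nonneg_left (poissonReal_le_of_dist hδ hr.1 hr.2 hd)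
      (inv_nonneg.2 hσ.le)).trans_lt hlt
  · refine tendsto_const_nhds.congr' ?_
    filter_upwards [hev] with r hr
    rw [Measure.restrict_univ, integral_const_mul,
      integral_poissonReal hn (hnorm r (by linarith) hr.2), inv_mul_cancel₀ hσ.ne']
  · filter_upwards [hev] with r hr
    exact (continuous_const.mul
      (continuous_poissonReal (hnorm r (by linarith) hr.2))).aestronglyMeasurable

/-! ### The Szegő kernel as an integral of Poisson-Szegő kernels -/

/-- An integrable function on a metric space that is orthogonal to all continuous functions
bounded by `1` vanishes almost everywhere. -/
theorem ae_eq_zero_of_forall_continuous {S : Type} [PseudoMetricSpace S] [MeasurableSpace S]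
    [BorelSpace S] {μ : Measure S} {h : S → ℂ} (hh : Integrable h μ)
    (H : ∀ g : S → ℂ, Continuous g → (∀ s, ‖g s‖ ≤ 1) → ∫ s, g s * h s ∂μ = 0) : h =ᵐ[μ] 0 := by
  refine ae_eq_zero_of_forall_setIntegral_isClosed_eq_zero hh fun s hs => ?_
  have hpos : ∀ m : ℕ, (0 : ℝ) < 1 / ((m : ℝ) + 1) := fun m => Nat.one_div_pos_of_nat
  have hlim := thickenedIndicator_tendsto_indicator_closure hpos
    tendsto_one_div_add_atTop_nhds_zero_nat s
  rw [hs.closure_eq, tendsto_pi_nhds] at hlim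
  have hbd : ∀ (m : ℕ) (t : S), ‖((thickenedIndicator (hpos m) s t : ℝ) : ℂ)‖ ≤ 1 := fun m t => by
    rw [Complex.norm_real, Real.norm_of_nonneg NNReal.zero_le_coe]
    exact_mod_cast thickenedIndicator_le_one (hpos m) s t
  have hcont : ∀ m : ℕ, Continuous fun t : S => ((thickenedIndicator (hpos m) s t : ℝ) : ℂ) :=
    fun m => Complex.continuous_ofReal.comp
      (NNReal.continuous_coe.comp (thickenedIndicator (hpos m) s).continuous)
  have key := tendsto_integral_of_dominated_convergence (μ := μ) (fun t => ‖h t‖)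
    (F := fun m t => ((thickenedIndicator (hpos m) s t : ℝ) : ℂ) * h t)
    (f := fun t => s.indicator h t)
    (fun m => (hcont m).aestronglyMeasurable.mul hh.1) hh.norm
    (fun m => .of_forall fun t => by
      rw [norm_mul]; exact mul_le_of_le_one_left (norm_nonneg _) (hbd m t))
    (.of_forall fun t => by
      have h1 : Tendsto (fun m => ((thickenedIndicator (hpos m) s t : ℝ) : ℂ)) atTop
          (𝓝 (((s.indicator (fun _ => (1 : NNReal)) t : NNReal) : ℝ) : ℂ)) :=
        (Complex.continuous_ofReal.tendsto _).comp
          ((NNReal.continuous_coe.tendsto _).comp (hlim t))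
      have h2 := h1.mul_const (h t)
      convert! h2 using 2
      by_cases ht : t ∈ s <;> simp [ht])
  rw [integral_indicator hs.measurableSet] at key
  refine tendsto_nhds_unique key ?_
  simp only [H _ (hcont _) (hbd _)]
  exact tendsto_const_nhds

/-- The boundary values of a Szegő kernel are given by the Poisson-Szegő kernel. -/
theorem boundary_values_eq_poisson {n : ℕ} (hn : 1 < n) {x : Cn n} (hx : ‖x‖ < 1)
    {k : Metric.sphere (0 : Cn n) 1 → ℂ}
    (hk : ∀ (f : Cn n → ℂ) (g : Metric.sphere (0 : Cn n) 1 → ℂ),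
      MemHardy f → IsRadialBoundaryValue f g → f x = ∫ ζ, g ζ * k ζ ∂(surfaceMeasure n)) :
    k =ᵐ[surfaceMeasure n] fun ζ => (sphereMass n : ℂ)⁻¹ * poisson x (ζ : Cn n) := by
  have hn0 : 0 < n := by omega
  have hσ : (sphereMass n : ℂ) ≠ 0 := by exact_mod_cast (sphereMass_pos hn0).ne'
  have hP := continuous_poisson hx
  have hcont : ∀ g : Metric.sphere (0 : Cn n) 1 → ℂ, Continuous g →
      ∫ ζ, g ζ * k ζ ∂(surfaceMeasure n) =
        ∫ ζ, g ζ * ((sphereMass n : ℂ)⁻¹ * poisson x (ζ : Cn n)) ∂(surfaceMeasure n) := by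
    intro g hg
    rw [← hk _ g (poissonIntegral_memHardy hn (continuous_const.mul hg))
      (poissonIntegral_boundary hn0 hg), poissonIntegral]
    congr 1
    ext ζ
    simp only [Pi.mul_apply]
    ring
  -- The integral of `k` equals `1`, whereas that of a non-integrable function would be `0`.
  have hki : Integrable k (surfaceMeasure n) := by
    by_contra hni
    have h := hcont (fun _ => 1) continuous_const
    simp only [one_mul] at h
    rw [integral_undef hni, integral_const_mul, integral_poisson hn0 hx, inv_mul_cancel₀ hσ] at h
    exact zero_ne_one h
  have hPi : Integrable (fun ζ : Metric.sphere (0 : Cn n) 1 => (sphereMass n : ℂ)⁻¹ *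
      poisson x (ζ : Cn n)) (surfaceMeasure n) :=
    (continuous_const.mul hP).integrable_of_compactSpace
  have := ae_eq_zero_of_forall_continuous (hki.sub hPi) fun g hg hb => by
    have h1 : Integrable (fun ζ => g ζ * k ζ) (surfaceMeasure n) :=
      hki.bdd_mul hg.aestronglyMeasurable (.of_forall hb)
    have h2 : Integrable (fun ζ : Metric.sphere (0 : Cn n) 1 => g ζ * ((sphereMass n : ℂ)⁻¹ *
        poisson x (ζ : Cn n))) (surfaceMeasure n) :=
      (hg.mul (continuous_const.mul hP)).integrable_of_compactSpace
    simp only [Pi.sub_apply, mul_sub]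
    rw [integral_sub h1 h2, hcont g hg, sub_self]
  filter_upwards [this] with ζ hζ
  exact sub_eq_zero.1 hζ

/-- The reproducing property at `y`, applied to the function `K(x, ·)` itself. -/
theorem szego_eq_integral {n : ℕ} (hn : 1 < n) {K : Cn n → Cn n → ℂ} (hK : IsSzegoKernel n K)
    {x y : Cn n} (hx : ‖x‖ < 1) (hy : ‖y‖ < 1) :
    K x y = (sphereMass n : ℂ)⁻¹ ^ 2 *
      ∫ ζ, poisson x (ζ : Cn n) * poisson y (ζ : Cn n) ∂(surfaceMeasure n) := by
  obtain ⟨k, hkb, hk⟩ := hK.reproducing x (mem_unitBall.2 hx)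
  obtain ⟨l, -, hl⟩ := hK.reproducing y (mem_unitBall.2 hy)
  rw [hl _ k (hK.memHardy_right x (mem_unitBall.2 hx)) hkb, ← integral_const_mul]
  refine integral_congr_ae ?_
  filter_upwards [boundary_values_eq_poisson hn hx hk, boundary_values_eq_poisson hn hy hl]
    with ζ h1 h2
  rw [h1, h2]
  ring

theorem szego_eq_sphereQuad {n : ℕ} (hn : 1 < n) {K : Cn n → Cn n → ℂ} (hK : IsSzegoKernel n K)
    {x y : Cn n} (hx : ‖x‖ < 1) (hy : ‖y‖ < 1) :
    K x y = (sphereMass n : ℂ)⁻¹ ^ 2 *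
      (((1 - (‖x‖ : ℂ) ^ 2) * (1 - (‖y‖ : ℂ) ^ 2)) ^ n * sphereQuad x y) := by
  rw [szego_eq_integral hn hK hx hy]
  congr 1
  rw [sphereQuad, ← integral_const_mul]
  refine integral_congr_ae (.of_forall fun ζ => ?_)
  simp only [poisson, mul_pow]
  ring

/-- The Szegő kernel is smooth in the product of the open balls. -/
theorem szego_contDiffOn {n : ℕ} (hn : 1 < n) {K : Cn n → Cn n → ℂ} (hK : IsSzegoKernel n K)
    (m : ℕ) : ContDiffOn ℝ m (fun p : Cn n × Cn n => K p.1 p.2) (unitBall n ×ˢ unitBall n) := by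
  let O : Set ((Cn n × Cn n) × Cn n) :=
    {p | (p.1.1, (p.2, (1 : ℂ))) ∈ poissonDomain n ∧ (p.1.2, (p.2, (1 : ℂ))) ∈ poissonDomain n}
  have hO : IsOpen O := ((isOpen_poissonDomain n).preimage (by fun_prop)).inter
    ((isOpen_poissonDomain n).preimage (by fun_prop))
  have hG : ContDiffOn ℝ ∞ (fun p : (Cn n × Cn n) × Cn n => poisson p.1.1 p.2 * poisson p.1.2 p.2)
      O := by
    have h1 := (contDiffOn_poisson_mul n).comp (s := O)
      (f := fun p : (Cn n × Cn n) × Cn n => (p.1.1, (p.2, (1 : ℂ)))) (by fun_prop) fun p hp => hp.1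
    have h2 := (contDiffOn_poisson_mul n).comp (s := O)
      (f := fun p : (Cn n × Cn n) × Cn n => (p.1.2, (p.2, (1 : ℂ)))) (by fun_prop) fun p hp => hp.2
    exact (h1.mul h2).congr fun p _ => by simp
  have h := contDiffOn_integral (μ := surfaceMeasure n)
    (ι := fun ζ : Metric.sphere (0 : Cn n) 1 => (ζ : Cn n)) continuous_subtype_val hO
    (U := unitBall n ×ˢ unitBall n) (Metric.isOpen_ball.prod Metric.isOpen_ball)
    (fun p hp ζ => ⟨mem_poissonDomain (mem_unitBall.1 hp.1) ζ 1,
      mem_poissonDomain (mem_unitBall.1 hp.2) ζ 1⟩) m hG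
  refine ((contDiffOn_const (c := (sphereMass n : ℂ)⁻¹ ^ 2)).mul h).congr fun p hp => ?_
  exact szego_eq_integral hn hK (mem_unitBall.1 hp.1) (mem_unitBall.1 hp.2)

/-! ### Smoothness of powers times a logarithm -/

/-- At `0` the function `sᵐ⁺¹ log s` vanishes together with its derivatives up to order `m`, so it
is of class `Cᵐ` on the whole line (`Real.log s` being `log |s|` for negative `s`). -/
theorem contDiff_pow_mul_log (m : ℕ) :
    ContDiff ℝ m (fun s : ℝ => s ^ (m + 1) * Real.log s) := by
  induction m with
  | zero => exact contDiff_zero.2 (by simpa using Real.continuous_mul_log)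
  | succ m ih =>
    have hd : ∀ s : ℝ, HasDerivAt (fun s : ℝ => s ^ (m + 2) * Real.log s)
        ((m + 2) * (s ^ (m + 1) * Real.log s) + s ^ (m + 1)) s := by
      intro s
      rcases eq_or_ne s 0 with rfl | hs
      · rw [hasDerivAt_iff_tendsto_slope]
        have hc : Continuous fun s : ℝ => s ^ m * (s * Real.log s) :=
          (continuous_pow m).mul Real.continuous_mul_log
        have h0 := (hc.tendsto 0).mono_left (nhdsWithin_le_nhds (s := {0}ᶜ))
        have h1 : ((m : ℝ) + 2) * (0 ^ (m + 1) * Real.log 0) + 0 ^ (m + 1) =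
            0 ^ m * (0 * Real.log 0) := by simp
        rw [h1]
        refine h0.congr' ?_
        filter_upwards [self_mem_nhdsWithin] with s hs
        have hs0 : s ≠ 0 := hs
        rw [slope_def_field]
        field_simp
        simp
        ring
      · refine ((hasDerivAt_pow (m + 2) s).mul (Real.hasDerivAt_log hs)).congr_deriv ?_
        push_cast
        field_simp
        ring
    have hderiv : deriv (fun s : ℝ => s ^ (m + 2) * Real.log s) =
        fun s => (m + 2) * (s ^ (m + 1) * Real.log s) + s ^ (m + 1) := funext fun s => (hd s).deriv
    rw [show ((m + 1 : ℕ) : WithTop ℕ∞) = (m : WithTop ℕ∞) + 1 by push_cast; rfl,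
      contDiff_succ_iff_deriv]
    refine ⟨fun s => (hd s).differentiableAt, by simp, ?_⟩
    rw [hderiv]
    exact (contDiff_const.mul ih).add (contDiff_id.pow (m + 1))

/-- A function of the form `b(s) sⁿ log s` with `b(0) ≠ 0` is not of class `Cⁿ` up to `0`: after
`n` differentiations and removal of the regular terms a nonzero multiple of `log s` is left. -/
theorem not_contDiffOn_mul_pow_mul_log (n : ℕ) : ∀ {φ b : ℝ → ℂ} {ε : ℝ}, 0 < ε →
    ContDiffOn ℝ n φ (Set.Icc 0 ε) → ContDiffOn ℝ n b (Set.Ioo (-ε) ε) → b 0 ≠ 0 →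
    (∀ s ∈ Set.Ioo 0 ε, φ s = b s * ((s ^ n * Real.log s : ℝ) : ℂ)) → False := by
  induction n with
  | zero =>
    intro φ b ε hε hφ hb hb0 h
    have hφ0 : Tendsto φ (𝓝[>] 0) (𝓝 (φ 0)) :=
      ((hφ.continuousOn 0 (by simp [hε.le])).mono_left
        (nhdsWithin_le_of_mem (Icc_mem_nhdsGT hε)))
    have hb' : Tendsto b (𝓝[>] 0) (𝓝 (b 0)) :=
      (hb.continuousOn.continuousAt (Ioo_mem_nhds (by linarith) hε)).tendsto.mono_left
        nhdsWithin_le_nhds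
    have hq : Tendsto (fun s => ‖φ s / b s‖) (𝓝[>] 0) (𝓝 ‖φ 0 / b 0‖) :=
      (hφ0.div hb' hb0).norm
    have hlog : Tendsto (fun s => |Real.log s|) (𝓝[>] 0) atTop :=
      tendsto_abs_atBot_atTop.comp Real.tendsto_log_nhdsGT_zero
    refine not_tendsto_nhds_of_tendsto_atTop hlog _ (hq.congr' ?_)
    filter_upwards [Ioo_mem_nhdsGT hε, hb'.eventually_ne hb0] with s hs hbs
    rw [h s hs, mul_div_cancel_left₀ _ hbs, pow_zero, one_mul, Complex.norm_real, Real.norm_eq_abs]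
  | succ n ih =>
    intro φ b ε hε hφ hb hb0 h
    have hcast : ((n + 1 : ℕ) : WithTop ℕ∞) = (n : WithTop ℕ∞) + 1 := by push_cast; rfl
    rw [hcast] at hφ hb
    have hφ' := ((contDiffOn_succ_iff_derivWithin (uniqueDiffOn_Icc hε)).1 hφ)
    have hb' := ((contDiffOn_succ_iff_deriv_of_isOpen isOpen_Ioo).1 hb)
    have hbn : ContDiffOn ℝ n b (Set.Ioo (-ε) ε) := hb.of_le (by simp)
    have hsub : Set.Icc 0 (ε / 2) ⊆ Set.Icc 0 ε := Set.Icc_subset_Icc_right (by linarith)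
    have hsub' : Set.Icc 0 (ε / 2) ⊆ Set.Ioo (-ε) ε := fun s hs =>
      ⟨by linarith [hs.1], by linarith [hs.2]⟩
    have hpow : ContDiff ℝ n fun s : ℝ => ((s ^ n : ℝ) : ℂ) :=
      Complex.ofRealCLM.contDiff.comp (contDiff_id.pow n)
    have hid : ContDiff ℝ n fun s : ℝ => (s : ℂ) := Complex.ofRealCLM.contDiff
    -- The derivative of `b sⁿ⁺¹ log s` is `(b' s + (n+1) b) sⁿ log s` and the regular term `b sⁿ`.
    refine ih (φ := fun s => derivWithin φ (Set.Icc 0 ε) s - b s * ((s ^ n : ℝ) : ℂ))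
      (b := fun s => deriv b s * (s : ℂ) + (n + 1) * b s) (ε := ε / 2) (by linarith)
      ((hφ'.2.2.mono hsub).sub ((hbn.mono hsub').mul hpow.contDiffOn))
      ((((hb'.2.2).mul hid.contDiffOn).add (contDiffOn_const.mul hbn)).mono
        (Set.Ioo_subset_Ioo (by linarith) (by linarith))) ?_ ?_
    · simp only [Complex.ofReal_zero, mul_zero, zero_add]
      exact mul_ne_zero (by exact_mod_cast Nat.succ_ne_zero n) hb0
    · intro s hs
      have hs0 : s ≠ 0 := hs.1.ne'
      have hsε : s < ε := by linarith [hs.2]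
      have hl : HasDerivAt (fun s : ℝ => s ^ (n + 1) * Real.log s)
          ((n + 1) * s ^ n * Real.log s + s ^ n) s := by
        refine ((hasDerivAt_pow (n + 1) s).mul (Real.hasDerivAt_log hs0)).congr_deriv ?_
        push_cast
        field_simp
        ring
      have hbd : HasDerivAt b (deriv b s) s :=
        ((hb'.1 s ⟨by linarith [hs.1], hsε⟩).differentiableAt
          (Ioo_mem_nhds (by linarith [hs.1]) hsε)).hasDerivAt
      have hprod := hbd.mul hl.ofReal_comp
      have hφd : HasDerivAt φ _ s := hprod.congr_of_eventuallyEq (by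
        filter_upwards [Ioo_mem_nhds hs.1 hsε] with r hr using h r hr)
      rw [derivWithin_of_mem_nhds (Icc_mem_nhds hs.1 hsε), hφd.deriv]
      push_cast
      ring

/-! ### The logarithmic term of the Szegő kernel -/

/-- The part of `segDomain` on which the logarithms of `b` and `c` are smooth. -/
def logDomain : Set (ℂ × ℂ × ℂ × ℂ) :=
  {p | 0 < p.2.1.re ∧ 0 < p.2.2.1.re ∧ p.2.1 * p.2.2.1 - p.1 * p.2.2.2 ≠ 0}

theorem isOpen_logDomain : IsOpen logDomain := by
  have hb : Continuous fun p : ℂ × ℂ × ℂ × ℂ => p.2.1.re := Complex.continuous_re.comp (by fun_prop)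
  have hc : Continuous fun p : ℂ × ℂ × ℂ × ℂ => p.2.2.1.re := Complex.continuous_re.comp (by fun_prop)
  exact (isOpen_lt continuous_const hb).inter
    ((isOpen_lt continuous_const hc).inter (isOpen_ne_fun (by fun_prop) (by fun_prop)))

theorem logDomain_subset : logDomain ⊆ segDomain := fun _ hp =>
  ⟨Complex.ne_zero_of_re_pos hp.1, Complex.ne_zero_of_re_pos hp.2.1, hp.2.2⟩

/-- The coefficient of `segInt` in the expansion of `sphereQuad`. -/
def segWeight {n : ℕ} (hn : 0 < n) (l i j : ℕ) : ℂ :=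
  expansionCoeff hn l * (splitCoeff n l i * l.choose j)

/-- The weight in which all the orders are maximal, on which the nonvanishing of the logarithm
rests. -/
theorem segWeight_self_ne_zero {n : ℕ} (hn : 0 < n) : segWeight hn n n n ≠ 0 := by
  refine mul_ne_zero (by exact_mod_cast expansionCoeff_self_ne_zero hn) (mul_ne_zero ?_ (by simp))
  rw [splitCoeff]
  refine mul_ne_zero (by simp) (div_ne_zero (mul_ne_zero ?_ ?_) ?_) <;>
    exact_mod_cast Nat.factorial_ne_zero _

/-- The coefficient of the logarithm at `(a, b, c, d) = (0, 1, 1, d)` is a polynomial in `d`, whose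
term of degree `n` comes from `l = i = j = n` only. -/
theorem exists_log_coeff_ne_zero {n : ℕ} (hn : 0 < n) : ∃ d : ℝ, 0 < d ∧ d < 1 ∧
    ∑ l ∈ Finset.range (n + 1), ∑ i ∈ Finset.range (l + 1), ∑ j ∈ Finset.range (l + 1),
      segWeight hn l i j * (((n - 1 + j).choose (n + (l - i) - 1) : ℂ) *
        (-(d : ℂ)) ^ (n - 1 + j + 1 - (n + (l - i)))) ≠ 0 := by
  -- The exponent is `j - (l - i)`, which equals `n` only for `l = i = j = n`.
  let P : Polynomial ℂ :=
    ∑ l ∈ Finset.range (n + 1), ∑ i ∈ Finset.range (l + 1), ∑ j ∈ Finset.range (l + 1),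
      Polynomial.C (segWeight hn l i j * ((n - 1 + j).choose (n + (l - i) - 1) : ℂ) *
        (-1) ^ (n - 1 + j + 1 - (n + (l - i)))) * Polynomial.X ^ (n - 1 + j + 1 - (n + (l - i)))
  have hP : P ≠ 0 := by
    intro h0
    have hc : P.coeff n = 0 := by rw [h0, Polynomial.coeff_zero]
    simp only [P, Polynomial.finsetSum_coeff, Polynomial.coeff_C_mul_X_pow] at hc
    rw [Finset.sum_eq_single n, Finset.sum_eq_single n, Finset.sum_eq_single n] at hc
    · rw [if_pos (by omega)] at hc
      refine mul_ne_zero (mul_ne_zero (segWeight_self_ne_zero hn) ?_)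
        (pow_ne_zero _ (by norm_num)) hc
      exact_mod_cast (Nat.choose_pos (by omega)).ne'
    · intro j hj hjn
      rw [Finset.mem_range] at hj
      exact if_neg (by omega)
    · simp
    · intro i hi hin
      rw [Finset.mem_range] at hi
      exact Finset.sum_eq_zero fun j hj => if_neg (by rw [Finset.mem_range] at hj; omega)
    · simp
    · intro l hl hln
      rw [Finset.mem_range] at hl
      exact Finset.sum_eq_zero fun i hi => Finset.sum_eq_zero fun j hj => if_neg (by
        rw [Finset.mem_range] at hi hj; omega)
    · simp
  have hinf : ((fun d : ℝ => (d : ℂ)) '' Set.Ioo 0 1).Infinite :=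
    (Set.Ioo_infinite one_pos).image Complex.ofReal_injective.injOn
  obtain ⟨_, ⟨d, hd, rfl⟩, hroot⟩ := hinf.exists_notMem_finset P.roots.toFinset
  refine ⟨d, hd.1, hd.2, fun h => hroot ?_⟩
  rw [Multiset.mem_toFinset, Polynomial.mem_roots hP, Polynomial.IsRoot.def, ← h]
  simp only [P, Polynomial.eval_finsetSum, Polynomial.eval_mul, Polynomial.eval_C,
    Polynomial.eval_pow, Polynomial.eval_X]
  refine Finset.sum_congr rfl fun l _ => Finset.sum_congr rfl fun i _ =>
    Finset.sum_congr rfl fun j _ => ?_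
  rw [neg_pow (d : ℂ)]
  ring

/-- The quadruple at which `segInt` is evaluated in the formula for `sphereQuad x y`. Its outer
entries are `1 - |x|²` and `1 - |y|²`. -/
def quadParam {n : ℕ} (p : Cn n × Cn n) : ℂ × ℂ × ℂ × ℂ :=
  (1 - inner ℂ p.1 p.1, 1 - inner ℂ p.1 p.2, 1 - inner ℂ p.2 p.1, 1 - inner ℂ p.2 p.2)

/-- The product `(1 - |x|²)(1 - |y|²)`, which vanishes on the boundary of the product of balls. -/
def boundaryProd {n : ℕ} (p : Cn n × Cn n) : ℝ := (1 - ‖p.1‖ ^ 2) * (1 - ‖p.2‖ ^ 2)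

theorem one_sub_inner_self {n : ℕ} (x : Cn n) :
    (1 : ℂ) - inner ℂ x x = ((1 - ‖x‖ ^ 2 : ℝ) : ℂ) := by
  rw [inner_self_eq_norm_sq_to_K]
  push_cast
  rfl

/-- Off the locus `|1 - ⟨x, y⟩|² = (1 - |x|²)(1 - |y|²)` the integral `sphereQuad`, multiplied by
`((1 - |x|²)(1 - |y|²))ⁿ`, is the sum of a smooth function and of a smooth multiple of
`sⁿ log s`, where `s = (1 - |x|²)(1 - |y|²)`. -/
theorem exists_sphereQuad_expansion {n : ℕ} (hn : 0 < n) : ∃ A B : ℂ × ℂ × ℂ × ℂ → ℂ,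
    ContDiffOn ℝ ∞ A logDomain ∧ ContDiffOn ℝ ∞ B logDomain ∧
    (∀ x y : Cn n, ‖x‖ < 1 → ‖y‖ < 1 → quadParam (x, y) ∈ logDomain →
      ((1 - (‖x‖ : ℂ) ^ 2) * (1 - (‖y‖ : ℂ) ^ 2)) ^ n * sphereQuad x y =
        A (quadParam (x, y)) + B (quadParam (x, y)) *
          ((boundaryProd (x, y) ^ n * Real.log (boundaryProd (x, y)) : ℝ) : ℂ)) ∧
    ∃ d : ℝ, 0 < d ∧ d < 1 ∧ B (0, 1, 1, (d : ℂ)) ≠ 0 := by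
  have hex : ∀ l i j : ℕ, ∃ u v : ℂ × ℂ × ℂ × ℂ → ℂ, j ≤ l →
      ContDiffOn ℝ ∞ u segDomain ∧ ContDiffOn ℝ ∞ v segDomain ∧
      (∀ a b c d : ℂ, 0 < a.re → 0 < b.re → 0 < c.re → 0 < d.re → b * c - a * d ≠ 0 →
        segInt (n - 1 + j) (n + i) (n + (l - i)) a b c d =
          u (a, b, c, d) * ((a ^ (n - 1 + j + 1 - (n + (l - i))))⁻¹ *
            (d ^ (n + (l - i) - 1 - (n - 1 + j)))⁻¹) +
          v (a, b, c, d) * (Complex.log b + Complex.log c - Complex.log a - Complex.log d)) ∧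
      ∀ d : ℂ, v (0, 1, 1, d) = if n + (l - i) = 0 then 0 else
        ((n - 1 + j).choose (n + (l - i) - 1) : ℂ) * (-d) ^ (n - 1 + j + 1 - (n + (l - i))) := by
    intro l i j
    by_cases hj : j ≤ l
    · obtain ⟨u, v, h⟩ := segInt_expansion _ (n - 1 + j) (n + i) (n + (l - i)) rfl (by omega)
      exact ⟨u, v, fun _ => h⟩
    · exact ⟨0, 0, fun h => absurd h hj⟩
  choose u v huv using hex
  -- The constant and the sum in `sphereQuad_eq`.
  let T : ℂ := feynmanConst n * (feynmanConst n * sphereMass n)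
  have hT : T ≠ 0 := mul_ne_zero (feynmanConst_ne_zero n) (mul_ne_zero (feynmanConst_ne_zero n)
    (by exact_mod_cast (sphereMass_pos hn).ne'))
  let S (f : ℕ → ℕ → ℕ → ℂ) : ℂ := ∑ l ∈ Finset.range (n + 1), ∑ i ∈ Finset.range (l + 1),
    ∑ j ∈ Finset.range (l + 1), segWeight hn l i j * f l i j
  have hS : ∀ f : ℕ → ℕ → ℕ → ℂ × ℂ × ℂ × ℂ → ℂ,
      (∀ l i j, j ≤ l → ContDiffOn ℝ ∞ (f l i j) logDomain) →
      ContDiffOn ℝ ∞ (fun p => S fun l i j => f l i j p) logDomain := fun f hf =>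
    ContDiffOn.sum fun l _ => ContDiffOn.sum fun i _ => ContDiffOn.sum fun j hj =>
      contDiffOn_const.mul (hf l i j (by rw [Finset.mem_range] at hj; omega))
  have hlog : ∀ g : ℂ × ℂ × ℂ × ℂ → ℂ, ContDiff ℝ ∞ g → (∀ p ∈ logDomain, 0 < (g p).re) →
      ContDiffOn ℝ ∞ (fun p => Complex.log (g p)) logDomain := fun g hg hpos p hp =>
    (((Complex.contDiffAt_log (Or.inl (hpos p hp)) (n := ∞)).restrict_scalars ℝ).comp p
      hg.contDiffAt).contDiffWithinAt
  have hlogbc : ContDiffOn ℝ ∞ (fun p : ℂ × ℂ × ℂ × ℂ => Complex.log p.2.1 + Complex.log p.2.2.1)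
      logDomain :=
    (hlog (fun p => p.2.1) (by fun_prop) fun p hp => hp.1).add
      (hlog (fun p => p.2.2.1) (by fun_prop) fun p hp => hp.2.1)
  refine ⟨fun p => T * S fun l i j => u l i j p *
        (p.1 ^ (n - (n - 1 + j + 1 - (n + (l - i)))) *
          p.2.2.2 ^ (n - (n + (l - i) - 1 - (n - 1 + j)))) +
        v l i j p * ((p.1 * p.2.2.2) ^ n * (Complex.log p.2.1 + Complex.log p.2.2.1)),
    fun p => -(T * S fun l i j => v l i j p), ?_, ?_, ?_, ?_⟩
  · refine contDiffOn_const.mul (hS (fun l i j p => _) fun l i j hj => ?_)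
    exact (((huv l i j hj).1.mono logDomain_subset).mul (by fun_prop)).add
      (((huv l i j hj).2.1.mono logDomain_subset).mul (ContDiffOn.mul (by fun_prop) hlogbc))
  · exact (contDiffOn_const.mul (hS v fun l i j hj =>
      (huv l i j hj).2.1.mono logDomain_subset)).neg
  · intro x y hx hy hp
    have hρ : 0 < 1 - ‖x‖ ^ 2 := by nlinarith [norm_nonneg x]
    have hρ' : 0 < 1 - ‖y‖ ^ 2 := by nlinarith [norm_nonneg y]
    rw [sphereQuad_eq hn hx hy]
    simp only [quadParam, boundaryProd] at hp ⊢
    rw [one_sub_inner_self, one_sub_inner_self] at hp ⊢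
    rw [Real.log_mul hρ.ne' hρ'.ne']
    have e1 : (1 : ℂ) - (‖x‖ : ℂ) ^ 2 = ((1 - ‖x‖ ^ 2 : ℝ) : ℂ) := by push_cast; rfl
    have e2 : (1 : ℂ) - (‖y‖ : ℂ) ^ 2 = ((1 - ‖y‖ ^ 2 : ℝ) : ℂ) := by push_cast; rfl
    rw [e1, e2]
    generalize 1 - ‖x‖ ^ 2 = ρ at *
    generalize 1 - ‖y‖ ^ 2 = ρ' at *
    have h0 : (ρ : ℂ) ≠ 0 := by exact_mod_cast hρ.ne'
    have h0' : (ρ' : ℂ) ≠ 0 := by exact_mod_cast hρ'.ne'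
    simp only [S, T]
    push_cast
    simp only [Finset.mul_sum, Finset.sum_mul, ← Finset.sum_neg_distrib, ← Finset.sum_add_distrib]
    refine Finset.sum_congr rfl fun l hl => Finset.sum_congr rfl fun i hi =>
      Finset.sum_congr rfl fun j hj => ?_
    rw [Finset.mem_range] at hl hi hj
    rw [(huv l i j (by omega)).2.2.1 ρ _ _ ρ' (by simpa using hρ) hp.1 hp.2.1 (by simpa using hρ')
      hp.2.2, ← Complex.ofReal_log hρ.le, ← Complex.ofReal_log hρ'.le]
    -- The poles of `segInt` have order at most `n` and are cancelled by the factor `(ρ ρ')ⁿ`.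
    have p1 : (ρ : ℂ) ^ n * ((ρ : ℂ) ^ (n - 1 + j + 1 - (n + (l - i))))⁻¹ =
        (ρ : ℂ) ^ (n - (n - 1 + j + 1 - (n + (l - i)))) := (pow_sub₀ _ h0 (by omega)).symm
    have p2 : (ρ' : ℂ) ^ n * ((ρ' : ℂ) ^ (n + (l - i) - 1 - (n - 1 + j)))⁻¹ =
        (ρ' : ℂ) ^ (n - (n + (l - i) - 1 - (n - 1 + j))) := (pow_sub₀ _ h0' (by omega)).symm
    rw [← p1, ← p2, segWeight]
    ring
  · obtain ⟨d, hd0, hd1, hd⟩ := exists_log_coeff_ne_zero hn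
    refine ⟨d, hd0, hd1, neg_ne_zero.2 (mul_ne_zero hT ?_)⟩
    convert hd using 1
    refine Finset.sum_congr rfl fun l _ => Finset.sum_congr rfl fun i _ =>
      Finset.sum_congr rfl fun j hj => ?_
    have hjl : j ≤ l := by rw [Finset.mem_range] at hj; omega
    simp only
    rw [(huv l i j hjl).2.2.2, if_neg (by omega)]

/-! ### Boundary regularity -/

theorem contDiff_quadParam (n : ℕ) : ContDiff ℝ ∞ (quadParam (n := n)) := by
  have h : ∀ f g : Cn n × Cn n → Cn n, ContDiff ℝ ∞ f → ContDiff ℝ ∞ g →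
      ContDiff ℝ ∞ fun p => (1 : ℂ) - inner ℂ (f p) (g p) := fun f g hf hg =>
    contDiff_const.sub (ContDiff.inner ℂ hf hg)
  exact (h _ _ contDiff_fst contDiff_fst).prodMk ((h _ _ contDiff_fst contDiff_snd).prodMk
    ((h _ _ contDiff_snd contDiff_fst).prodMk (h _ _ contDiff_snd contDiff_snd)))

theorem contDiff_boundaryProd (n : ℕ) : ContDiff ℝ ∞ (boundaryProd (n := n)) :=
  (contDiff_const.sub (contDiff_fst.norm_sq ℂ)).mul (contDiff_const.sub (contDiff_snd.norm_sq ℂ))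

theorem mem_closedBallsMinusBoundaryDiagonal {n : ℕ} {x y : Cn n} :
    (x, y) ∈ closedBallsMinusBoundaryDiagonal n ↔
      (‖x‖ ≤ 1 ∧ ‖y‖ ≤ 1) ∧ ¬ (x = y ∧ ‖x‖ = 1) := by
  rw [closedBallsMinusBoundaryDiagonal, unitBall, closure_prod_eq, closure_ball _ one_ne_zero]
  simp

/-- Away from the boundary diagonal, `⟨x, y⟩` stays away from `1` when `x` or `y` is on
the sphere. -/
theorem quadParam_mem_logDomain {n : ℕ} {x y : Cn n}
    (h : (x, y) ∈ closedBallsMinusBoundaryDiagonal n) (h0 : ‖x‖ = 1 ∨ ‖y‖ = 1) :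
    quadParam (x, y) ∈ logDomain := by
  obtain ⟨⟨hx, hy⟩, hxy⟩ := mem_closedBallsMinusBoundaryDiagonal.1 h
  have hne : x ≠ y := by
    rintro rfl
    exact hxy ⟨rfl, h0.elim id id⟩
  have hpos : 0 < ‖x - y‖ ^ 2 := pow_pos (norm_pos_iff.2 (sub_ne_zero.2 hne)) 2
  rw [norm_sub_sq (𝕜 := ℂ)] at hpos
  have hlt : (inner ℂ x y).re < 1 := by
    have : RCLike.re (inner ℂ x y) = (inner ℂ x y).re := rfl
    nlinarith [norm_nonneg x, norm_nonneg y]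
  have h1 : 0 < (1 - inner ℂ x y).re := by simpa using hlt
  have h2 : 0 < (1 - inner ℂ y x).re := by
    have : (inner ℂ y x).re = (inner ℂ x y).re := inner_re_symm (𝕜 := ℂ) y x
    simpa [this] using hlt
  refine ⟨h1, h2, ?_⟩
  simp only [quadParam]
  have h3 : (1 - inner ℂ x x) * (1 - inner ℂ y y) = 0 := by
    rw [one_sub_inner_self, one_sub_inner_self]
    rcases h0 with h0 | h0 <;> simp [h0]
  rw [h3, sub_zero]
  exact mul_ne_zero (Complex.ne_zero_of_re_pos h1) (Complex.ne_zero_of_re_pos h2)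

/-- The Szegő kernel is the sum of a smooth function and of a smooth multiple of `sⁿ log s`, where
`s = (1 - |x|²)(1 - |y|²)`, and the factor of the logarithm does not vanish identically at the
boundary. -/
theorem exists_szego_expansion {n : ℕ} (hn : 1 < n) {K : Cn n → Cn n → ℂ}
    (hK : IsSzegoKernel n K) : ∃ A B : ℂ × ℂ × ℂ × ℂ → ℂ,
    ContDiffOn ℝ ∞ A logDomain ∧ ContDiffOn ℝ ∞ B logDomain ∧
    (∀ x y : Cn n, ‖x‖ < 1 → ‖y‖ < 1 → quadParam (x, y) ∈ logDomain →
      K x y = A (quadParam (x, y)) + B (quadParam (x, y)) *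
          ((boundaryProd (x, y) ^ n * Real.log (boundaryProd (x, y)) : ℝ) : ℂ)) ∧
    ∃ d : ℝ, 0 < d ∧ d < 1 ∧ B (0, 1, 1, (d : ℂ)) ≠ 0 := by
  have hn0 : 0 < n := by omega
  obtain ⟨A, B, hA, hB, h, d, hd0, hd1, hd⟩ := exists_sphereQuad_expansion hn0
  have hσ : (sphereMass n : ℂ)⁻¹ ^ 2 ≠ 0 :=
    pow_ne_zero _ (inv_ne_zero (by exact_mod_cast (sphereMass_pos hn0).ne'))
  refine ⟨fun p => (sphereMass n : ℂ)⁻¹ ^ 2 * A p, fun p => (sphereMass n : ℂ)⁻¹ ^ 2 * B p,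
    contDiffOn_const.mul hA, contDiffOn_const.mul hB, fun x y hx hy hp => ?_,
    d, hd0, hd1, mul_ne_zero hσ hd⟩
  rw [szego_eq_sphereQuad hn hK hx hy, h x y hx hy hp]
  ring

theorem szego_isCmUpToBoundary {n : ℕ} (hn : 1 < n) {K : Cn n → Cn n → ℂ}
    (hK : IsSzegoKernel n K) : IsCmUpToBoundary n (n - 1) K := by
  classical
  obtain ⟨A, B, hA, hB, h, -⟩ := exists_szego_expansion hn hK
  let G : Cn n × Cn n → ℂ := fun p => A (quadParam p) + B (quadParam p) *
    ((boundaryProd p ^ n * Real.log (boundaryProd p) : ℝ) : ℂ)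
  let F : Cn n × Cn n → ℂ := fun p => if p ∈ unitBall n ×ˢ unitBall n then K p.1 p.2 else G p
  have hopen : IsOpen (unitBall n ×ˢ unitBall n) := Metric.isOpen_ball.prod Metric.isOpen_ball
  have hle : ((n - 1 : ℕ) : WithTop ℕ∞) ≤ ∞ := WithTop.coe_le_coe.2 le_top
  have hlog : ContDiff ℝ (n - 1 : ℕ) fun s : ℝ => s ^ n * Real.log s := by
    have := contDiff_pow_mul_log (n - 1)
    rwa [Nat.sub_add_cancel (by omega)] at this
  refine ⟨F, ?_, fun x hx y hy => if_pos ⟨hx, hy⟩⟩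
  rintro ⟨x, y⟩ hp
  by_cases hb : (x, y) ∈ unitBall n ×ˢ unitBall n
  · refine (((szego_contDiffOn hn hK (n - 1)).contDiffAt (hopen.mem_nhds hb)).congr_of_eventuallyEq
      ?_).contDiffWithinAt
    filter_upwards [hopen.mem_nhds hb] with q hq using if_pos hq
  · obtain ⟨⟨hx, hy⟩, -⟩ := mem_closedBallsMinusBoundaryDiagonal.1 hp
    have h0 : ‖x‖ = 1 ∨ ‖y‖ = 1 := by
      by_contra! hne
      exact hb ⟨mem_unitBall.2 (lt_of_le_of_ne hx hne.1), mem_unitBall.2 (lt_of_le_of_ne hy hne.2)⟩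
    have hmem := quadParam_mem_logDomain hp h0
    have hnhds := isOpen_logDomain.mem_nhds hmem
    have hq : ContDiffAt ℝ (n - 1 : ℕ) (quadParam (n := n)) (x, y) :=
      ((contDiff_quadParam n).of_le hle).contDiffAt
    have hG : ContDiffAt ℝ (n - 1 : ℕ) G (x, y) :=
      ((((hA.contDiffAt hnhds).of_le hle).comp (x, y) hq)).add
        ((((hB.contDiffAt hnhds).of_le hle).comp (x, y) hq).mul
          (Complex.ofRealCLM.contDiff.comp
            (hlog.comp ((contDiff_boundaryProd n).of_le hle))).contDiffAt)
    refine hG.contDiffWithinAt.congr_of_eventuallyEq (nhdsWithin_le_nhds ?_) (if_neg hb)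
    filter_upwards [(contDiff_quadParam n).continuous.continuousAt.preimage_mem_nhds hnhds]
      with q hq
    by_cases hqb : q ∈ unitBall n ×ˢ unitBall n
    · rw [show F q = K q.1 q.2 from if_pos hqb]
      exact h q.1 q.2 (mem_unitBall.1 hqb.1) (mem_unitBall.1 hqb.2) hq
    · exact if_neg hqb

theorem szego_hasLogSingularity {n : ℕ} (hn : 1 < n) {K : Cn n → Cn n → ℂ}
    (hK : IsSzegoKernel n K) : HasLogSingularity n K := by
  obtain ⟨A, B, hA, hB, h, d, hd0, hd1, hd⟩ := exists_szego_expansion hn hK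
  have h1d : 0 ≤ 1 - d := by linarith
  let ζ : Cn n := EuclideanSpace.single ⟨0, by omega⟩ 1
  let w : Cn n := EuclideanSpace.single ⟨1, hn⟩ ((√(1 - d) : ℝ) : ℂ)
  have hζ : ‖ζ‖ = 1 := by simp [ζ]
  have hw : ‖w‖ ^ 2 = 1 - d := by
    simp [w, Real.sq_sqrt h1d]
  have hw1 : ‖w‖ < 1 := by nlinarith [norm_nonneg w]
  have hζw : inner ℂ ζ w = 0 := by
    simp [ζ, w, EuclideanSpace.inner_single_left]
  have hwζ : inner ℂ w ζ = 0 := by rw [← inner_conj_symm, hζw, map_zero]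
  -- The orthogonality of `ζ` and `w` makes `b = c = 1` along the whole radius.
  have hq1 : quadParam ((1 : ℝ) • ζ, w) = (0, 1, 1, (d : ℂ)) := by
    simp only [quadParam, one_smul]
    rw [one_sub_inner_self, one_sub_inner_self, hw, hζ, hζw, hwζ]
    simp
  have hpath : ContDiff ℝ ∞ fun t : ℝ => quadParam (t • ζ, w) :=
    (contDiff_quadParam n).comp ((contDiff_id.smul contDiff_const).prodMk contDiff_const)
  have hmem : quadParam ((1 : ℝ) • ζ, w) ∈ logDomain := by
    rw [hq1]; simp [logDomain]
  have hnhds := isOpen_logDomain.mem_nhds hmem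
  have hcomp : ∀ f : ℂ × ℂ × ℂ × ℂ → ℂ, ContDiffOn ℝ ∞ f logDomain →
      ContDiffAt ℝ ∞ (fun t : ℝ => f (quadParam (t • ζ, w))) 1 := fun f hf =>
    ContDiffAt.comp (g := f) (1 : ℝ) (hf.contDiffAt hnhds) hpath.contDiffAt
  have hre : ∀ f : ℝ → ℝ, ContDiffAt ℝ ∞ f 1 → ContDiffAt ℝ ∞ (fun t => (f t : ℂ)) 1 :=
    fun f hf => Complex.ofRealCLM.contDiff.contDiffAt.comp (1 : ℝ) hf
  refine ⟨ζ, hζ, w, mem_unitBall.2 hw1,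
    fun t => A (quadParam (t • ζ, w)) + B (quadParam (t • ζ, w)) *
      (((((1 - t) * ((1 + t) * d)) ^ n) * Real.log ((1 + t) * d) : ℝ) : ℂ),
    fun t => B (quadParam (t • ζ, w)) * ((((1 + t) * d) ^ n : ℝ) : ℂ), ?_, ?_, ?_, ?_⟩
  · refine (hcomp A hA).add ((hcomp B hB).mul (hre _ (ContDiffAt.mul (by fun_prop) ?_)))
    exact ContDiffAt.log (by fun_prop) (by positivity)
  · exact (hcomp B hB).mul (hre _ (by fun_prop))
  · simp only
    rw [hq1]
    exact mul_ne_zero hd (by exact_mod_cast (by positivity : (0 : ℝ) < ((1 + 1) * d) ^ n).ne')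
  · have hev : ∀ᶠ t : ℝ in 𝓝[<] 1, quadParam (t • ζ, w) ∈ logDomain :=
      nhdsWithin_le_nhds (hpath.continuous.continuousAt.preimage_mem_nhds hnhds)
    filter_upwards [hev, Ioo_mem_nhdsLT (show (0 : ℝ) < 1 by norm_num)] with t ht ht01
    have htn : ‖t • ζ‖ = t := by rw [norm_smul, hζ, mul_one, Real.norm_of_nonneg ht01.1.le]
    have h1 : 0 < 1 - t := by linarith [ht01.2]
    have h2 : 0 < (1 + t) * d := mul_pos (by linarith [ht01.1]) hd0
    have hbp : boundaryProd (t • ζ, w) = (1 - t) * ((1 + t) * d) := by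
      simp only [boundaryProd, htn, hw]
      ring
    rw [h _ _ (by rw [htn]; exact ht01.2) hw1 ht, hbp, Real.log_mul h1.ne' h2.ne', mul_pow (1 - t)]
    push_cast
    ring

/-- A logarithmic singularity along a radius is incompatible with smoothness of order `n` up to the
boundary, because the radius ends at a point off the boundary diagonal. -/
theorem HasLogSingularity.not_isCmUpToBoundary {n : ℕ} {K : Cn n → Cn n → ℂ}
    (h : HasLogSingularity n K) : ¬ IsCmUpToBoundary n n K := by
  rintro ⟨F, hF, hFK⟩
  obtain ⟨ζ, hζ, w, hw, a, b, ha, hb, hb1, hab⟩ := h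
  have hle : (n : WithTop ℕ∞) ≤ ∞ := WithTop.coe_le_coe.2 le_top
  have hsub : ContDiff ℝ n fun s : ℝ => 1 - s := by fun_prop
  have ha' : ContDiffAt ℝ n (fun s : ℝ => a (1 - s)) 0 :=
    ContDiffAt.comp (g := a) (0 : ℝ) (by simpa using ha.of_le hle) hsub.contDiffAt
  have hb' : ContDiffAt ℝ n (fun s : ℝ => b (1 - s)) 0 :=
    ContDiffAt.comp (g := b) (0 : ℝ) (by simpa using hb.of_le hle) hsub.contDiffAt
  have hw1 := mem_unitBall.1 hw
  have hev : ∀ᶠ s : ℝ in 𝓝 0, 1 - s < 1 → K ((1 - s) • ζ) w =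
      a (1 - s) + b (1 - s) * (((1 - (1 - s)) ^ n * Real.log (1 - (1 - s)) : ℝ) : ℂ) := by
    have hlim : Tendsto (fun s : ℝ => 1 - s) (𝓝 0) (𝓝 1) := by
      simpa using hsub.continuous.tendsto 0
    exact hlim.eventually (eventually_nhdsWithin_iff.1 hab)
  obtain ⟨ε, hε, hball⟩ := Metric.eventually_nhds_iff_ball.1
    ((ha'.eventually (by simp)).and ((hb'.eventually (by simp)).and
      (hev.and (Iio_mem_nhds (show (0 : ℝ) < 1 by norm_num)))))
  rw [Real.ball_eq_Ioo, zero_sub, zero_add] at hball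
  have hIcc : Set.Icc 0 (ε / 2) ⊆ Set.Ioo (-ε) ε := fun s hs =>
    ⟨by linarith [hs.1], by linarith [hs.2]⟩
  have hnorm : ∀ s ∈ Set.Icc 0 (ε / 2), ‖(1 - s) • ζ‖ = 1 - s := fun s hs => by
    have hs1 : s < 1 := (hball s (hIcc hs)).2.2.2
    rw [norm_smul, hζ, mul_one, Real.norm_of_nonneg (by linarith)]
  refine not_contDiffOn_mul_pow_mul_log n (φ := fun s => F ((1 - s) • ζ, w) - a (1 - s))
    (b := fun s => b (1 - s)) (half_pos hε) ?_ ?_ (by simpa using hb1) ?_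
  · refine ContDiffOn.sub (hF.comp (f := fun s : ℝ => ((1 - s) • ζ, w))
      ((hsub.smul contDiff_const).prodMk contDiff_const).contDiffOn fun s hs => ?_)
      fun s hs => (hball s (hIcc hs)).1.contDiffWithinAt
    refine mem_closedBallsMinusBoundaryDiagonal.2 ⟨⟨?_, hw1.le⟩, fun h => ?_⟩
    · rw [hnorm s hs]
      linarith [hs.1]
    · rw [h.1] at h
      exact hw1.ne h.2
  · exact fun s hs => (hball s ⟨by linarith [hs.1], by linarith [hs.2]⟩).2.1.contDiffWithinAt
  · intro s hs
    have hs' := Set.Ioo_subset_Icc_self hs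
    have hK := (hball s (hIcc hs')).2.2.1 (by linarith [hs.1])
    rw [hFK _ (mem_unitBall.2 (by rw [hnorm s hs']; linarith [hs.1])) _ hw, hK, sub_sub_cancel]
    ring

theorem proposition3p5 (n : ℕ) (hn : 1 < n) (K : Cn n → Cn n → ℂ) (hK : IsSzegoKernel n K) :
    IsCmUpToBoundary n (n - 1) K ∧ ¬ IsCmUpToBoundary n n K ∧ HasLogSingularity n K :=
  ⟨szego_isCmUpToBoundary hn hK, (szego_hasLogSingularity hn hK).not_isCmUpToBoundary,
    szego_hasLogSingularity hn hK⟩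

end
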